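/- All graphs are finite and simple, and are counted up to isomorphism. A graph $G$ is $r$-critical if $\chi(G)=r$ and every proper subgraph of $G$ has chromatic number less than $r$. A vertex is simplicial if it is adjacent to all other vertices of the graph; adding $s$ simplicial vertices to a graph $H$ means forming the join $H\vee K_s$. For every $r\ge 6$ there are exactly twenty-two $r$-critical graphs on $r+4$ vertices. Moreover, there is a list of twenty-two pairwise non-isomorphic graphs, not depending on $r$, consisting of the unique $3$-critical graph on $7$ vertices, four $4$-critical graphs on $8$ vertices, sixteen $5$-critical graphs on $9$ vertices and one $6$-critical graph on $10$ vertices, such that for every $r\ge 6$ a graph on $r+4$ vertices is $r$-critical if and only if it is obtained from a $k$-critical graph of the list ($3\le k\le 6$) by adding $r-k\ge 0$ simplicial vertices. -/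

import Mathlib

/-- `G` is `r`-critical: its chromatic number is `r`, and every proper subgraph (fewer vertices or
fewer edges) has chromatic number less than `r`. -/
def IsCritical {V : Type*} (r : ℕ) (G : SimpleGraph V) : Prop :=
  G.chromaticNumber = r ∧ ∀ H : G.Subgraph, H ≠ ⊤ → H.coe.chromaticNumber < r

/-- The join of two vertex-disjoint graphs: their disjoint sum together with all edges between
the two vertex sets. -/
def graphJoin {V W : Type*} (G : SimpleGraph V) (H : SimpleGraph W) : SimpleGraph (V ⊕ W) :=
  (G ⊕g H) ⊔ completeBipartiteGraph V W

/-- The graph obtained from `G` by adding `s` new simplicial vertices, that is, vertices adjacent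
to all other vertices of the resulting graph. -/
def addSimplicial {V : Type*} (G : SimpleGraph V) (s : ℕ) : SimpleGraph (V ⊕ Fin s) :=
  graphJoin G (⊤ : SimpleGraph (Fin s))

/-- Isomorphism of graphs. -/
def AreIso {V W : Type*} (G : SimpleGraph V) (H : SimpleGraph W) : Prop :=
  Nonempty (G ≃g H)

/-- Isomorphism as an equivalence relation on the graphs with vertex set `Fin n`. -/
def isoSetoid (n : ℕ) : Setoid (SimpleGraph (Fin n)) where
  r G H := AreIso G H
  iseqv := ⟨fun _ => ⟨SimpleGraph.Iso.refl⟩, fun ⟨f⟩ => ⟨f.symm⟩, fun ⟨f⟩ ⟨g⟩ => ⟨f.trans g⟩⟩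

/-- The number of `r`-critical graphs on `n` vertices, up to isomorphism. -/
noncomputable def numCritical (r n : ℕ) : ℕ :=
  {q : Quotient (isoSetoid n) | ∃ G : SimpleGraph (Fin n),
    IsCritical r G ∧ Quotient.mk (isoSetoid n) G = q}.ncard

/-! ### Partial colourings and criticality -/

/-! Put `r = m + 1`: `Crit G m` is `r`-criticality, and the graphs in question have order `m + 5`.
The simplicial vertices form a clique joined to everything else. Chromatic numbers add under joins
and the factors of a critical join are critical (`Crit.exists_split`), so stripping the simplicial
vertices lowers the order and `m` equally (`Crit.exists_core`). Conversely, adding simplicial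
vertices preserves criticality, and they can be cancelled in an isomorphism. It remains to find all
critical graphs of order `m + 5` without simplicial vertices, for every `m`.

What makes this finite is Gallai's theorem: if the complement is connected, then the order is at
least `2m + 1`, and in case of equality deleting any vertex leaves a perfect matching of the
complement (`Crit.pmOn_erase`, `Crit.two_mul_add_one_le`). Its proof takes a Tutte barrier of the
complement, of maximal deficiency and then of maximal size. If Hall's condition holds between the
odd sets that need many colours and the barrier vertices, the matchings combine to an `m`-colouring.
If it fails, a worst violator shows how to recolour after a vertex deletion. Both contradict
criticality unless the barrier is empty.

For connected complement, order `m + 5` thus leaves `m = 2, 3, 4` on 7, 8, 9 vertices. For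
disconnected complement the graph is a join of two smaller critical graphs without simplicial
vertices. Each has order at least its own `m` plus 3, the 5-cycle being the only extremal case, so
the join is that of two 5-cycles.

The small orders are settled by a search whose certificates are checked in the kernel. Its starting
points come from theory: on 7 and 8 vertices pigeonhole gives an independent triple; on 9 vertices
two near-perfect matchings of the complement give an odd cycle of the complement whose remaining
vertices are paired off by non-edges. Each surviving branch yields a homomorphism from a listed
non-colourable graph of the same order, which criticality turns into an isomorphism
(`Crit.iso_of_hom`). Triangle counts separate the listed graphs, and the total is 1 + 4 + 16 + 1. -/

/-- `G` has a proper colouring of the vertices in `X` with colours below `m`. -/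
def ColOn {V : Type*} (G : SimpleGraph V) (X : Set V) (m : ℕ) : Prop :=
  ∃ c : V → ℕ, (∀ u ∈ X, c u < m) ∧ ∀ u ∈ X, ∀ v ∈ X, G.Adj u v → c u ≠ c v

/-- Criticality in terms of colourings: `G` is not `m`-colourable, but it becomes `m`-colourable
when a vertex or an edge is deleted. -/
structure Crit {V : Type*} (G : SimpleGraph V) (m : ℕ) : Prop where
  not_col : ¬ G.Colorable m
  vert : ∀ v, ColOn G {v}ᶜ m
  edge : ∀ u v, G.Adj u v → (G.deleteEdges {s(u, v)}).Colorable m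

section Coloring

variable {V W : Type*} {G : SimpleGraph V} {X Y : Set V} {m k : ℕ}

theorem ColOn.mono (h : ColOn G X m) (hY : Y ⊆ X) (hm : m ≤ k) : ColOn G Y k := by
  obtain ⟨c, hc, hp⟩ := h
  exact ⟨c, fun u hu => (hc u (hY hu)).trans_le hm, fun u hu v hv => hp u (hY hu) v (hY hv)⟩

theorem ColOn.mono_graph {G' : SimpleGraph V} (h : ColOn G X m)
    (hG : ∀ u ∈ X, ∀ v ∈ X, G'.Adj u v → G.Adj u v) : ColOn G' X m := by
  obtain ⟨c, hc, hp⟩ := h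
  exact ⟨c, hc, fun u hu v hv huv => hp u hu v hv (hG u hu v hv huv)⟩

theorem colOn_univ_iff : ColOn G Set.univ m ↔ G.Colorable m := by
  constructor
  · rintro ⟨c, hc, hp⟩
    exact ⟨SimpleGraph.Coloring.mk (fun v => (⟨c v, hc v trivial⟩ : Fin m))
      fun {u v} huv h => hp u trivial v trivial huv (by simpa using h)⟩
  · rintro ⟨c⟩
    exact ⟨fun v => c v, fun u _ => (c u).2, fun u _ v _ huv h => c.valid huv (Fin.ext h)⟩

theorem colOn_induce_iff : (G.induce X).Colorable m ↔ ColOn G X m := by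
  classical
  constructor
  · rintro ⟨c⟩
    refine ⟨fun v => if h : v ∈ X then c ⟨v, h⟩ else 0, fun u hu => ?_, fun u hu v hv huv => ?_⟩
    · simp [hu]
    · simp only [hu, hv, dif_pos]
      intro h
      exact c.valid (v := ⟨u, hu⟩) (w := ⟨v, hv⟩) (by simpa using huv) (Fin.ext h)
  · rintro ⟨c, hc, hp⟩
    exact ⟨SimpleGraph.Coloring.mk (fun v => (⟨c v, hc v v.2⟩ : Fin m))
      fun {u v} huv h => hp u u.2 v v.2 (by simpa using huv) (by simpa using h)⟩

/-- Disjoint palettes colour a union. -/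
theorem ColOn.union (hX : ColOn G X m) (hY : ColOn G Y k) : ColOn G (X ∪ Y) (m + k) := by
  classical
  obtain ⟨c, hc, hp⟩ := hX
  obtain ⟨d, hd, hq⟩ := hY
  refine ⟨fun v => if v ∈ X then c v else m + d v, ?_, ?_⟩
  · intro u hu
    by_cases h : u ∈ X
    · simp only [h, if_true]; have := hc u h; omega
    · have := hd u (hu.resolve_left h)
      simp only [h, if_false]; omega
  · intro u hu v hv huv
    by_cases h : u ∈ X <;> by_cases h' : v ∈ X
    · simpa [h, h'] using hp u h v h' huv
    · have := hc u h; simp only [h, h', if_true, if_false]; omega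
    · have := hc v h'; simp only [h, h', if_true, if_false]; omega
    · have := hq u (hu.resolve_left h) v (hv.resolve_left h') huv
      simp only [h, h', if_false]; omega

theorem colOn_empty : ColOn G ∅ 0 := ⟨fun _ => 0, by simp, by simp⟩

theorem colOn_singleton (v : V) : ColOn G {v} 1 :=
  ⟨fun _ => 0, by simp, by
    rintro u rfl w rfl h
    exact absurd h (G.loopless.irrefl _)⟩

/-- A colouring whose values on `X` lie in a finite set can be renumbered. -/
theorem colOn_of_finset (c : V → ℕ) (s : Finset ℕ) (hc : ∀ u ∈ X, c u ∈ s)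
    (hp : ∀ u ∈ X, ∀ v ∈ X, G.Adj u v → c u ≠ c v) : ColOn G X s.card := by
  classical
  let e := s.equivFin
  refine ⟨fun v => if h : c v ∈ s then e ⟨c v, h⟩ else 0, fun u hu => ?_, fun u hu v hv huv h => ?_⟩
  · simp [hc u hu]
  · simp only [hc u hu, hc v hv, dif_pos] at h
    have := e.injective (Fin.ext h)
    exact hp u hu v hv huv (by simpa using this)

/-- Completely joined sets use disjoint palettes. -/
theorem ColOn.split (h : ColOn G (X ∪ Y) m) (hXY : ∀ u ∈ X, ∀ v ∈ Y, G.Adj u v) :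
    ∃ a b, a + b = m ∧ ColOn G X a ∧ ColOn G Y b := by
  classical
  obtain ⟨c, hc, hp⟩ := h
  let s := (Finset.range m).filter fun i => ∃ u ∈ X, c u = i
  let t := (Finset.range m).filter fun i => ¬ ∃ u ∈ X, c u = i
  refine ⟨s.card, t.card, ?_, ?_, ?_⟩
  · rw [Finset.card_filter_add_card_filter_not, Finset.card_range]
  · refine colOn_of_finset c s (fun u hu => ?_) fun u hu v hv => hp u (.inl hu) v (.inl hv)
    exact Finset.mem_filter.2 ⟨Finset.mem_range.2 (hc u (.inl hu)), u, hu, rfl⟩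
  · refine colOn_of_finset c t (fun u hu => ?_) fun u hu v hv => hp u (.inr hu) v (.inr hv)
    refine Finset.mem_filter.2 ⟨Finset.mem_range.2 (hc u (.inr hu)), ?_⟩
    rintro ⟨w, hw, hwu⟩
    exact hp w (.inl hw) u (.inr hu) (hXY w hw u hu) hwu

theorem lt_succ_iff_colorable {W : Type*} (H : SimpleGraph W) :
    H.chromaticNumber < ((m + 1 : ℕ) : ℕ∞) ↔ H.Colorable m := by
  rw [← SimpleGraph.chromaticNumber_le_iff_colorable, Nat.cast_add, Nat.cast_one]
  exact ENat.lt_add_one_iff (ENat.natCast_ne_top m)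

theorem Crit.nonempty (h : Crit G m) : Nonempty V := by
  by_contra hV
  rw [not_nonempty_iff] at hV
  exact h.not_col (SimpleGraph.Colorable.of_isEmpty m)

theorem Crit.colorable_succ (h : Crit G m) : G.Colorable (m + 1) := by
  obtain ⟨v⟩ := h.nonempty
  rw [← colOn_univ_iff]
  exact ((h.vert v).union (colOn_singleton v)).mono (by intro u _; simpa using em _) le_rfl

/-- A proper subgraph misses a vertex or an edge, and colourings restrict to subgraphs, so single
deletions suffice. The index is shifted: `m` is one less than the chromatic number. -/
theorem isCritical_iff : IsCritical (m + 1) G ↔ Crit G m := by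
  classical
  constructor
  · rintro ⟨h, hs⟩
    refine ⟨fun hc => ?_, fun v => ?_, fun u v huv => ?_⟩
    · rw [← lt_succ_iff_colorable, h] at hc
      exact lt_irrefl _ hc
    · have := hs ((⊤ : G.Subgraph).deleteVerts {v}) (by
        intro h
        have : v ∈ ((⊤ : G.Subgraph).deleteVerts {v}).verts := by rw [h]; trivial
        simp at this)
      rw [lt_succ_iff_colorable] at this
      obtain ⟨c⟩ := this
      refine colOn_induce_iff.1 ⟨SimpleGraph.Coloring.mk (fun w => c ⟨w, ⟨trivial, w.2⟩⟩) ?_⟩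
      intro a b hab
      refine c.valid ?_
      have ha := a.2
      have hb := b.2
      simp only [Set.mem_compl_iff, Set.mem_singleton_iff] at ha hb
      simpa [ha, hb] using hab
    · have := hs ((⊤ : G.Subgraph).deleteEdges {s(u, v)}) (by
        intro h
        have : ((⊤ : G.Subgraph).deleteEdges {s(u, v)}).Adj u v := by rw [h]; exact huv
        simp at this)
      rw [lt_succ_iff_colorable] at this
      obtain ⟨c⟩ := this
      refine ⟨SimpleGraph.Coloring.mk (fun w => c ⟨w, by simp⟩) ?_⟩
      intro a b hab
      refine c.valid ?_
      rw [SimpleGraph.Subgraph.coe_adj, SimpleGraph.Subgraph.deleteEdges_adj]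
      rwa [SimpleGraph.deleteEdges_adj] at hab
  · intro h
    refine ⟨?_, fun H hH => ?_⟩
    · refine le_antisymm h.colorable_succ.chromaticNumber_le ?_
      rw [← not_lt, lt_succ_iff_colorable]
      exact h.not_col
    · rw [lt_succ_iff_colorable]
      by_cases hv : ∃ v, v ∉ H.verts
      · obtain ⟨v, hv⟩ := hv
        obtain ⟨c, hc, hp⟩ := h.vert v
        have hne : ∀ w ∈ H.verts, w ∈ ({v}ᶜ : Set V) := by rintro w hw rfl; exact hv hw
        exact ⟨SimpleGraph.Coloring.mk (fun w => (⟨c w, hc w (hne w w.2)⟩ : Fin m))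
          fun {a b} hab he => hp a (hne a a.2) b (hne b b.2) (H.adj_sub hab) (by simpa using he)⟩
      · push Not at hv
        have : ∃ u v, G.Adj u v ∧ ¬ H.Adj u v := by
          by_contra! hall
          refine hH (SimpleGraph.Subgraph.ext (by ext v; simp [hv v]) ?_)
          ext u v
          exact ⟨fun h => H.adj_sub h, fun h => hall u v h⟩
        obtain ⟨u, v, huv, hn⟩ := this
        obtain ⟨c⟩ := h.edge u v huv
        refine ⟨SimpleGraph.Coloring.mk (fun w => c w) fun {a b} hab => c.valid ?_⟩
        rw [SimpleGraph.deleteEdges_adj]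
        refine ⟨H.adj_sub hab, fun he => hn ?_⟩
        rw [Set.mem_singleton_iff, Sym2.eq_iff] at he
        have hab' : H.Adj a b := hab
        rcases he with ⟨h1, h2⟩ | ⟨h1, h2⟩
        · rwa [h1, h2] at hab'
        · rw [h1, h2] at hab'; exact hab'.symm

/-- A graph without isolated vertices is critical as soon as it is edge-critical. -/
theorem Crit.of_edge (h : ¬ G.Colorable m)
    (hv : ∀ v, ∃ u, G.Adj v u)
    (he : ∀ u v, G.Adj u v → (G.deleteEdges {s(u, v)}).Colorable m) : Crit G m := by
  refine ⟨h, fun v => ?_, he⟩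
  obtain ⟨u, hu⟩ := hv v
  refine ((colOn_univ_iff.2 (he v u hu)).mono (Set.subset_univ _) le_rfl).mono_graph ?_
  intro a ha b hb hab
  rw [SimpleGraph.deleteEdges_adj]
  refine ⟨hab, fun h => ?_⟩
  rw [Set.mem_singleton_iff, Sym2.eq_iff] at h
  rcases h with ⟨h1, -⟩ | ⟨-, h2⟩
  exacts [ha h1, hb h2]

theorem Crit.iso {H : SimpleGraph W} (h : Crit G m) (f : G ≃g H) : Crit H m := by
  refine ⟨fun hc => h.not_col (SimpleGraph.Colorable.of_hom f.toHom hc), fun w => ?_, fun u v huv => ?_⟩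
  · obtain ⟨c, hc, hp⟩ := h.vert (f.symm w)
    have hne : ∀ u ∈ ({w}ᶜ : Set W), f.symm u ∈ ({f.symm w}ᶜ : Set V) := by
      intro u hu he
      exact hu (f.symm.injective he)
    exact ⟨fun u => c (f.symm u), fun u hu => hc _ (hne u hu),
      fun u hu v hv huv => hp _ (hne u hu) _ (hne v hv) (f.symm.map_adj_iff.2 huv)⟩
  · obtain ⟨c⟩ := h.edge (f.symm u) (f.symm v) (f.symm.map_adj_iff.2 huv)
    refine ⟨SimpleGraph.Coloring.mk (fun w => c (f.symm w)) fun {a b} hab => c.valid ?_⟩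
    rw [SimpleGraph.deleteEdges_adj] at hab ⊢
    refine ⟨f.symm.map_adj_iff.2 hab.1, fun he => hab.2 ?_⟩
    simpa [Sym2.eq_iff] using he

/-- A homomorphism from a non-`m`-colourable graph of the same order into a critical graph is an
isomorphism. -/
theorem Crit.iso_of_hom [Finite V] {F : SimpleGraph V} (h : Crit G m) (hF : ¬ F.Colorable m)
    (f : F →g G) : AreIso G F := by
  -- If a vertex were missed, a colouring of `G` without it would pull back to `F`.
  have hs : Function.Surjective f := by
    intro v
    by_contra! hv
    obtain ⟨c, hc, hp⟩ := h.vert v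
    exact hF ⟨SimpleGraph.Coloring.mk (fun w => (⟨c (f w), hc _ (hv w)⟩ : Fin m))
      fun {a b} hab he => hp _ (hv a) _ (hv b) (f.map_adj hab) (by simpa using he)⟩
  have hb : Function.Bijective f := Finite.surjective_iff_bijective.1 hs
  -- Likewise, an edge of `G` that does not come from `F` could be deleted before pulling back a
  -- colouring.
  have : ∀ a b, G.Adj (f a) (f b) → F.Adj a b := by
    intro a b hab
    by_contra hn
    obtain ⟨c⟩ := h.edge _ _ hab
    refine hF ⟨SimpleGraph.Coloring.mk (fun w => c (f w)) fun {x y} hxy => c.valid ?_⟩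
    rw [SimpleGraph.deleteEdges_adj]
    refine ⟨f.map_adj hxy, fun he => hn ?_⟩
    rw [Set.mem_singleton_iff, Sym2.eq_iff] at he
    rcases he with ⟨h1, h2⟩ | ⟨h1, h2⟩
    · rwa [hb.1 h1, hb.1 h2] at hxy
    · rw [hb.1 h1, hb.1 h2] at hxy; exact hxy.symm
  let e : F ≃g G := ⟨Equiv.ofBijective f hb, fun {a b} => ⟨this a b, fun h => f.map_adj h⟩⟩
  exact ⟨e.symm⟩

end Coloring


/-! ### Joins -/

/-- No vertex of `G` is adjacent to all other vertices. -/
def SimplicialFree {V : Type*} (G : SimpleGraph V) : Prop :=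
  ∀ v, ∃ u, u ≠ v ∧ ¬ G.Adj v u

/-- The complement of `G` is connected, expressed by cuts. -/
def CutConn {V : Type*} (G : SimpleGraph V) : Prop :=
  ∀ X : Set V, X.Nonempty → Xᶜ.Nonempty → ∃ u ∈ X, ∃ v ∈ Xᶜ, ¬ G.Adj u v

section Join

variable {V W V' W' : Type*} {G : SimpleGraph V} {H : SimpleGraph W} {X : Set V} {m a b : ℕ}

@[simp] theorem graphJoin_inl_inl (u v : V) :
    (graphJoin G H).Adj (.inl u) (.inl v) ↔ G.Adj u v := by
  simp [graphJoin, completeBipartiteGraph]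

@[simp] theorem graphJoin_inr_inr (u v : W) :
    (graphJoin G H).Adj (.inr u) (.inr v) ↔ H.Adj u v := by
  simp [graphJoin, completeBipartiteGraph]

@[simp] theorem graphJoin_inl_inr (u : V) (v : W) :
    (graphJoin G H).Adj (.inl u) (.inr v) := by
  simp [graphJoin, completeBipartiteGraph]

@[simp] theorem graphJoin_inr_inl (u : V) (v : W) :
    (graphJoin G H).Adj (.inr v) (.inl u) := by
  simp [graphJoin, completeBipartiteGraph]

/-- Isomorphic factors give isomorphic joins. -/
def graphJoinCongr {G' : SimpleGraph V'} {H' : SimpleGraph W'} (f : G ≃g G') (g : H ≃g H') :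
    graphJoin G H ≃g graphJoin G' H' where
  toEquiv := Equiv.sumCongr f.toEquiv g.toEquiv
  map_rel_iff' := by
    rintro (u | u) (v | v) <;> simp [f.map_adj_iff, g.map_adj_iff]

/-- Decomposition of a graph along a set that is completely joined to its complement. -/
noncomputable def isoGraphJoin (hX : ∀ u ∈ X, ∀ v ∈ Xᶜ, G.Adj u v) :
    graphJoin (G.induce X) (G.induce Xᶜ) ≃g G := by
  classical
  exact
  { toEquiv := Equiv.Set.sumCompl X
    map_rel_iff' := by
      rintro (u | u) (v | v)
      · simp
      · simpa using hX u u.2 v v.2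
      · simpa using (hX v v.2 u u.2).symm
      · simp }

/-- Chromatic numbers add: `(a + 1) + (b + 1) = (a + b + 1) + 1`. Deleting a vertex, or an edge
inside a factor, saves a colour in that factor. -/
theorem Crit.graphJoin (hG : Crit G a) (hH : Crit H b) : Crit (graphJoin G H) (a + b + 1) := by
  have comp : (Set.range (Sum.inl : V → V ⊕ W)) ∪ Set.range Sum.inr = Set.univ := by
    ext (u | u) <;> simp
  refine ⟨fun hc => ?_, fun v => ?_, fun u v huv => ?_⟩
  · rw [← colOn_univ_iff, ← comp] at hc
    obtain ⟨p, q, hpq, ⟨c, hc, hcp⟩, ⟨d, hd, hdp⟩⟩ := hc.split (by rintro _ ⟨u, rfl⟩ _ ⟨v, rfl⟩; simp)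
    have h1 : a < p := by
      by_contra! hle
      exact hG.not_col (colOn_univ_iff.1 ⟨fun v => c (.inl v),
        fun u _ => (hc _ ⟨u, rfl⟩).trans_le hle,
        fun u _ v _ h => hcp _ ⟨u, rfl⟩ _ ⟨v, rfl⟩ (by simpa using h)⟩)
    have h2 : b < q := by
      by_contra! hle
      exact hH.not_col (colOn_univ_iff.1 ⟨fun v => d (.inr v),
        fun u _ => (hd _ ⟨u, rfl⟩).trans_le hle,
        fun u _ v _ h => hdp _ ⟨u, rfl⟩ _ ⟨v, rfl⟩ (by simpa using h)⟩)
    omega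
  · rcases v with v | v
    · obtain ⟨c, hc, hcp⟩ := hG.vert v
      obtain ⟨d, hd, hdp⟩ := colOn_univ_iff.2 hH.colorable_succ
      refine ⟨Sum.elim c (fun w => a + d w), ?_, ?_⟩
      · rintro (u | u) hu
        · have := hc u (by simpa using hu); simp; omega
        · have := hd u trivial; simp; omega
      · rintro (u | u) hu (w | w) hw h
        · simpa using hcp u (by simpa using hu) w (by simpa using hw) (by simpa using h)
        · have := hc u (by simpa using hu); simp; omega
        · have := hc w (by simpa using hw); simp; omega
        · simpa using hdp u trivial w trivial (by simpa using h)
    · obtain ⟨c, hc, hcp⟩ := hH.vert v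
      obtain ⟨d, hd, hdp⟩ := colOn_univ_iff.2 hG.colorable_succ
      refine ⟨Sum.elim (fun w => b + d w) c, ?_, ?_⟩
      · rintro (u | u) hu
        · have := hd u trivial; simp; omega
        · have := hc u (by simpa using hu); simp; omega
      · rintro (u | u) hu (w | w) hw h
        · simpa using hdp u trivial w trivial (by simpa using h)
        · have := hc w (by simpa using hw); simp; omega
        · have := hc u (by simpa using hu); simp; omega
        · simpa using hcp u (by simpa using hu) w (by simpa using hw) (by simpa using h)
  -- When an edge between the factors is deleted, its two ends share the extra colour `a + b`; the
  -- rest of the factors needs only `a` and `b` colours.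
  · have cross : ∀ (x : V) (y : W), ((_root_.graphJoin G H).deleteEdges {s(.inl x, .inr y)}).Colorable
        (a + b + 1) := by
      intro x y
      obtain ⟨c, hc, hcp⟩ := hG.vert x
      obtain ⟨d, hd, hdp⟩ := hH.vert y
      classical
      refine colOn_univ_iff.1 ⟨Sum.elim (fun v => if v = x then a + b else c v)
        (fun w => if w = y then a + b else a + d w), ?_, ?_⟩
      · rintro (u | u) -
        · by_cases hu : u = x
          · simp [hu]
          · have := hc u (by simpa using hu); simp [hu]; omega
        · by_cases hu : u = y
          · simp [hu]
          · have := hd u (by simpa using hu); simp [hu]; omega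
      · rintro (u | u) - (v | v) - h
        · by_cases hu : u = x <;> by_cases hv : v = x
          · subst hu hv; simp at h
          · have := hc v (by simpa using hv); simp [hu, hv]; omega
          · have := hc u (by simpa using hu); simp [hu, hv]; omega
          · simp only [Sum.elim_inl, hu, hv, if_false]
            exact hcp u (by simpa using hu) v (by simpa using hv) (by simpa using h)
        · by_cases hu : u = x <;> by_cases hv : v = y
          · subst hu hv; simp at h
          · have := hd v (by simpa using hv); simp [hu, hv]; omega
          · have := hc u (by simpa using hu); simp [hu, hv]; omega
          · have := hc u (by simpa using hu); simp [hu, hv]; omega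
        · by_cases hu : v = x <;> by_cases hv : u = y
          · subst hu hv; simp at h
          · have := hd u (by simpa using hv); simp [hu, hv]; omega
          · have := hc v (by simpa using hu); simp [hu, hv]; omega
          · have := hc v (by simpa using hu); simp [hu, hv]; omega
        · by_cases hu : u = y <;> by_cases hv : v = y
          · subst hu hv; simp at h
          · have := hd v (by simpa using hv); simp [hu, hv]; omega
          · have := hd u (by simpa using hu); simp [hu, hv]; omega
          · simp only [Sum.elim_inr, hu, hv, if_false]
            have := hdp u (by simpa using hu) v (by simpa using hv) (by simpa using h)
            omega
    rcases u with u | u <;> rcases v with v | v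
    · obtain ⟨c⟩ := hG.edge u v (by simpa using huv)
      obtain ⟨d⟩ := hH.colorable_succ
      refine colOn_univ_iff.1 ⟨Sum.elim (fun v => c v) (fun w => a + d w), ?_, ?_⟩
      · rintro (w | w) -
        · have := (c w).2; simp; omega
        · have := (d w).2; simp; omega
      · rintro (x | x) - (y | y) - h
        · have := c.valid (v := x) (w := y) (by simpa using h)
          simpa [Fin.ext_iff] using this
        · have := (c x).2; simp; omega
        · have := (c y).2; simp; omega
        · have := d.valid (v := x) (w := y) (by simpa using h)
          simpa [Fin.ext_iff] using this
    · exact cross u v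
    · rw [Sym2.eq_swap]; exact cross v u
    · obtain ⟨c⟩ := hH.edge u v (by simpa using huv)
      obtain ⟨d⟩ := hG.colorable_succ
      refine colOn_univ_iff.1 ⟨Sum.elim (fun w => b + d w) (fun v => c v), ?_, ?_⟩
      · rintro (w | w) -
        · have := (d w).2; simp; omega
        · have := (c w).2; simp; omega
      · rintro (x | x) - (y | y) - h
        · have := d.valid (v := x) (w := y) (by simpa using h)
          simpa [Fin.ext_iff] using this
        · have := (c y).2; simp; omega
        · have := (c x).2; simp; omega
        · have := c.valid (v := x) (w := y) (by simpa using h)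
          simpa [Fin.ext_iff] using this

/-- The factor on `X` of a critical join is critical. Here `p` and `q` are the chromatic numbers
of the two factors. -/
theorem Crit.induce_of_join {p q : ℕ} (h : Crit G m) (hX : ∀ u ∈ X, ∀ v ∈ Xᶜ, G.Adj u v)
    (hp : ∀ k, ColOn G X k → p ≤ k) (hq : ∀ k, ColOn G Xᶜ k → q ≤ k) (hpq : p + q = m + 1)
    (hp0 : 0 < p) : Crit (G.induce X) (p - 1) := by
  refine ⟨?_, ?_, ?_⟩
  · rw [colOn_induce_iff]
    intro hc
    have := hp _ hc
    omega
  · rintro ⟨x, hx⟩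
    have : ColOn G ((X \ {x}) ∪ Xᶜ) m := (h.vert x).mono (by
      rintro u (hu | hu)
      · exact hu.2
      · rintro rfl; exact hu hx) le_rfl
    obtain ⟨k, l, hkl, ⟨c, hc, hcp⟩, hl⟩ := this.split fun u hu v hv => hX u hu.1 v hv
    -- The part `Xᶜ` still takes `q` colours, which leaves at most `m - q = p - 1` for `X` without
    -- `x`.
    have hle : k ≤ p - 1 := by have := hq l hl; omega
    refine ⟨fun u => c u, fun u hu => ?_, fun u hu v hv huv => ?_⟩
    · exact (hc u ⟨u.2, fun he => hu (Subtype.ext he)⟩).trans_le hle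
    · exact hcp u ⟨u.2, fun he => hu (Subtype.ext he)⟩ v ⟨v.2, fun he => hv (Subtype.ext he)⟩
        (by simpa using huv)
  · rintro ⟨x, hx⟩ ⟨y, hy⟩ hxy
    -- The deleted edge lies inside `X`, so edges with an end in `Xᶜ` survive.
    have hd : ∀ u, ∀ v ∈ Xᶜ, G.Adj u v → (G.deleteEdges {s(x, y)}).Adj u v := by
      intro u v hv huv
      rw [SimpleGraph.deleteEdges_adj]
      refine ⟨huv, fun he => hv ?_⟩
      rw [Set.mem_singleton_iff, Sym2.eq_iff] at he
      rcases he with ⟨-, rfl⟩ | ⟨-, rfl⟩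
      exacts [hy, hx]
    have hc := h.edge x y (by simpa using hxy)
    rw [← colOn_univ_iff, ← Set.union_compl_self X] at hc
    obtain ⟨k, l, hkl, ⟨c, hc, hcp⟩, hl⟩ := hc.split fun u hu v hv => hd u v hv (hX u hu v hv)
    have hle : k ≤ p - 1 := by
      have := hq l (hl.mono_graph fun u _ v hv huv => hd u v hv huv)
      omega
    refine colOn_univ_iff.1 ⟨fun u => c u, fun u _ => ?_, fun u _ v _ huv => ?_⟩
    · exact (hc u u.2).trans_le hle
    · refine hcp u u.2 v v.2 ?_
      rw [SimpleGraph.deleteEdges_adj] at huv ⊢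
      refine ⟨by simpa using huv.1, fun he => huv.2 ?_⟩
      simpa [Sym2.eq_iff, Subtype.ext_iff] using he

/-- The factors of a critical join are critical. -/
theorem Crit.exists_split (h : Crit G m) (hX : ∀ u ∈ X, ∀ v ∈ Xᶜ, G.Adj u v) (hne : X.Nonempty)
    (hne' : Xᶜ.Nonempty) :
    ∃ a b, a + b + 1 = m ∧ Crit (G.induce X) a ∧ Crit (G.induce Xᶜ) b := by
  classical
  have exX : ∀ Z : Set V, ∃ p, ColOn G Z p := fun Z =>
    ⟨m + 1, (colOn_univ_iff.2 h.colorable_succ).mono (Set.subset_univ _) le_rfl⟩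
  obtain ⟨p, hp, hpm⟩ : ∃ p, ColOn G X p ∧ ∀ k, ColOn G X k → p ≤ k :=
    ⟨_, Nat.find_spec (exX X), fun k hk => Nat.find_min' _ hk⟩
  obtain ⟨q, hq, hqm⟩ : ∃ p, ColOn G Xᶜ p ∧ ∀ k, ColOn G Xᶜ k → p ≤ k :=
    ⟨_, Nat.find_spec (exX Xᶜ), fun k hk => Nat.find_min' _ hk⟩
  have hm : m < p + q := by
    by_contra! hle
    exact h.not_col (colOn_univ_iff.1 ((hp.union hq).mono (by simp) hle))
  -- For the upper bound delete a vertex of `X`: the `m`-colouring splits over the join, and putting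
  -- the vertex back costs at most one colour.
  have hpq : p + q = m + 1 := by
    obtain ⟨x, hx⟩ := hne
    have : ColOn G ((X \ {x}) ∪ Xᶜ) m := (h.vert x).mono (by
      rintro u (hu | hu)
      · exact hu.2
      · rintro rfl; exact hu hx) le_rfl
    obtain ⟨k, l, hkl, hk, hl⟩ := this.split fun u hu v hv => hX u hu.1 v hv
    have h1 := hqm l hl
    have h2 := hpm (k + 1) ((hk.union (colOn_singleton x)).mono
      (by intro u hu; by_cases u = x <;> simp_all) le_rfl)
    omega
  have pos : ∀ (Z : Set V) (k : ℕ), Z.Nonempty → ColOn G Z k → 0 < k := by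
    rintro Z k ⟨x, hx⟩ ⟨c, hc, -⟩
    exact (Nat.zero_le _).trans_lt (hc x hx)
  have hp0 := pos X p hne hp
  have hq0 := pos Xᶜ q hne' hq
  refine ⟨p - 1, q - 1, by omega, h.induce_of_join hX hpm hqm hpq hp0,
    h.induce_of_join (q := p) ?_ hqm ?_ (by omega) hq0⟩
  · intro u hu v hv
    exact (hX v (by simpa using hv) u hu).symm
  · simpa using hpm

end Join


/-! ### Critical graphs of small order with connected complement -/

/-- The complement of `G` has a perfect matching on `X`, given by an involution. -/
def PMOn {V : Type*} (G : SimpleGraph V) (X : Finset V) : Prop :=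
  ∃ f : V → V, ∀ u ∈ X, f u ∈ X ∧ f u ≠ u ∧ f (f u) = u ∧ ¬ G.Adj u (f u)

/-- A set `S` together with disjoint odd sets, each of which is separated by `S` in the complement
of `G`, restricted to `X`. -/
structure Barrier {V : Type*} [DecidableEq V] (G : SimpleGraph V) (X S : Finset V)
    (𝒬 : Finset (Finset V)) : Prop where
  subset : S ⊆ X
  sub : ∀ Q ∈ 𝒬, Q ⊆ X \ S
  odd : ∀ Q ∈ 𝒬, Odd Q.card
  disj : ∀ Q ∈ 𝒬, ∀ Q' ∈ 𝒬, Q ≠ Q' → Disjoint Q Q'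
  join : ∀ Q ∈ 𝒬, ∀ u ∈ Q, ∀ v ∈ X \ S, v ∉ Q → G.Adj u v

section Gallai

variable {V : Type*} [DecidableEq V] {G : SimpleGraph V}

theorem pmOn_of_isPerfectMatching {X : Finset V} {M : (Gᶜ.induce (X : Set V)).Subgraph}
    (hM : M.IsPerfectMatching) : PMOn G X := by
  classical
  rw [SimpleGraph.Subgraph.isPerfectMatching_iff] at hM
  choose g hg hu using hM
  refine ⟨fun v => if h : v ∈ X then g ⟨v, h⟩ else v, fun u hu' => ?_⟩
  have hadj := M.adj_sub (hg ⟨u, hu'⟩)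
  have hmem : (g ⟨u, hu'⟩ : V) ∈ X := (g ⟨u, hu'⟩).2
  have hadj' : Gᶜ.Adj u (g ⟨u, hu'⟩) := by simpa using hadj
  rw [SimpleGraph.compl_adj] at hadj'
  simp only [hu', dif_pos, hmem]
  refine ⟨trivial, Ne.symm hadj'.1, ?_, hadj'.2⟩
  exact congrArg Subtype.val (hu (g ⟨u, hu'⟩) ⟨u, hu'⟩ (hg ⟨u, hu'⟩).symm).symm

/-- Tutte's theorem for the complement on `X`: the violator becomes `S` and the odd components
become the odd sets. Distinct components of the complement are completely joined in `G`. -/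
theorem exists_barrier_of_not_pmOn {X : Finset V} (h : ¬ PMOn G X) :
    ∃ S 𝒬, Barrier G X S 𝒬 ∧ S.card < 𝒬.card := by
  classical
  have : ∃ u, (Gᶜ.induce (X : Set V)).IsTutteViolator u := by
    by_contra! hn
    obtain ⟨M, hM⟩ := SimpleGraph.tutte.2 hn
    exact h (pmOn_of_isPerfectMatching hM)
  obtain ⟨U, hU⟩ := this
  unfold SimpleGraph.IsTutteViolator at hU
  set J := ((⊤ : (Gᶜ.induce (X : Set V)).Subgraph).deleteVerts U) with hJ
  have hfin : J.coe.oddComponents.Finite := Set.toFinite _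
  let val : J.verts → V := fun x => x.1.1
  have hval : Function.Injective val := fun x y hxy => Subtype.ext (Subtype.ext hxy)
  let S : Finset V := U.toFinset.map ⟨Subtype.val, Subtype.val_injective⟩
  let F : J.coe.ConnectedComponent → Finset V := fun c => c.supp.toFinset.map ⟨val, hval⟩
  have memF : ∀ c v, v ∈ F c ↔ ∃ x : J.verts, J.coe.connectedComponentMk x = c ∧ val x = v := by
    intro c v
    simp [F]
  have Finj : Function.Injective F := by
    intro c d hcd
    obtain ⟨x, hx⟩ := c.nonempty_supp
    have : val x ∈ F d := by rw [← hcd, memF]; exact ⟨x, hx, rfl⟩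
    rw [memF] at this
    obtain ⟨y, hy, hxy⟩ := this
    rw [← hy, hval hxy]
    exact (SimpleGraph.ConnectedComponent.mem_supp_iff _ _).1 hx |>.symm
  have memJ : ∀ v, v ∈ X \ S → ∃ x : J.verts, val x = v := by
    intro v hv
    rw [Finset.mem_sdiff] at hv
    refine ⟨⟨⟨v, hv.1⟩, trivial, fun hvU => hv.2 ?_⟩, rfl⟩
    simp only [S, Finset.mem_map, Set.mem_toFinset]
    exact ⟨⟨v, hv.1⟩, hvU, rfl⟩
  refine ⟨S, hfin.toFinset.map ⟨F, Finj⟩, ⟨?_, ?_, ?_, ?_, ?_⟩, ?_⟩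
  · intro v hv
    simp only [S, Finset.mem_map] at hv
    obtain ⟨x, -, rfl⟩ := hv
    exact x.2
  · intro Q hQ v hv
    simp only [Finset.mem_map] at hQ
    obtain ⟨c, -, rfl⟩ := hQ
    obtain ⟨x, -, rfl⟩ := (memF _ _).1 hv
    refine Finset.mem_sdiff.2 ⟨x.1.2, fun hS => ?_⟩
    simp only [S, Finset.mem_map, Set.mem_toFinset] at hS
    obtain ⟨y, hy, hxy⟩ := hS
    have : y = x.1 := Subtype.ext hxy
    exact x.2.2 (this ▸ hy)
  · intro Q hQ
    simp only [Finset.mem_map, Set.Finite.mem_toFinset] at hQ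
    obtain ⟨c, hc, rfl⟩ := hQ
    have hc' : Odd c.supp.ncard := hc
    rw [Set.ncard_eq_toFinset_card'] at hc'
    simpa [F] using hc'
  · intro Q hQ Q' hQ' hne
    simp only [Finset.mem_map] at hQ hQ'
    obtain ⟨c, -, rfl⟩ := hQ
    obtain ⟨d, -, rfl⟩ := hQ'
    rw [Finset.disjoint_left]
    intro v hv hv'
    obtain ⟨x, hx, hxv⟩ := (memF _ _).1 hv
    obtain ⟨y, hy, hyv⟩ := (memF _ _).1 hv'
    have : x = y := hval (hxv.trans hyv.symm)
    subst this
    exact hne (by rw [← hx, ← hy])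
  · intro Q hQ u hu v hv hvQ
    simp only [Finset.mem_map] at hQ
    obtain ⟨c, -, rfl⟩ := hQ
    obtain ⟨x, hx, rfl⟩ := (memF _ _).1 hu
    obtain ⟨y, rfl⟩ := memJ v hv
    by_contra hn
    refine hvQ ((memF _ _).2 ⟨y, ?_, rfl⟩)
    rw [← hx]
    refine (SimpleGraph.ConnectedComponent.sound (SimpleGraph.Adj.reachable ?_)).symm
    have hne : val x ≠ val y := by
      intro he
      exact hvQ (he ▸ hu)
    have : (Gᶜ.induce (X : Set V)).Adj x.1 y.1 := by
      rw [SimpleGraph.comap_adj, SimpleGraph.compl_adj]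
      exact ⟨hne, hn⟩
    exact SimpleGraph.Subgraph.deleteVerts_adj.2 ⟨trivial, x.2.2, trivial, y.2.2, this⟩
  · rw [Finset.card_map, Finset.card_map, ← Set.ncard_eq_toFinset_card _ hfin,
      ← Set.ncard_eq_toFinset_card']
    exact hU

theorem Barrier.card_biUnion {X S : Finset V} {𝒬 : Finset (Finset V)} (h : Barrier G X S 𝒬) :
    (𝒬.biUnion id).card = ∑ Q ∈ 𝒬, Q.card :=
  Finset.card_biUnion fun Q hQ Q' hQ' hne => h.disj Q hQ Q' hQ' hne

theorem Barrier.nonempty {X S : Finset V} {𝒬 : Finset (Finset V)} (h : Barrier G X S 𝒬)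
    {Q : Finset V} (hQ : Q ∈ 𝒬) : Q.Nonempty :=
  Finset.card_pos.1 (h.odd Q hQ).pos

theorem even_sum_add_card (𝒬 : Finset (Finset V)) (h : ∀ Q ∈ 𝒬, Odd Q.card) :
    Even (∑ Q ∈ 𝒬, Q.card + 𝒬.card) := by
  induction 𝒬 using Finset.induction_on with
  | empty => simp
  | insert Q 𝒬 hQ ih =>
    rw [Finset.sum_insert hQ, Finset.card_insert_of_notMem hQ]
    have h1 := h Q (Finset.mem_insert_self _ _)
    have h2 := ih fun Q' hQ' => h Q' (Finset.mem_insert_of_mem hQ')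
    grind

/-- On a set of even order, the leftover part can be added to correct the parity. -/
theorem Barrier.exists_add_two_le {X S : Finset V} {𝒬 : Finset (Finset V)} (h : Barrier G X S 𝒬)
    (hX : Even X.card) (hc : S.card < 𝒬.card) :
    ∃ 𝒬', Barrier G X S 𝒬' ∧ S.card + 2 ≤ 𝒬'.card := by
  by_cases h2 : S.card + 2 ≤ 𝒬.card
  · exact ⟨𝒬, h, h2⟩
  have hsub : 𝒬.biUnion id ⊆ X \ S := Finset.biUnion_subset.2 h.sub
  set L := (X \ S) \ 𝒬.biUnion id with hL
  have hcard : L.card + ∑ Q ∈ 𝒬, Q.card + S.card = X.card := by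
    rw [← h.card_biUnion, hL, Finset.card_sdiff_add_card_eq_card hsub,
      Finset.card_sdiff_add_card_eq_card h.subset]
  -- Modulo 2 the sum of the `|Q|` is `|𝒬| = |S| + 1`, so it cancels against `|S|` up to 1, while
  -- `|X|` is even.
  have hodd : Odd L.card := by
    have := even_sum_add_card 𝒬 h.odd
    have h1 : 𝒬.card = S.card + 1 := by omega
    grind
  have hLd : ∀ Q ∈ 𝒬, Disjoint L Q := by
    intro Q hQ
    rw [Finset.disjoint_left]
    intro v hv hvQ
    exact (Finset.mem_sdiff.1 hv).2 (Finset.mem_biUnion.2 ⟨Q, hQ, hvQ⟩)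
  have hLn : L ∉ 𝒬 := by
    intro hmem
    have := hLd L hmem
    rw [disjoint_self, Finset.bot_eq_empty] at this
    simp [this] at hodd
  refine ⟨insert L 𝒬, ⟨h.subset, ?_, ?_, ?_, ?_⟩, ?_⟩
  · intro Q hQ
    rcases Finset.mem_insert.1 hQ with rfl | hQ
    · exact Finset.sdiff_subset
    · exact h.sub Q hQ
  · intro Q hQ
    rcases Finset.mem_insert.1 hQ with rfl | hQ
    · exact hodd
    · exact h.odd Q hQ
  · intro Q hQ Q' hQ' hne
    rcases Finset.mem_insert.1 hQ with h1 | h1 <;> rcases Finset.mem_insert.1 hQ' with h2 | h2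
    · exact absurd (h1.trans h2.symm) hne
    · rw [h1]; exact hLd Q' h2
    · rw [h2]; exact (hLd Q h1).symm
    · exact h.disj Q h1 Q' h2 hne
  · intro Q hQ u hu v hv hvQ
    rcases Finset.mem_insert.1 hQ with rfl | hQ
    · have : v ∈ 𝒬.biUnion id := by
        by_contra hn
        exact hvQ (Finset.mem_sdiff.2 ⟨hv, hn⟩)
      obtain ⟨Q', hQ', hvQ'⟩ := Finset.mem_biUnion.1 this
      refine (h.join Q' hQ' v hvQ' u (Finset.mem_sdiff.1 hu).1 fun huQ' => ?_).symm
      exact (Finset.mem_sdiff.1 hu).2 (Finset.mem_biUnion.2 ⟨Q', hQ', huQ'⟩)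
    · exact h.join Q hQ u hu v hv hvQ
  · rw [Finset.card_insert_of_notMem hLn]
    omega

/-- A barrier inside a separated part `Y` can be added to a barrier of the whole graph. -/
theorem Barrier.add [Fintype V] {Y S S' : Finset V} {𝒬 𝒬' : Finset (Finset V)}
    (h : Barrier G Finset.univ S 𝒬) (h' : Barrier G Y S' 𝒬') (hYS : Disjoint Y S)
    (hYQ : ∀ Q ∈ 𝒬, Disjoint Y Q) (hY : ∀ u ∈ Y, ∀ v, v ∉ S → v ∉ Y → G.Adj u v) :
    Barrier G Finset.univ (S ∪ S') (𝒬 ∪ 𝒬') ∧ (S ∪ S').card = S.card + S'.card ∧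
      (𝒬 ∪ 𝒬').card = 𝒬.card + 𝒬'.card := by
  have hYd : ∀ Q ∈ 𝒬', Q ⊆ Y := fun Q hQ => (h'.sub Q hQ).trans Finset.sdiff_subset
  refine ⟨⟨Finset.subset_univ _, ?_, ?_, ?_, ?_⟩, ?_, ?_⟩
  · intro Q hQ v hv
    simp only [Finset.mem_sdiff, Finset.mem_univ, true_and, Finset.mem_union, not_or]
    rcases Finset.mem_union.1 hQ with hQ | hQ
    · exact ⟨(Finset.mem_sdiff.1 (h.sub Q hQ hv)).2,
        fun hS => Finset.disjoint_left.1 (hYQ Q hQ) (h'.subset hS) hv⟩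
    · exact ⟨Finset.disjoint_left.1 hYS (hYd Q hQ hv), (Finset.mem_sdiff.1 (h'.sub Q hQ hv)).2⟩
  · intro Q hQ
    rcases Finset.mem_union.1 hQ with hQ | hQ
    exacts [h.odd Q hQ, h'.odd Q hQ]
  · intro Q hQ Q' hQ' hne
    rcases Finset.mem_union.1 hQ with h1 | h1 <;> rcases Finset.mem_union.1 hQ' with h2 | h2
    · exact h.disj Q h1 Q' h2 hne
    · exact ((hYQ Q h1).mono_left (hYd Q' h2)).symm
    · exact (hYQ Q' h2).mono_left (hYd Q h1)
    · exact h'.disj Q h1 Q' h2 hne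
  · intro Q hQ u hu v hv hvQ
    simp only [Finset.mem_sdiff, Finset.mem_univ, true_and, Finset.mem_union, not_or] at hv
    rcases Finset.mem_union.1 hQ with hQ | hQ
    · exact h.join Q hQ u hu v (by simpa using hv.1) hvQ
    · by_cases hvY : v ∈ Y
      · exact h'.join Q hQ u hu v (Finset.mem_sdiff.2 ⟨hvY, hv.2⟩) hvQ
      · exact hY u (hYd Q hQ hu) v hv.1 hvY
  · exact Finset.card_union_of_disjoint ((hYS.mono_left h'.subset).symm)
  · refine Finset.card_union_of_disjoint (Finset.disjoint_left.2 fun Q hQ hQ' => ?_)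
    obtain ⟨v, hv⟩ := h.nonempty hQ
    exact Finset.disjoint_left.1 (hYQ Q hQ) (hYd Q hQ' hv) hv

/-- A barrier such that all its odd sets are factor-critical and the leftover part has a perfect
matching in the complement. -/
theorem exists_maximal_barrier [Fintype V] (G : SimpleGraph V) :
    ∃ S 𝒬, Barrier G Finset.univ S 𝒬 ∧ S.card ≤ 𝒬.card ∧
      (∀ Q ∈ 𝒬, ∀ u ∈ Q, PMOn G (Q.erase u)) ∧
      PMOn G ((Finset.univ \ S) \ 𝒬.biUnion id) := by
  classical
  let B : Finset (Finset V × Finset (Finset V)) :=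
    Finset.univ.filter fun p => Barrier G Finset.univ p.1 p.2
  have memB : ∀ S 𝒬, (S, 𝒬) ∈ B ↔ Barrier G Finset.univ S 𝒬 := by simp [B]
  have h0 : ((∅ : Finset V), (∅ : Finset (Finset V))) ∈ B :=
    (memB _ _).2 ⟨by simp, by simp, by simp, by simp, by simp⟩
  -- First maximise the deficiency `|𝒬| - |S|`, in `ℤ` since it may be negative; then, among the
  -- maximisers, maximise `|S|`.
  obtain ⟨p, hp, hpmax⟩ := B.exists_max_image (fun p => (p.2.card : ℤ) - p.1.card) ⟨_, h0⟩
  let B' := B.filter fun q => (q.2.card : ℤ) - q.1.card = p.2.card - p.1.card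
  obtain ⟨⟨S, 𝒬⟩, hq, hqmax⟩ := B'.exists_max_image (fun q => q.1.card)
    ⟨p, Finset.mem_filter.2 ⟨hp, rfl⟩⟩
  obtain ⟨hqB, hqd⟩ := Finset.mem_filter.1 hq
  have hB := (memB _ _).1 hqB
  have max1 : ∀ S' 𝒬', Barrier G Finset.univ S' 𝒬' → 𝒬'.card + S.card ≤ 𝒬.card + S'.card := by
    intro S' 𝒬' h'
    have := hpmax (S', 𝒬') ((memB _ _).2 h')
    simp only at this hqd
    omega
  have max2 : ∀ S' 𝒬', Barrier G Finset.univ S' 𝒬' → 𝒬'.card + S.card = 𝒬.card + S'.card →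
      S'.card ≤ S.card := by
    intro S' 𝒬' h' he
    refine hqmax (S', 𝒬') (Finset.mem_filter.2 ⟨(memB _ _).2 h', ?_⟩)
    simp only at hqd ⊢
    omega
  refine ⟨S, 𝒬, hB, by simpa using max1 _ _ ((memB _ _).1 h0), ?_, ?_⟩
  -- Suppose the complement has no perfect matching on `Q` without `u`. By parity there is a barrier
  -- of deficiency at least 2 inside. Moving `u` to `S` and replacing `Q` by that barrier costs 2
  -- and gains at least 2, while `S` grows, against the choice.
  · intro Q hQ u hu
    by_contra hn
    obtain ⟨S1, 𝒬1, hB1, hc1⟩ := exists_barrier_of_not_pmOn hn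
    obtain ⟨𝒬2, hB2, hc2⟩ := hB1.exists_add_two_le (by
      rw [Finset.card_erase_of_mem hu]
      have := hB.odd Q hQ
      grind) hc1
    have huS : u ∉ S := (Finset.mem_sdiff.1 (hB.sub Q hQ hu)).2
    have hB' : Barrier G Finset.univ (insert u S) (𝒬.erase Q) := by
      refine ⟨Finset.subset_univ _, ?_, ?_, ?_, ?_⟩
      · intro Q' hQ' v hv
        obtain ⟨hne, hQ'⟩ := Finset.mem_erase.1 hQ'
        simp only [Finset.mem_sdiff, Finset.mem_univ, true_and, Finset.mem_insert, not_or]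
        refine ⟨?_, (Finset.mem_sdiff.1 (hB.sub Q' hQ' hv)).2⟩
        rintro rfl
        exact Finset.disjoint_left.1 (hB.disj Q' hQ' Q hQ hne) hv hu
      · intro Q' hQ'
        exact hB.odd Q' (Finset.mem_of_mem_erase hQ')
      · intro Q' hQ' Q'' hQ''
        exact hB.disj Q' (Finset.mem_of_mem_erase hQ') Q'' (Finset.mem_of_mem_erase hQ'')
      · intro Q' hQ' v hv w hw
        refine hB.join Q' (Finset.mem_of_mem_erase hQ') v hv w ?_
        simp only [Finset.mem_sdiff, Finset.mem_univ, true_and, Finset.mem_insert, not_or] at hw ⊢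
        exact hw.2
    obtain ⟨hB3, h1, h2⟩ := hB'.add hB2 (by
        rw [Finset.disjoint_left]
        intro v hv hv'
        obtain ⟨hne, hvQ⟩ := Finset.mem_erase.1 hv
        rcases Finset.mem_insert.1 hv' with h | h
        · exact hne h
        · exact (Finset.mem_sdiff.1 (hB.sub Q hQ hvQ)).2 h)
      (by
        intro Q' hQ'
        obtain ⟨hne, hQ'⟩ := Finset.mem_erase.1 hQ'
        exact (hB.disj Q hQ Q' hQ' hne.symm).mono_left (Finset.erase_subset _ _))
      (by
        intro v hv w hw hw'
        rw [Finset.mem_insert, not_or] at hw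
        refine hB.join Q hQ v (Finset.mem_of_mem_erase hv) w (by simpa using hw.2) fun hwQ => ?_
        exact hw' (Finset.mem_erase.2 ⟨hw.1, hwQ⟩))
    rw [Finset.card_insert_of_notMem huS] at h1
    rw [Finset.card_erase_of_mem hQ] at h2
    have hpos : 0 < 𝒬.card := Finset.card_pos.2 ⟨Q, hQ⟩
    have m1 := max1 _ _ hB3
    have m2 := max2 _ _ hB3
    omega
  -- A barrier of the leftover part could simply be added, raising the deficiency.
  · by_contra hn
    obtain ⟨S1, 𝒬1, hB1, hc1⟩ := exists_barrier_of_not_pmOn hn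
    obtain ⟨hB3, h1, h2⟩ := hB.add hB1 (by
        rw [Finset.disjoint_left]
        intro v hv
        exact (Finset.mem_sdiff.1 (Finset.mem_sdiff.1 hv).1).2)
      (by
        intro Q hQ
        rw [Finset.disjoint_left]
        intro v hv hvQ
        exact (Finset.mem_sdiff.1 hv).2 (Finset.mem_biUnion.2 ⟨Q, hQ, hvQ⟩))
      (by
        intro v hv w hw hw'
        have : w ∈ 𝒬.biUnion id := by
          by_contra hn
          exact hw' (Finset.mem_sdiff.2 ⟨by simpa using hw, hn⟩)
        obtain ⟨Q, hQ, hwQ⟩ := Finset.mem_biUnion.1 this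
        refine (hB.join Q hQ w hwQ v (Finset.mem_sdiff.1 hv).1 fun hvQ => ?_).symm
        exact (Finset.mem_sdiff.1 hv).2 (Finset.mem_biUnion.2 ⟨Q, hQ, hvQ⟩))
    have m1 := max1 _ _ hB3
    omega

end Gallai


/-! ### Colour counts from matchings of the complement, and Gallai's theorem. -/

section Gallai

variable {V : Type*} {G : SimpleGraph V}

theorem ColOn.biUnion {ι : Type*} (s : Finset ι) (A : ι → Set V) (w : ι → ℕ)
    (h : ∀ i ∈ s, ColOn G (A i) (w i)) : ColOn G (⋃ i ∈ s, A i) (∑ i ∈ s, w i) := by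
  classical
  induction s using Finset.induction_on with
  | empty => simpa using colOn_empty
  | insert i s hi ih =>
    rw [Finset.sum_insert hi, Finset.set_biUnion_insert]
    exact (h i (Finset.mem_insert_self _ _)).union
      (ih fun j hj => h j (Finset.mem_insert_of_mem hj))

/-- Lower bound for the number of colours on pairwise completely joined sets. -/
theorem ColOn.sum_le {ι : Type*} (s : Finset ι) (A : ι → Set V) (w : ι → ℕ)
    (hw : ∀ i ∈ s, ∀ k, ColOn G (A i) k → w i ≤ k)
    (hA : ∀ i ∈ s, ∀ j ∈ s, i ≠ j → ∀ u ∈ A i, ∀ v ∈ A j, G.Adj u v) {k : ℕ}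
    (h : ColOn G (⋃ i ∈ s, A i) k) : ∑ i ∈ s, w i ≤ k := by
  classical
  induction s using Finset.induction_on generalizing k with
  | empty => simp
  | insert i s hi ih =>
    rw [Finset.set_biUnion_insert] at h
    obtain ⟨a, b, rfl, ha, hb⟩ := h.split (by
      intro u hu v hv
      simp only [Set.mem_iUnion] at hv
      obtain ⟨j, hj, hv⟩ := hv
      exact hA i (Finset.mem_insert_self _ _) j (Finset.mem_insert_of_mem hj)
        (by rintro rfl; exact hi hj) u hu v hv)
    rw [Finset.sum_insert hi]
    refine add_le_add (hw i (Finset.mem_insert_self _ _) a ha) (ih ?_ ?_ hb)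
    · exact fun j hj => hw j (Finset.mem_insert_of_mem hj)
    · exact fun j hj j' hj' => hA j (Finset.mem_insert_of_mem hj) j' (Finset.mem_insert_of_mem hj')

theorem colOn_card (X : Finset V) : ColOn G X X.card := by
  classical
  have := ColOn.biUnion (G := G) X (fun v => {v}) (fun _ => 1) fun v _ => colOn_singleton v
  exact this.mono (by intro v hv; simpa using hv) (by simp)

theorem colOn_pair {u v : V} (h : ¬ G.Adj u v) : ColOn G {u, v} 1 :=
  ⟨fun _ => 0, by simp, by
    rintro a (rfl | rfl) b (rfl | rfl) hab
    · exact absurd hab (G.loopless.irrefl _)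
    · exact absurd hab h
    · exact absurd hab.symm h
    · exact absurd hab (G.loopless.irrefl _)⟩

variable [DecidableEq V]

/-- Each matched pair is independent in `G` and serves as a colour class; pairs are peeled off one
at a time. -/
theorem PMOn.colOn {X : Finset V} (h : PMOn G X) : ∃ k, 2 * k = X.card ∧ ColOn G X k := by
  obtain ⟨f, hf⟩ := h
  induction X using Finset.strongInduction with
  | H X ih =>
    rcases X.eq_empty_or_nonempty with rfl | ⟨u, hu⟩
    · exact ⟨0, by simp, by simpa using colOn_empty⟩
    · obtain ⟨h1, h2, h3, h4⟩ := hf u hu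
      have hsub : (X.erase u).erase (f u) ⊂ X :=
        (Finset.erase_subset _ _).trans_ssubset (Finset.erase_ssubset hu)
      obtain ⟨k, hk, hc⟩ := ih _ hsub (by
        intro v hv
        simp only [Finset.mem_erase] at hv ⊢
        obtain ⟨g1, g2, g3, g4⟩ := hf v hv.2.2
        refine ⟨⟨fun he => hv.2.1 ?_, fun he => hv.1 ?_, g1⟩, g2, g3, g4⟩
        · rw [← g3, he, h3]
        · rw [← he, g3])
      refine ⟨k + 1, ?_, (hc.union (colOn_pair h4)).mono ?_ le_rfl⟩
      · rw [Finset.card_erase_of_mem (Finset.mem_erase.2 ⟨h2, h1⟩),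
          Finset.card_erase_of_mem hu] at hk
        have : 1 < X.card := Finset.one_lt_card.2 ⟨u, hu, f u, h1, h2.symm⟩
        omega
      · intro v hv
        by_cases hvu : v = u
        · simp [hvu]
        · by_cases hvf : v = f u
          · simp [hvf]
          · left
            simpa [hvu, hvf] using hv

/-- A factor-critical set together with a vertex attached to it. -/
theorem colOn_insert_of_pmOn {Q : Finset V} {s u : V} (hu : u ∈ Q) (h : PMOn G (Q.erase u))
    (hs : ¬ G.Adj s u) : ColOn G (insert s (Q : Set V)) ((Q.card + 1) / 2) := by
  obtain ⟨k, hk, hc⟩ := h.colOn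
  refine (hc.union (colOn_pair hs)).mono ?_ ?_
  · intro v hv
    by_cases hvu : v = u
    · simp [hvu]
    · rcases hv with rfl | hv
      · simp
      · left
        simpa [hvu] using hv
  · rw [Finset.card_erase_of_mem hu] at hk
    have : 0 < Q.card := Finset.card_pos.2 ⟨u, hu⟩
    omega

theorem two_mul_sum_half {ι : Type*} (s : Finset ι) (w : ι → ℕ) (h : ∀ i ∈ s, Odd (w i)) :
    2 * ∑ i ∈ s, (w i + 1) / 2 = ∑ i ∈ s, w i + s.card := by
  rw [Finset.mul_sum, Finset.card_eq_sum_ones, ← Finset.sum_add_distrib]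
  refine Finset.sum_congr rfl fun i hi => ?_
  have := h i hi
  grind

theorem two_mul_sum_half_sub {ι : Type*} (s : Finset ι) (w : ι → ℕ) (h : ∀ i ∈ s, Odd (w i)) :
    2 * ∑ i ∈ s, (w i - 1) / 2 + s.card = ∑ i ∈ s, w i := by
  rw [Finset.mul_sum, Finset.card_eq_sum_ones, ← Finset.sum_add_distrib]
  refine Finset.sum_congr rfl fun i hi => ?_
  have := h i hi
  grind

/-- **Gallai's theorem.** If a critical graph that is not `m`-colourable has at most `2m + 1`
vertices and a connected complement, then its complement is factor-critical. -/
theorem Crit.pmOn_erase [Fintype V] {m : ℕ} (h : Crit G m) (hconn : CutConn G)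
    (hcard : Fintype.card V ≤ 2 * m + 1) (x : V) : PMOn G (Finset.univ.erase x) := by
  classical
  obtain ⟨S, 𝒬, hB, hd, hF, hR⟩ := exists_maximal_barrier G
  have hsub : 𝒬.biUnion id ⊆ Finset.univ \ S := Finset.biUnion_subset.2 hB.sub
  set R₀ := (Finset.univ \ S) \ 𝒬.biUnion id with hR₀
  have hn : R₀.card + ∑ Q ∈ 𝒬, Q.card + S.card = Fintype.card V := by
    rw [← hB.card_biUnion, hR₀, Finset.card_sdiff_add_card_eq_card hsub,
      Finset.card_sdiff_add_card_eq_card (Finset.subset_univ _), Finset.card_univ]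
  obtain ⟨k₀, hk₀, hc₀⟩ := hR.colOn
  have joinQ : ∀ Q ∈ 𝒬, ∀ u ∈ Q, ∀ v, v ∉ S → v ∉ Q → G.Adj u v :=
    fun Q hQ u hu v hv => hB.join Q hQ u hu v (by simpa using hv)
  -- With `S` empty, an odd set is joined to all other vertices, so by connectivity of the
  -- complement it is the whole vertex set, and the maximal barrier gives the matching. With no odd
  -- set either, the perfect matching of the complement yields an `m`-colouring.
  rcases S.eq_empty_or_nonempty with rfl | hS
  · rcases 𝒬.eq_empty_or_nonempty with rfl | ⟨Q, hQ⟩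
    · exfalso
      refine h.not_col (colOn_univ_iff.1 (hc₀.mono ?_ ?_))
      · simp [hR₀]
      · simp at hn
        omega
    · have hQu : Q = Finset.univ := by
        by_contra hne
        obtain ⟨v, hv⟩ : ∃ v, v ∉ Q := by
          by_contra! hall
          exact hne (Finset.eq_univ_of_forall hall)
        obtain ⟨u, hu, w, hw, hadj⟩ := hconn (Q : Set V) (by simpa using hB.nonempty hQ)
          ⟨v, by simpa using hv⟩
        exact hadj (joinQ Q hQ u (by simpa using hu) w (by simp) (by simpa using hw))
      exact hQu ▸ hF Q hQ x (by simp [hQu])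
  exfalso
  let tight : Finset V → Prop := fun Q => ∀ k, ColOn G (Q : Set V) k → (Q.card + 1) / 2 ≤ k
  let 𝒯 := 𝒬.filter tight
  let t : 𝒯 → Finset V := fun Q => S.filter fun s => ∃ u ∈ Q.1, ¬ G.Adj s u
  have memQ : ∀ Q : 𝒯, Q.1 ∈ 𝒬 := fun Q => (Finset.mem_filter.1 Q.2).1
  have tightQ : ∀ Q : 𝒯, tight Q.1 := fun Q => (Finset.mem_filter.1 Q.2).2
  -- Hall's condition for assigning to the tight sets distinct vertices of `S`, each with a
  -- non-neighbour in its set. Such a vertex is absorbed by its set at no cost in colours.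
  by_cases hall : ∀ Z : Finset 𝒯, Z.card ≤ (Z.biUnion t).card
  · obtain ⟨ψ, hψ, hψt⟩ := (Finset.all_card_le_biUnion_card_iff_exists_injective t).1 hall
    have c1 : ColOn G (⋃ Q ∈ (Finset.univ : Finset 𝒯), insert (ψ Q) (Q.1 : Set V))
        (∑ Q : 𝒯, (Q.1.card + 1) / 2) := by
      refine ColOn.biUnion _ _ _ fun Q _ => ?_
      obtain ⟨u, hu, hadj⟩ := (Finset.mem_filter.1 (hψt Q)).2
      exact colOn_insert_of_pmOn hu (hF Q (memQ Q) u hu) hadj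
    have c2 : ColOn G (⋃ Q ∈ 𝒬.filter fun Q => ¬ tight Q, (Q : Set V))
        (∑ Q ∈ 𝒬.filter fun Q => ¬ tight Q, (Q.card - 1) / 2) := by
      refine ColOn.biUnion _ _ _ fun Q hQ => ?_
      have := (Finset.mem_filter.1 hQ).2
      simp only [tight, not_forall, not_le] at this
      obtain ⟨k, hk, hlt⟩ := this
      exact hk.mono subset_rfl (by omega)
    have hψS : Finset.univ.image ψ ⊆ S := by
      intro s hs
      obtain ⟨Q, -, rfl⟩ := Finset.mem_image.1 hs
      exact (Finset.mem_filter.1 (hψt Q)).1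
    have c3 := colOn_card (G := G) (S \ Finset.univ.image ψ)
    have hc3 : (S \ Finset.univ.image ψ).card + 𝒯.card = S.card := by
      rw [← Finset.card_sdiff_add_card_eq_card hψS, Finset.card_image_of_injective _ hψ]
      simp
    refine h.not_col (colOn_univ_iff.1 ((((c1.union c2).union c3).union hc₀).mono ?_ ?_))
    · intro v _
      by_cases hvS : v ∈ S
      · by_cases hvψ : v ∈ Finset.univ.image ψ
        · obtain ⟨Q, -, rfl⟩ := Finset.mem_image.1 hvψ
          refine .inl (.inl (.inl ?_))
          simp only [Set.mem_iUnion]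
          exact ⟨Q, Finset.mem_univ _, .inl rfl⟩
        · exact .inl (.inr (by simpa using ⟨hvS, by simpa using hvψ⟩))
      · by_cases hvQ : v ∈ 𝒬.biUnion id
        · obtain ⟨Q, hQ, hv⟩ := Finset.mem_biUnion.1 hvQ
          by_cases ht : tight Q
          · refine .inl (.inl (.inl ?_))
            simp only [Set.mem_iUnion]
            exact ⟨⟨Q, Finset.mem_filter.2 ⟨hQ, ht⟩⟩, Finset.mem_univ _, .inr hv⟩
          · refine .inl (.inl (.inr ?_))
            simp only [Set.mem_iUnion]
            exact ⟨Q, Finset.mem_filter.2 ⟨hQ, ht⟩, hv⟩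
        · refine .inr ?_
          rw [hR₀, Finset.mem_coe, Finset.mem_sdiff]
          exact ⟨by simpa using hvS, hvQ⟩
    -- Twice the number of colours used is `|V| + |S| - |𝒬| ≤ |V| ≤ 2m + 1`.
    · have e1 : ∑ Q : 𝒯, (Q.1.card + 1) / 2 = ∑ Q ∈ 𝒯, (Q.card + 1) / 2 :=
        Finset.sum_coe_sort 𝒯 fun Q => (Q.card + 1) / 2
      have e2 := two_mul_sum_half 𝒯 Finset.card fun Q hQ => hB.odd Q (Finset.mem_filter.1 hQ).1
      have e3 := two_mul_sum_half_sub (𝒬.filter fun Q => ¬ tight Q) Finset.card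
        fun Q hQ => hB.odd Q (Finset.mem_filter.1 hQ).1
      have e4 : ∑ Q ∈ 𝒯, Q.card + ∑ Q ∈ 𝒬.filter (fun Q => ¬ tight Q), Q.card = ∑ Q ∈ 𝒬, Q.card :=
        Finset.sum_filter_add_sum_filter_not _ _ _
      have e5 : 𝒯.card + (𝒬.filter fun Q => ¬ tight Q).card = 𝒬.card :=
        Finset.card_filter_add_card_filter_not _
      omega
  · obtain ⟨Z₀, hZ₀⟩ := not_forall.1 hall
    -- A violator of largest excess, so that its neighbourhood `T` can be matched back into `Z`.
    obtain ⟨Z, -, hZmax⟩ := (Finset.univ : Finset (Finset 𝒯)).exists_max_image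
      (fun Z => (Z.card : ℤ) - (Z.biUnion t).card) ⟨Z₀, Finset.mem_univ _⟩
    have hZpos : (Z.biUnion t).card < Z.card := by
      have := hZmax Z₀ (Finset.mem_univ _)
      omega
    set T := Z.biUnion t with hT
    have hTS : T ⊆ S := Finset.biUnion_subset.2 fun Q _ => Finset.filter_subset _ _
    -- A vertex of `T` is needed for the deletion below. By connectivity some non-edge leaves an odd
    -- set of `Z`, and it can only lead to `S`.
    obtain ⟨w, hw⟩ : T.Nonempty := by
      obtain ⟨Q, hQ⟩ : Z.Nonempty := Finset.card_pos.1 (by omega)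
      obtain ⟨s, hs⟩ := hS
      obtain ⟨u, hu, v, hv, hadj⟩ := hconn (Q.1 : Set V) (by simpa using hB.nonempty (memQ Q))
        ⟨s, fun hsQ => (Finset.mem_sdiff.1 (hB.sub Q.1 (memQ Q) hsQ)).2 hs⟩
      by_cases hvS : v ∈ S
      · exact ⟨v, Finset.mem_biUnion.2 ⟨Q, hQ, Finset.mem_filter.2
          ⟨hvS, u, hu, fun h => hadj h.symm⟩⟩⟩
      · exact absurd (joinQ Q.1 (memQ Q) u hu v hvS hv) hadj
    let t' : T → Finset 𝒯 := fun s => Z.filter fun Q => s.1 ∈ t Q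
    -- If some `A ⊆ T` had too few neighbours in `Z`, removing these from `Z` would increase the
    -- excess.
    have hall' : ∀ A : Finset T, A.card ≤ (A.biUnion t').card := by
      intro A
      have hsubZ : A.biUnion t' ⊆ Z := Finset.biUnion_subset.2 fun s _ => Finset.filter_subset _ _
      have hm := hZmax (Z \ A.biUnion t') (Finset.mem_univ _)
      have hsubT : (Z \ A.biUnion t').biUnion t ⊆ T \ A.map ⟨Subtype.val, Subtype.val_injective⟩ := by
        intro s hs
        obtain ⟨Q, hQ, hsQ⟩ := Finset.mem_biUnion.1 hs
        obtain ⟨hQZ, hQA⟩ := Finset.mem_sdiff.1 hQ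
        refine Finset.mem_sdiff.2 ⟨Finset.mem_biUnion.2 ⟨Q, hQZ, hsQ⟩, fun hsA => hQA ?_⟩
        obtain ⟨s', hs', rfl⟩ := Finset.mem_map.1 hsA
        exact Finset.mem_biUnion.2 ⟨s', hs', Finset.mem_filter.2 ⟨hQZ, hsQ⟩⟩
      have hAT : A.map ⟨Subtype.val, Subtype.val_injective⟩ ⊆ T := by
        intro s hs
        obtain ⟨s', -, rfl⟩ := Finset.mem_map.1 hs
        exact s'.2
      have h1 := Finset.card_le_card hsubT
      have h2 := Finset.card_sdiff_add_card_eq_card hAT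
      have h3 := Finset.card_sdiff_add_card_eq_card hsubZ
      rw [Finset.card_map] at h2
      omega
    obtain ⟨φ, hφ, hφt⟩ := (Finset.all_card_le_biUnion_card_iff_exists_injective t').1 hall'
    let R : Set V := {v | v ∉ T ∧ ∀ Q ∈ Z, v ∉ Q.1}
    have hjoin : ∀ Q ∈ Z, ∀ u ∈ Q.1, ∀ v ∈ R, G.Adj u v := by
      intro Q hQ u hu v hv
      by_cases hvS : v ∈ S
      · by_contra hadj
        exact hv.1 (Finset.mem_biUnion.2 ⟨Q, hQ, Finset.mem_filter.2
          ⟨hvS, u, hu, fun h => hadj h.symm⟩⟩)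
      · exact joinQ Q.1 (memQ Q) u hu v hvS (hv.2 Q hQ)
    -- Colour `G` without `w`. The sets in `Z` are joined to one another and to `R`, so by tightness
    -- they take at least the sum of `(|Q| + 1) / 2` colours, none of which occurs on `R`.
    have hcol : ColOn G ((⋃ Q ∈ Z, (Q.1 : Set V)) ∪ R) m := by
      refine (h.vert w).mono ?_ le_rfl
      rintro v (hv | hv) rfl
      · simp only [Set.mem_iUnion] at hv
        obtain ⟨Q, hQ, hv⟩ := hv
        exact (Finset.mem_sdiff.1 (hB.sub Q.1 (memQ Q) hv)).2 (hTS hw)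
      · exact hv.1 hw
    obtain ⟨a, b, hab, ha, hb⟩ := hcol.split (by
      intro u hu v hv
      simp only [Set.mem_iUnion] at hu
      obtain ⟨Q, hQ, hu⟩ := hu
      exact hjoin Q hQ u hu v hv)
    have hle := ColOn.sum_le Z (fun Q => (Q.1 : Set V)) (fun Q => (Q.1.card + 1) / 2)
      (fun Q _ => tightQ Q) (by
        intro Q hQ Q' hQ' hne u hu v hv
        have hd := hB.disj Q.1 (memQ Q) Q'.1 (memQ Q') (fun he => hne (Subtype.ext he))
        exact joinQ Q.1 (memQ Q) u hu v (Finset.mem_sdiff.1 (hB.sub Q'.1 (memQ Q') hv)).2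
          fun hvQ => Finset.disjoint_left.1 hd hvQ hv) ha
    -- The same number of colours covers the sets in `Z` together with all of `T`, because `φ`
    -- attaches each vertex of `T` to a set of its own. Keeping the colouring of `R` now gives `m`
    -- colours for all of `G`.
    have c1 : ColOn G (⋃ Q ∈ Z, ((Q.1 : Set V) ∪ {s | ∃ h : s ∈ T, φ ⟨s, h⟩ = Q}))
        (∑ Q ∈ Z, (Q.1.card + 1) / 2) := by
      refine ColOn.biUnion _ _ _ fun Q hQ => ?_
      by_cases hex : ∃ s : T, φ s = Q
      · obtain ⟨s, hs⟩ := hex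
        have := (Finset.mem_filter.1 (hφt s)).2
        rw [hs] at this
        obtain ⟨u, hu, hadj⟩ := (Finset.mem_filter.1 this).2
        refine (colOn_insert_of_pmOn hu (hF Q (memQ Q) u hu) hadj).mono ?_ le_rfl
        rintro v (hv | ⟨hvT, hv⟩)
        · exact .inr hv
        · left
          exact congrArg Subtype.val (hφ (hv.trans hs.symm))
      -- For a set without a partner, `u` is paired with itself.
      · obtain ⟨u, hu⟩ := hB.nonempty (memQ Q)
        refine (colOn_insert_of_pmOn hu (hF Q (memQ Q) u hu) (G.loopless.irrefl u)).mono ?_ le_rfl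
        rintro v (hv | ⟨hvT, hv⟩)
        · exact .inr hv
        · exact absurd ⟨_, hv⟩ hex
    refine h.not_col (colOn_univ_iff.1 ((c1.union hb).mono ?_ (by omega)))
    intro v _
    by_cases hvT : v ∈ T
    · left
      simp only [Set.mem_iUnion]
      exact ⟨φ ⟨v, hvT⟩, (Finset.mem_filter.1 (hφt ⟨v, hvT⟩)).1, .inr ⟨hvT, rfl⟩⟩
    · by_cases hex : ∃ Q ∈ Z, v ∈ Q.1
      · obtain ⟨Q, hQ, hv⟩ := hex
        left
        simp only [Set.mem_iUnion]
        exact ⟨Q, hQ, .inl hv⟩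
      · push Not at hex
        exact .inr ⟨hvT, hex⟩

/-- If the order were smaller, Gallai's theorem would give a matching of the complement missing one
vertex, and hence a colouring with `(|V| + 1) / 2 ≤ m` colours. -/
theorem Crit.two_mul_add_one_le [Fintype V] {m : ℕ} (h : Crit G m) (hconn : CutConn G) :
    2 * m + 1 ≤ Fintype.card V := by
  by_contra! hlt
  obtain ⟨x⟩ := h.nonempty
  obtain ⟨k, hk, hc⟩ := (h.pmOn_erase hconn (by omega) x).colOn
  rw [Finset.card_erase_of_mem (Finset.mem_univ x), Finset.card_univ] at hk
  refine h.not_col (colOn_univ_iff.1 ((hc.union (colOn_singleton x)).mono ?_ (k := m) ?_))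
  · intro v _
    by_cases hv : v = x <;> simp [hv]
  · have : 0 < Fintype.card V := Fintype.card_pos_iff.2 ⟨x⟩
    omega

end Gallai


/-! ### Verified case analysis for critical graphs on few vertices -/

/-- The properties of critical graphs with connected complement used by the case analysis. -/
structure CaseHyp {V : Type*} [Fintype V] (G : SimpleGraph V) (m : ℕ) : Prop where
  not_col : ¬ G.Colorable m
  cut : CutConn G
  nbr : ∀ a b, ∃ c, c ≠ a ∧ c ≠ b ∧ ¬ G.Adj a c
  deg : ∀ v, ∀ s : Finset V, (∀ u, G.Adj v u → u ∈ s) → m ≤ s.card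

/-! ### Necessary conditions that prune the search. -/

section CaseHyp

variable {V W : Type*} {G : SimpleGraph V} {m : ℕ}

/-- Otherwise a colour absent from `s` extends a colouring of `G` without `v`. Only a superset of
the neighbourhood is required, since the search knows the neighbourhood incompletely. -/
theorem Crit.le_card_of_neighbors (h : Crit G m) (v : V) (s : Finset V)
    (hs : ∀ u, G.Adj v u → u ∈ s) : m ≤ s.card := by
  classical
  by_contra! hlt
  obtain ⟨c, hc, hp⟩ := h.vert v
  obtain ⟨k, hk, hks⟩ : ∃ k ∈ Finset.range m, k ∉ s.image c := by
    by_contra! hall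
    have := Finset.card_le_card (s := Finset.range m) hall
    rw [Finset.card_range] at this
    exact absurd (this.trans Finset.card_image_le) (by omega)
  refine h.not_col (colOn_univ_iff.1 ⟨fun u => if u = v then k else c u, ?_, ?_⟩)
  · intro u _
    by_cases hu : u = v
    · simpa [hu] using hk
    · simpa [hu] using hc u hu
  · have key : ∀ u, u ≠ v → G.Adj v u → k ≠ c u := by
      rintro u - hadj rfl
      exact hks (Finset.mem_image_of_mem c (hs u hadj))
    intro a _ b _ hab
    by_cases ha : a = v <;> by_cases hb : b = v
    · subst ha hb; exact absurd hab (G.loopless.irrefl _)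
    · simpa [ha, hb] using key b hb (ha ▸ hab)
    · simpa [ha, hb] using (key a ha (hb ▸ hab.symm)).symm
    · simpa [ha, hb] using hp a ha b hb hab

/-- The point is `nbr`: no vertex has degree one in the complement. Connectivity gives `a` a
non-neighbour `b'`. If it is the only one, then in a colouring of `G` without `b'` the colour of `a`
occurs at `a` alone, and `b'` can take it too. -/
theorem Crit.caseHyp [Fintype V] (h : Crit G m) (hconn : CutConn G) (hV : 1 < Fintype.card V) :
    CaseHyp G m := by
  classical
  have one : ∀ a, ∃ c, c ≠ a ∧ ¬ G.Adj a c := by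
    intro a
    obtain ⟨b, hb⟩ := Fintype.exists_ne_of_one_lt_card hV a
    obtain ⟨u, rfl, v, hv, hadj⟩ := hconn {a} ⟨a, rfl⟩ ⟨b, hb⟩
    exact ⟨v, hv, hadj⟩
  refine ⟨h.not_col, hconn, fun a b => ?_, h.le_card_of_neighbors⟩
  by_contra! hall
  obtain ⟨b', hb', hadj⟩ := one a
  have hbb : b' = b := by
    by_contra hne
    exact hadj (hall b' hb' hne)
  subst hbb
  obtain ⟨c, hc, hp⟩ := h.vert b'
  refine h.not_col (colOn_univ_iff.1 ⟨fun u => if u = b' then c a else c u, ?_, ?_⟩)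
  · intro u _
    by_cases hu : u = b'
    · simpa [hu] using hc a hb'.symm
    · simpa [hu] using hc u hu
  · have key : ∀ u, u ≠ b' → G.Adj b' u → c a ≠ c u := by
      intro u hu hbu
      have hua : u ≠ a := by rintro rfl; exact hadj hbu.symm
      exact hp a hb'.symm u hu (hall u hua hu)
    intro x _ y _ hxy
    by_cases hx : x = b' <;> by_cases hy : y = b'
    · subst hx hy; exact absurd hxy (G.loopless.irrefl _)
    · simpa [hx, hy] using key y hy (hx ▸ hxy)
    · simpa [hx, hy] using (key x hx (hy ▸ hxy.symm)).symm
    · simpa [hx, hy] using hp x hx y hy hxy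

theorem CutConn.iso {H : SimpleGraph W} (h : CutConn G) (f : G ≃g H) : CutConn H := by
  rintro X ⟨x, hx⟩ ⟨y, hy⟩
  obtain ⟨u, hu, v, hv, hadj⟩ := h (f ⁻¹' X) ⟨f.symm x, by simpa using hx⟩
    ⟨f.symm y, by simpa using hy⟩
  exact ⟨f u, hu, f v, hv, by rwa [f.map_adj_iff]⟩

theorem CaseHyp.iso [Fintype V] [Fintype W] {H : SimpleGraph W} (h : CaseHyp G m) (f : G ≃g H) : CaseHyp H m := by
  refine ⟨fun hc => h.not_col (SimpleGraph.Colorable.of_hom f.toHom hc), h.cut.iso f,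
    fun a b => ?_, fun v s hs => ?_⟩
  · obtain ⟨c, h1, h2, h3⟩ := h.nbr (f.symm a) (f.symm b)
    refine ⟨f c, fun he => h1 ?_, fun he => h2 ?_, fun hadj => h3 ?_⟩
    · simp [← he]
    · simp [← he]
    · rw [← f.map_adj_iff]; simpa using hadj
  · have := h.deg (f.symm v) (s.map f.symm.toEquiv.toEmbedding) (by
      intro u hu
      refine Finset.mem_map.2 ⟨f u, hs _ ?_, by simp⟩
      have := f.map_adj_iff.2 hu
      simpa using this)
    simpa using this

end CaseHyp

/-! ### Numerical encoding of configurations and certificates. -/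

theorem natBeq_eq_false_iff {a b : ℕ} : Nat.beq a b = false ↔ a ≠ b := by
  rw [← Bool.not_eq_true, Nat.beq_eq]

/-- `f` holds for all numbers below the bound. -/
def allLt : ℕ → (ℕ → Bool) → Bool
  | 0, _ => true
  | n + 1, f => f n && allLt n f

/-- The number of values below the bound at which `f` holds. -/
def countLt : ℕ → (ℕ → Bool) → ℕ
  | 0, _ => 0
  | n + 1, f => bif f n then countLt n f + 1 else countLt n f

theorem allLt_iff {n : ℕ} {f : ℕ → Bool} : allLt n f = true ↔ ∀ i < n, f i = true := by
  induction n with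
  | zero => simp [allLt]
  | succ n ih =>
    simp only [allLt, Bool.and_eq_true, ih, Nat.lt_succ_iff_lt_or_eq]
    exact ⟨fun h i hi => hi.elim (h.2 i) (fun e => e ▸ h.1), fun h => ⟨h n (.inr rfl), fun i hi => h i (.inl hi)⟩⟩

theorem countLt_eq (n : ℕ) (f : ℕ → Bool) :
    countLt n f = ((Finset.range n).filter fun i => f i = true).card := by
  induction n with
  | zero => simp [countLt]
  | succ n ih =>
    rw [Finset.range_add_one, Finset.filter_insert]
    cases h : f n <;> simp [countLt, h, ih]

/-- The digit of `p` at position `a` in base `b`. -/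
def digitAt (b p a : ℕ) : ℕ := p / b ^ a % b

/-- A set of pairs of vertices below `n` is stored in the binary digits of a number, with the pair
`a < b` at position `n * a + b`. -/
def hasPair (n N a b : ℕ) : Bool :=
  N.testBit (bif Nat.blt a b then n * a + b else n * b + a)

/-- The map whose values are the digits of `p` sends pairs of `A` to pairs of `B`. -/
def mapsInto (n p A B : ℕ) : Bool :=
  allLt n fun a => allLt n fun b =>
    !(A.testBit (n * a + b)) || hasPair n B (digitAt n p a) (digitAt n p b)

/-- The digits of `p` are distinct. -/
def isPerm (n p : ℕ) : Bool :=
  allLt n fun a => allLt a fun b => !(Nat.beq (digitAt n p a) (digitAt n p b))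

/-- Certificates for the case analysis. The inner nodes branch on an edge, treating all edges of an
orbit at once; the leaves state why no case is left. -/
inductive Cert
  | leaf (j p : ℕ)
  | color (c : ℕ)
  | nbr (a b : ℕ)
  | cut (s : ℕ)
  | deg (v : ℕ)
  | use (j p : ℕ)
  | edge (e : ℕ) (sym : List (ℕ × ℕ)) (l r : Cert)
  | nonedge (e : ℕ) (sym : List (ℕ × ℕ)) (l r : Cert)

/-- Add pairs to a set of pairs. -/
def addPairs (N : ℕ) : List ℕ → ℕ
  | [] => N
  | e :: es => addPairs (N ||| 2 ^ e) es

/-- Check a certificate, where `N` and `K` are the pairs known to be adjacent and non-adjacent. -/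
def Cert.check (n m : ℕ) (F : List (List ℕ)) (known : List ℕ) : Cert → ℕ → ℕ → Bool
  | leaf j p, N, _ =>
    -- The default `[0]` is the pair `(0, 0)`. An index out of range therefore asks for a loop,
    -- which keeps the check sound.
    (F.getD j [0]).all fun e => hasPair n N (digitAt n p (e / n)) (digitAt n p (e % n))
  -- The base-`m` digits of `c` form a colouring that is proper however the undecided pairs turn
  -- out.
  | color c, _, K => allLt n fun a => allLt a fun b =>
    !(Nat.beq (digitAt m c a) (digitAt m c b)) || hasPair n K a b
  | nbr a b, N, _ => Nat.blt a n && Nat.blt b n &&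
    allLt n fun c => Nat.beq c a || Nat.beq c b || hasPair n N a c
  | cut s, N, _ => !(allLt n fun a => !(s.testBit a)) && !(allLt n fun a => s.testBit a) &&
    allLt n fun a => allLt n fun b => !(s.testBit a) || s.testBit b || hasPair n N a b
  -- Undecided pairs are counted as edges.
  | deg v, _, K => Nat.blt v n &&
    Nat.blt (countLt n fun c => !(Nat.beq c v || hasPair n K v c)) m
  -- The known claims assume no edges, so only the non-edges have to match.
  | use j p, _, K => Nat.blt j known.length && isPerm n p && mapsInto n p (known.getD j 0) K
  -- Each entry of `sym` has a permutation carrying the left-hand configuration to the one with that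
  -- pair in place of `e`. If any pair of the orbit is an edge, the left branch applies after
  -- relabelling; on the right, all of them are non-edges.
  | edge e sym l r, N, K => Nat.blt e (n * n) && l.check n m F known (N ||| 2 ^ e) K &&
    (sym.all fun x => Nat.blt x.1 (n * n) && isPerm n x.2 &&
      mapsInto n x.2 (N ||| 2 ^ e) (N ||| 2 ^ x.1) && mapsInto n x.2 K K) &&
    r.check n m F known N (addPairs (K ||| 2 ^ e) (sym.map Prod.fst))
  | nonedge e sym l r, N, K => Nat.blt e (n * n) && l.check n m F known N (K ||| 2 ^ e) &&
    (sym.all fun x => Nat.blt x.1 (n * n) && isPerm n x.2 &&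
      mapsInto n x.2 (K ||| 2 ^ e) (K ||| 2 ^ x.1) && mapsInto n x.2 N N) &&
    r.check n m F known (addPairs (N ||| 2 ^ e) (sym.map Prod.fst)) K

/-- All pairs stored in `N` satisfy `R`. -/
def PairsSat (n N : ℕ) (R : Fin n → Fin n → Prop) : Prop :=
  ∀ a b : Fin n, N.testBit (n * a + b) = true → R a b

/-- Some graph of the list `F` maps homomorphically to `G`. -/
def HomFromList {n : ℕ} (F : List (List ℕ)) (G : SimpleGraph (Fin n)) : Prop :=
  ∃ l ∈ F, ∃ f : ℕ → Fin n, ∀ e ∈ l, G.Adj (f (e / n)) (f (e % n))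

/-- Every graph that satisfies the hypotheses of the case analysis and is compatible with the known
pairs receives a homomorphism from a graph of the list. -/
def Claim (n m : ℕ) (F : List (List ℕ)) (N K : ℕ) : Prop :=
  ∀ G : SimpleGraph (Fin n), CaseHyp G m → PairsSat n N G.Adj →
    PairsSat n K (fun a b => ¬ G.Adj a b) → HomFromList F G

/-! ### Soundness of the certificate checker. -/

section Check

variable {n m : ℕ} {F : List (List ℕ)}

theorem digitAt_lt (hn : 0 < n) (p a : ℕ) : digitAt n p a < n := Nat.mod_lt _ hn

theorem PairsSat.hasPair {N : ℕ} {R : Fin n → Fin n → Prop} (h : PairsSat n N R)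
    (hR : ∀ a b, R a b → R b a) (a b : Fin n) (hab : hasPair n N a b = true) : R a b := by
  unfold _root_.hasPair at hab
  cases hlt : Nat.blt a b <;> rw [hlt] at hab
  · exact hR _ _ (h b a hab)
  · exact h a b hab

theorem PairsSat.add {N e : ℕ} {R : Fin n → Fin n → Prop} (h : PairsSat n N R)
    (hR : ∀ a b : Fin n, n * a + b = e → R a b) : PairsSat n (N ||| 2 ^ e) R := by
  intro a b hab
  rw [Nat.testBit_or, Bool.or_eq_true, Nat.testBit_two_pow, decide_eq_true_eq] at hab
  exact hab.elim (h a b) fun he => hR a b he.symm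

theorem PairsSat.addPairs {R : Fin n → Fin n → Prop} (es : List ℕ)
    (hR : ∀ e ∈ es, ∀ a b : Fin n, n * a + b = e → R a b) {N : ℕ} (h : PairsSat n N R) :
    PairsSat n (addPairs N es) R := by
  induction es generalizing N with
  | nil => exact h
  | cons e es ih =>
    exact ih (fun y hy => hR y (List.mem_cons_of_mem _ hy)) (h.add (hR e List.mem_cons_self))

theorem PairsSat.comap {p A B : ℕ} {R : Fin n → Fin n → Prop} (hR : ∀ a b, R a b → R b a)
    (h : PairsSat n B R) (hAB : mapsInto n p A B = true) (σ : Fin n → Fin n)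
    (hσ : ∀ a, (σ a : ℕ) = digitAt n p a) : PairsSat n A fun a b => R (σ a) (σ b) := by
  intro a b hab
  have := allLt_iff.1 (allLt_iff.1 hAB a a.2) b b.2
  rw [hab, Bool.not_true, Bool.false_or, ← hσ, ← hσ] at this
  exact h.hasPair hR _ _ this

theorem exists_perm_of_isPerm (hn : 0 < n) {p : ℕ} (h : isPerm n p = true) :
    ∃ σ : Fin n ≃ Fin n, ∀ a, (σ a : ℕ) = digitAt n p a := by
  let f : Fin n → Fin n := fun a => ⟨digitAt n p a, digitAt_lt hn p a⟩
  have hlt : ∀ a b : Fin n, b < a → f a ≠ f b := by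
    intro a b hab he
    have := allLt_iff.1 (allLt_iff.1 h a a.2) b hab
    simp only [Bool.not_eq_true', natBeq_eq_false_iff] at this
    exact this (congrArg Fin.val he)
  have hf : Function.Injective f := by
    intro a b he
    rcases lt_trichotomy a b with hab | hab | hab
    · exact absurd he.symm (hlt b a hab)
    · exact hab
    · exact absurd he (hlt a b hab)
  exact ⟨Equiv.ofBijective f (Finite.injective_iff_bijective.1 hf), fun a => rfl⟩

/-- Relabelling of a claim. -/
theorem Claim.relabel (hn : 0 < n) {N K N' K' p : ℕ} (h : Claim n m F N K) (hp : isPerm n p = true)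
    (hN : mapsInto n p N N' = true) (hK : mapsInto n p K K' = true) : Claim n m F N' K' := by
  intro G hG hGN hGK
  obtain ⟨σ, hσ⟩ := exists_perm_of_isPerm hn hp
  obtain ⟨l, hl, f, hf⟩ := h (G.comap σ) (hG.iso (SimpleGraph.Iso.comap σ G).symm)
    (hGN.comap (fun a b h => h.symm) hN σ hσ)
    (hGK.comap (fun a b h h' => h h'.symm) hK σ hσ)
  exact ⟨l, hl, fun i => σ (f i), fun e he => hf e he⟩

theorem exists_pair (hn : 0 < n) {e : ℕ} (he : e < n * n) :
    ∃ a b : Fin n, ∀ a' b' : Fin n, n * (a' : ℕ) + b' = e → a' = a ∧ b' = b := by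
  refine ⟨⟨e / n, Nat.div_lt_of_lt_mul he⟩, ⟨e % n, Nat.mod_lt _ hn⟩, ?_⟩
  rintro a b rfl
  refine ⟨Fin.ext ?_, Fin.ext ?_⟩
  · simp [Nat.mul_add_div hn, Nat.div_eq_of_lt b.2]
  · simp [Nat.mod_eq_of_lt b.2]

theorem adj_or_not_adj_of_pair {e : ℕ} (hn : 0 < n) {G : SimpleGraph (Fin n)} (he : e < n * n) :
    (∀ a b : Fin n, n * (a : ℕ) + b = e → G.Adj a b) ∨
      ∀ a b : Fin n, n * (a : ℕ) + b = e → ¬ G.Adj a b := by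
  obtain ⟨a, b, hab⟩ := exists_pair hn he
  by_cases h : G.Adj a b
  · left
    intro a' b' h'
    obtain ⟨rfl, rfl⟩ := hab a' b' h'
    exact h
  · right
    intro a' b' h'
    obtain ⟨rfl, rfl⟩ := hab a' b' h'
    exact h

/-- Induction on the certificate, with the configuration varying. A leaf exhibits a homomorphism,
contradicts a property in `CaseHyp`, or cites an earlier claim up to relabelling. The hypotheses of
a claim are invariant under isomorphism, which justifies treating a whole orbit in one branch. -/
theorem Cert.check_sound (hn : 0 < n) (hm : 0 < m) {known : List ℕ}
    (hknown : ∀ K ∈ known, Claim n m F 0 K) (c : Cert) (N K : ℕ)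
    (h : c.check n m F known N K = true) : Claim n m F N K := by
  have symm : ∀ G : SimpleGraph (Fin n), ∀ a b, ¬ G.Adj a b → ¬ G.Adj b a :=
    fun G a b h h' => h h'.symm
  have zero : ∀ p B, mapsInto n p 0 B = true := by
    intro p B
    simp [mapsInto, allLt_iff]
  induction c generalizing N K with
  | leaf j p =>
    intro G hG hN hK
    simp only [check, List.all_eq_true] at h
    let f : ℕ → Fin n := fun a => ⟨digitAt n p a, digitAt_lt hn p a⟩
    by_cases hj : j < F.length
    · rw [List.getD_eq_getElem _ _ hj] at h
      exact ⟨F[j], List.getElem_mem hj, f, fun e he =>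
        hN.hasPair (fun a b h => h.symm) (f (e / n)) (f (e % n)) (h e he)⟩
    · rw [List.getD_eq_default _ _ (not_lt.1 hj)] at h
      have := hN.hasPair (fun a b h => h.symm) (f (0 / n)) (f (0 % n)) (h 0 (by simp))
      simp at this
  | color c =>
    intro G hG hN hK
    exfalso
    simp only [check, allLt_iff, Bool.or_eq_true, Bool.not_eq_true', natBeq_eq_false_iff] at h
    have key : ∀ a b : Fin n, b < a → G.Adj a b → digitAt m c a ≠ digitAt m c b := by
      intro a b hab hadj
      refine (h a a.2 b hab).resolve_right fun hp => ?_
      exact hK.hasPair (symm G) a b hp hadj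
    refine hG.not_col ⟨SimpleGraph.Coloring.mk
      (fun a => (⟨digitAt m c a, digitAt_lt hm c a⟩ : Fin m)) ?_⟩
    intro a b hab he
    rw [Fin.mk.injEq] at he
    rcases lt_or_gt_of_ne hab.ne with hlt | hlt
    · exact key b a hlt hab.symm he.symm
    · exact key a b hlt hab he
  | nbr a b =>
    intro G hG hN hK
    exfalso
    simp only [check, allLt_iff, Bool.and_eq_true, Bool.or_eq_true, Nat.blt_eq, Nat.beq_eq] at h
    obtain ⟨⟨ha, hb⟩, h⟩ := h
    obtain ⟨c, h1, h2, h3⟩ := hG.nbr ⟨a, ha⟩ ⟨b, hb⟩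
    rcases h c c.2 with (h | h) | h
    · exact h1 (Fin.ext h)
    · exact h2 (Fin.ext h)
    · exact h3 (hN.hasPair (fun a b h => h.symm) ⟨a, ha⟩ c h)
  | cut s =>
    intro G hG hN hK
    exfalso
    simp only [check, Bool.and_eq_true, Bool.not_eq_true', ← Bool.not_eq_true, allLt_iff,
      Bool.or_eq_true, not_forall] at h
    obtain ⟨⟨⟨a, ha, h1⟩, b, hb, h2⟩, h⟩ := h
    obtain ⟨u, hu, v, hv, hadj⟩ := hG.cut {x : Fin n | s.testBit x = true}
      ⟨⟨a, ha⟩, by simpa using h1⟩ ⟨⟨b, hb⟩, by simpa using h2⟩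
    rcases h u u.2 v v.2 with (h | h) | h
    · exact h hu
    · exact hv h
    · exact hadj (hN.hasPair (fun a b h => h.symm) u v h)
  | deg v =>
    intro G hG hN hK
    exfalso
    simp only [check, Bool.and_eq_true, Nat.blt_eq, countLt_eq] at h
    obtain ⟨hv, h⟩ := h
    have := hG.deg ⟨v, hv⟩ (Finset.univ.filter fun c : Fin n =>
      (!(Nat.beq c v || hasPair n K v c)) = true) (by
        intro u hu
        simp only [Finset.mem_filter, Finset.mem_univ, true_and, Bool.not_eq_true',
          Bool.or_eq_false_iff, natBeq_eq_false_iff]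
        refine ⟨fun he => hu.ne (Fin.ext he.symm), ?_⟩
        rw [← Bool.not_eq_true]
        exact fun hp => hK.hasPair (symm G) ⟨v, hv⟩ u hp hu)
    rw [← Finset.card_map Fin.valEmbedding] at this
    refine absurd (this.trans (Finset.card_le_card ?_)) (not_le.2 h)
    intro x hx
    obtain ⟨y, hy, rfl⟩ := Finset.mem_map.1 hx
    exact Finset.mem_filter.2 ⟨Finset.mem_range.2 y.2, (Finset.mem_filter.1 hy).2⟩
  | use j p =>
    simp only [check, Bool.and_eq_true, Nat.blt_eq] at h
    obtain ⟨⟨hj, hp⟩, hK⟩ := h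
    rw [List.getD_eq_getElem _ _ hj] at hK
    exact (hknown _ (List.getElem_mem hj)).relabel hn hp (zero _ _) hK
  | edge e sym l r ihl ihr =>
    simp only [check, Bool.and_eq_true, Nat.blt_eq, List.all_eq_true] at h
    obtain ⟨⟨⟨he, hl⟩, hs⟩, hr⟩ := h
    intro G hG hN hK
    by_cases hex : ∃ x ∈ sym, ∀ a b : Fin n, n * (a : ℕ) + b = x.1 → G.Adj a b
    · obtain ⟨x, hx, hxG⟩ := hex
      obtain ⟨⟨⟨-, hp⟩, h1⟩, h2⟩ := hs x hx
      exact ((ihl _ _ hl).relabel hn hp h1 h2) G hG (hN.add hxG) hK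
    · rcases adj_or_not_adj_of_pair hn (G := G) he with hadj | hadj
      · exact ihl _ _ hl G hG (hN.add hadj) hK
      · refine ihr _ _ hr G hG hN (PairsSat.addPairs _ (fun e' he' => ?_) (hK.add hadj))
        obtain ⟨x, hx, rfl⟩ := List.mem_map.1 he'
        refine (adj_or_not_adj_of_pair hn (G := G) (hs x hx).1.1.1).resolve_left fun hxG => ?_
        exact hex ⟨x, hx, hxG⟩
  | nonedge e sym l r ihl ihr =>
    simp only [check, Bool.and_eq_true, Nat.blt_eq, List.all_eq_true] at h
    obtain ⟨⟨⟨he, hl⟩, hs⟩, hr⟩ := h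
    intro G hG hN hK
    by_cases hex : ∃ x ∈ sym, ∀ a b : Fin n, n * (a : ℕ) + b = x.1 → ¬ G.Adj a b
    · obtain ⟨x, hx, hxG⟩ := hex
      obtain ⟨⟨⟨-, hp⟩, h1⟩, h2⟩ := hs x hx
      exact ((ihl _ _ hl).relabel hn hp h2 h1) G hG hN (hK.add hxG)
    · rcases adj_or_not_adj_of_pair hn (G := G) he with hadj | hadj
      · refine ihr _ _ hr G hG (PairsSat.addPairs _ (fun e' he' => ?_) (hN.add hadj)) hK
        obtain ⟨x, hx, rfl⟩ := List.mem_map.1 he'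
        refine (adj_or_not_adj_of_pair hn (G := G) (hs x hx).1.1.1).resolve_right fun hxG => ?_
        exact hex ⟨x, hx, hxG⟩
      · exact ihl _ _ hl G hG hN (hK.add hadj)

end Check


/-! ### The candidate graphs. -/

/-- Edge lists of the candidates on nine vertices; the last one has isolated vertices. -/
def graphs9 : List (List ℕ) := [
  [1, 2, 3, 6, 11, 12, 15, 21, 22, 31, 41, 43, 44, 51, 52, 53, 61, 62, 71],
  [1, 2, 3, 8, 11, 12, 17, 21, 26, 31, 41, 42, 43, 51, 52, 53, 61, 62, 71],
  [1, 2, 5, 8, 11, 14, 17, 21, 22, 31, 33, 34, 42, 43, 51, 52, 53, 61, 62, 71],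
  [1, 2, 3, 7, 11, 13, 15, 24, 25, 32, 34, 35, 41, 42, 44, 51, 52, 53, 61, 62, 71],
  [1, 2, 5, 8, 11, 13, 17, 21, 23, 31, 33, 34, 42, 43, 44, 51, 52, 53, 61, 62, 71],
  [1, 2, 3, 6, 11, 12, 15, 22, 25, 31, 32, 35, 41, 43, 44, 51, 52, 53, 61, 62, 71],
  [1, 2, 6, 7, 11, 12, 13, 21, 25, 31, 32, 35, 41, 42, 44, 51, 52, 53, 61, 62, 71],
  [1, 2, 7, 8, 11, 16, 17, 21, 22, 32, 33, 35, 41, 42, 43, 51, 52, 53, 61, 62, 71],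
  [1, 2, 3, 4, 11, 13, 15, 16, 21, 24, 26, 31, 32, 35, 41, 43, 51, 52, 53, 61, 62, 71],
  [1, 2, 7, 8, 12, 14, 17, 21, 24, 26, 31, 32, 33, 41, 42, 43, 51, 52, 53, 61, 62, 71],
  [1, 6, 7, 8, 11, 13, 15, 21, 23, 25, 31, 32, 35, 41, 42, 44, 51, 52, 53, 61, 62, 71],
  [1, 6, 7, 8, 11, 12, 13, 23, 25, 26, 32, 33, 35, 41, 42, 43, 51, 52, 53, 61, 62, 71],
  [1, 6, 7, 8, 11, 13, 15, 21, 23, 25, 32, 34, 35, 41, 42, 44, 51, 52, 53, 61, 62, 71],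
  [1, 2, 7, 8, 14, 16, 17, 21, 24, 26, 31, 32, 33, 41, 42, 43, 51, 52, 53, 61, 62, 71],
  [1, 3, 4, 8, 11, 14, 15, 21, 22, 25, 33, 34, 35, 41, 43, 44, 51, 52, 53, 61, 62, 71],
  [1, 2, 3, 7, 12, 14, 16, 21, 24, 25, 31, 32, 33, 41, 42, 44, 51, 52, 53, 61, 62, 71],
  [21, 23, 24, 26, 31, 32, 33, 41, 42, 43, 51, 52, 53, 61, 62, 71]]

/-- Edge lists of the candidates on eight vertices; the last four have isolated vertices. -/
def graphs8 : List (List ℕ) := [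
  [1, 2, 7, 10, 12, 19, 29, 30, 37, 38, 46, 47, 55],
  [1, 4, 6, 10, 15, 19, 21, 29, 30, 37, 38, 46, 47, 55],
  [1, 4, 6, 10, 14, 19, 21, 29, 31, 37, 38, 46, 47, 55],
  [1, 3, 5, 10, 12, 21, 22, 28, 30, 38, 39, 46, 47, 55],
  [37, 38, 39, 46, 47, 55],
  [19, 21, 23, 28, 29, 37, 38, 46, 47, 55],
  [10, 11, 15, 19, 23, 28, 37, 38, 46, 47, 55],
  [10, 14, 15, 19, 20, 29, 31, 37, 38, 46, 47, 55]]

/-- Edge lists of the candidates on seven vertices; the last two have isolated vertices. -/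
def graphs7 : List (List ℕ) := [
  [1, 6, 9, 17, 25, 33, 41],
  [33, 34, 41],
  [17, 20, 25, 33, 41]]

/-- Edge lists of the candidates on five vertices; the last one has isolated vertices. -/
def graphs5 : List (List ℕ) := [
  [1, 4, 7, 13, 19],
  [13, 14, 19]]

/-! ### Certificates for the six starting configurations. -/

section Certificates

open Cert

/-- Certificate for complements with a cycle of length 7 and a disjoint edge. -/
def certCycle7 : Cert :=
  edge 2 [] (edge 12 [] (edge 22 [] (edge 5 [] (edge 32 [] (edge 15 [] (edge 42 [] (edge 3 [(4,
  378527148)] (edge 14 [(23, 378429356)] (edge 4 [(13, 379124956)] (edge 23 [] (edge 24 [(33,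
  381051500)] (nonedge 7 [(8, 343103292)] (edge 8 [] (edge 16 [] (edge 61 [] (edge 34 [(43,
  378527148)] (edge 43 [] (edge 35 [(44, 378527148)] (edge 53 [] (edge 17 [] (edge 25 [] (leaf 0
  368477948) (edge 26 [] (leaf 6 354255916) (color 97936))) (edge 26 [] (edge 13 [] (leaf 0
  369900820) (edge 44 [] (leaf 6 361396540) (color 81316))) (color 81556))) (edge 62 [] (edge 52
  [] (edge 17 [] (edge 25 [] (edge 33 [] (leaf 4 316547876) (edge 44 [] (leaf 8 321929724) (color
  208788))) (edge 26 [] (edge 33 [] (leaf 4 273682676) (edge 44 [] (leaf 0 366816340) (color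
  225168))) (color 97936))) (edge 26 [] (edge 13 [] (edge 33 [] (leaf 3 318954204) (edge 44 []
  (leaf 0 366816340) (color 208788))) (edge 44 [] (leaf 0 366816340) (color 81316))) (color
  81556))) (color 249492)) (color 212628))) (color 147092)) (edge 44 [] (edge 52 [] (edge 26 []
  (edge 53 [] (edge 33 [] (leaf 0 318434724) (edge 35 [] (leaf 2 253702756) (edge 62 [] (leaf 0
  366816340) (color 143252)))) (edge 62 [] (leaf 0 366816340) (color 245328))) (edge 35 [] (edge
  25 [] (edge 17 [] (edge 53 [] (leaf 6 219674164) (edge 62 [] (leaf 8 318449236) (color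
  245328))) (color 81556)) (color 97936)) (color 114256))) (edge 17 [] (edge 35 [] (edge 53 []
  (edge 62 [] (edge 33 [] (edge 25 [] (leaf 3 170701524) (deg 7)) (edge 26 [] (nbr 8 7) (color
  126864))) (color 244304)) (color 249492)) (color 184212)) (color 118692))) (color 179792)))
  (edge 52 [] (edge 26 [] (edge 35 [] (edge 44 [] (edge 53 [] (edge 25 [] (leaf 3 369380548) (deg
  7)) (color 233108)) (color 179792)) (color 167828)) (color 114320)) (deg 7))) (edge 17 [] (edge
  35 [] (edge 53 [] (edge 62 [] (edge 52 [] (edge 43 [] (edge 25 [] (edge 33 [] (leaf 4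
  255103004) (edge 34 [] (leaf 5 223966820) (edge 26 [] (leaf 9 89244076) (color 110480)))) (edge
  26 [] (edge 34 [] (leaf 4 369894980) (deg 7)) (color 97936))) (edge 44 [] (edge 34 [] (edge 25
  [] (leaf 4 369894820) (deg 7)) (deg 7)) (color 179792))) (edge 26 [] (edge 44 [] (nbr 8 7)
  (color 196176)) (color 130704))) (color 260688)) (color 200340)) (color 135060)) (color
  69540))) (edge 17 [] (edge 26 [] (edge 44 [] (edge 62 [] (edge 25 [] (edge 61 [] (edge 34 []
  (edge 52 [] (edge 13 [] (leaf 4 126523364) (edge 43 [] (leaf 5 204775500) (edge 53 [] (leaf 9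
  216800076) (color 216484)))) (edge 53 [] (edge 43 [] (leaf 4 364613252) (deg 7)) (color
  249492))) (edge 43 [] (edge 35 [] (edge 52 [] (leaf 4 364613412) (deg 7)) (color 167828)) (deg
  7))) (edge 35 [] (edge 53 [] (nbr 8 7) (color 200340)) (color 135060))) (edge 35 [] (edge 53 []
  (nbr 8 7) (color 216724)) (color 151444))) (color 211536)) (color 147024)) (color 81552))
  (color 85924))) (color 16020)) (nonedge 16 [(61, 378527148), (17, 343103292), (62, 340263396)]
  (edge 17 [] (edge 25 [] (edge 52 [] (edge 61 [] (edge 44 [] (edge 34 [] (edge 26 [] (edge 43 []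
  (leaf 7 303627900) (edge 53 [] (leaf 10 36311988) (edge 62 [] (edge 13 [] (leaf 0 374381172)
  (color 216484)) (color 245328)))) (edge 35 [] (edge 43 [] (leaf 4 34869684) (edge 53 [] (leaf 4
  25976252) (edge 62 [] (edge 13 [] (leaf 0 326854108) (color 216484)) (color 245328)))) (color
  151460))) (edge 35 [] (edge 43 [] (leaf 4 34869684) (edge 26 [] (edge 53 [] (leaf 12 39670132)
  (color 233108)) (color 114320))) (color 167828))) (edge 53 [] (edge 43 [] (edge 34 [] (edge 26
  [] (leaf 12 36311988) (edge 35 [] (leaf 1 41109644) (color 151460))) (edge 35 [] (leaf 1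
  41109644) (color 167828))) (color 179792)) (color 216996))) (edge 62 [] (edge 34 [(43,
  378527148)] (edge 44 [] (edge 26 [] (edge 13 [] (leaf 0 374381172) (edge 43 [] (leaf 2
  321578796) (edge 53 [] (leaf 13 219633996) (color 216484)))) (edge 35 [] (edge 13 [] (leaf 0
  326854108) (edge 43 [] (leaf 6 318349900) (edge 53 [] (leaf 3 219674324) (color 216484))))
  (color 151460))) (edge 53 [] (edge 43 [] (edge 26 [] (leaf 3 326333908) (edge 35 [] (leaf 2
  248919796) (color 151460))) (color 179792)) (color 216996))) (deg 7)) (color 260688))) (edge 53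
  [] (edge 35 [] (edge 61 [] (edge 43 [] (leaf 1 41109644) (edge 44 [] (edge 62 [] (edge 33 []
  (edge 34 [] (leaf 9 25993100) (deg 7)) (edge 26 [] (nbr 8 7) (color 126864))) (color 244304))
  (color 179792))) (edge 26 [] (edge 44 [] (edge 62 [] (nbr 8 7) (color 260688)) (color 196176))
  (color 130704))) (edge 44 [] (edge 34 [] (edge 43 [] (edge 26 [] (edge 61 [] (leaf 4 20717564)
  (edge 62 [] (leaf 3 210619468) (color 260688))) (color 151460)) (color 184212)) (color 167828))
  (color 183956))) (color 249492))) (edge 26 [] (edge 35 [] (edge 53 [] (edge 34 [] (edge 43 []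
  (edge 61 [] (leaf 4 41060020) (edge 62 [] (edge 52 [] (leaf 3 219674164) (deg 7)) (color
  260688))) (edge 52 [] (edge 44 [] (edge 61 [] (leaf 7 347255300) (deg 7)) (color 179792)) (deg
  7))) (edge 44 [] (edge 62 [] (nbr 8 7) (color 227920)) (color 163408))) (color 216724)) (color
  151444)) (color 97936))) (color 85924)) (nonedge 25 [(52, 378527148), (26, 343103292), (53,
  340263396)] (edge 26 [] (edge 35 [] (nonedge 44 [] (edge 34 [] (edge 43 [] (edge 33 [] (edge 52
  [] (leaf 3 165925116) (edge 53 [] (leaf 2 359600004) (color 249492))) (edge 53 [] (leaf 4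
  41060020) (color 225168))) (color 179792)) (color 163408)) (nonedge 53 [] (edge 52 [] (edge 34
  [] (leaf 0 366816340) (edge 43 [] (edge 13 [] (leaf 3 297359388) (color 232868)) (color
  233108))) (color 249492)) (nbr 8 7))) (edge 44 [] (edge 34 [] (edge 52 [] (leaf 0 366816340)
  (edge 53 [] (edge 43 [] (leaf 4 39652644) (color 184212)) (color 249492))) (color 167828))
  (color 163472))) (color 97936)) (nonedge 34 [(43, 378527148), (35, 343103292), (44, 340263396)]
  (edge 35 [] (edge 43 [] (leaf 0 323769628) (edge 44 [] (nbr 8 7) (color 179792))) (color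
  167828)) (nbr 7 8))))) (color 252496)) (edge 52 [(53, 343103292)] (edge 24 [] (edge 25 [] (edge
  7 [] (nonedge 16 [(61, 378527148)] (edge 17 [] (edge 61 [] (edge 26 [] (edge 44 [] (edge 34 []
  (edge 8 [] (edge 43 [] (leaf 7 303627900) (edge 53 [] (nonedge 35 [] (edge 13 [] (edge 33 []
  (leaf 8 23546388) (edge 62 [] (leaf 0 374381172) (color 190352))) (color 215524)) (nonedge 62
  [] (leaf 4 25976252) (nbr 8 7))) (edge 62 [] (edge 13 [] (leaf 0 374381172) (color 216484))
  (color 245328)))) (edge 62 [] (edge 13 [] (leaf 0 374381172) (edge 43 [] (leaf 2 321578796)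
  (color 32164))) (color 20388))) (edge 35 [] (edge 43 [] (edge 8 [] (leaf 4 20717580) (edge 62
  [] (leaf 6 213803596) (color 20388))) (edge 8 [] (edge 53 [] (edge 62 [] (nbr 8 7) (color
  243344)) (color 233108)) (color 48788))) (color 167828))) (edge 53 [] (edge 43 [] (edge 35 []
  (edge 8 [] (leaf 1 41109644) (edge 62 [] (leaf 0 323769628) (color 20388))) (color 216036))
  (color 179792)) (color 216996))) (edge 35 [] (edge 53 [] (edge 43 [] (edge 8 [] (leaf 1
  41109644) (edge 62 [] (leaf 0 323769628) (color 20388))) (edge 44 [] (edge 34 [] (edge 8 []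
  (leaf 4 25976252) (edge 62 [] (edge 13 [] (leaf 2 254248452) (color 32164)) (color 20388)))
  (color 114320)) (color 179792))) (color 150500)) (color 151460))) (edge 62 [] (edge 34 [(43,
  378527148)] (edge 43 [] (edge 26 [(53, 378527148)] (edge 44 [] (leaf 2 321578796) (edge 53 []
  (edge 35 [] (leaf 2 248919796) (color 194192)) (color 216996))) (color 128656)) (edge 44 []
  (edge 13 [] (edge 26 [] (leaf 0 374381172) (edge 35 [] (edge 53 [] (leaf 2 254248452) (color
  128656)) (color 114256))) (edge 8 [] (edge 35 [] (edge 53 [] (leaf 3 219674324) (color 216484))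
  (color 215524)) (color 32164))) (color 179792))) (deg 7)) (color 260688))) (color 85924))
  (nonedge 34 [(43, 378527148)] (edge 35 [] (edge 43 [] (edge 44 [] (edge 8 [] (edge 17 [] (edge
  13 [] (leaf 15 265616220) (edge 26 [] (leaf 3 205843060) (edge 53 [] (leaf 0 368477948) (color
  182756)))) (edge 26 [] (leaf 3 205843060) (color 102292))) (edge 62 [] (edge 17 [] (edge 13 []
  (leaf 3 292583124) (edge 26 [] (leaf 4 321567260) (edge 53 [] (leaf 0 323769628) (color
  182756)))) (edge 26 [] (leaf 4 321567260) (color 102292))) (color 36756))) (edge 53 [] (edge 17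
  [] (edge 8 [] (leaf 0 368477948) (edge 62 [] (leaf 0 323769628) (color 36756))) (edge 26 []
  (edge 13 [] (edge 8 [] (leaf 0 331334460) (edge 62 [] (leaf 5 330806316) (color 36756))) (color
  117220)) (color 102292))) (color 233364))) (edge 8 [] (edge 17 [] (edge 26 [] (edge 44 [] (edge
  53 [] (edge 62 [] (nbr 8 7) (color 243344)) (color 233108)) (color 179792)) (color 114320))
  (color 117732)) (color 48788))) (color 167828)) (nbr 7 8))) (edge 8 [] (edge 34 [(43,
  378527148)] (edge 61 [] (edge 16 [] (edge 43 [] (edge 35 [(44, 378527148)] (edge 17 [] (edge 53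
  [] (leaf 0 368477948) (edge 62 [] (edge 33 [] (leaf 7 331734404) (edge 44 [] (edge 13 [] (leaf
  4 74390124) (edge 26 [] (leaf 0 366816340) (color 145892))) (color 208788))) (color 212628)))
  (edge 26 [] (edge 44 [] (edge 53 [] (leaf 2 253702756) (edge 62 [] (leaf 0 366816340) (color
  212628))) (edge 53 [] (edge 13 [] (leaf 0 331334460) (color 81316)) (edge 62 [] (edge 13 []
  (edge 33 [] (leaf 3 318954204) (color 208788)) (color 81316)) (color 212628)))) (color 81556)))
  (color 147092)) (edge 44 [] (edge 26 [] (edge 53 [] (edge 33 [] (leaf 0 318434724) (edge 35 []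
  (leaf 2 253702756) (edge 62 [] (leaf 0 366816340) (color 190352)))) (edge 62 [] (leaf 0
  366816340) (color 245328))) (edge 35 [] (edge 17 [] (edge 53 [] (leaf 6 219674164) (edge 62 []
  (edge 33 [] (leaf 4 273682660) (color 124816)) (color 245328))) (color 81556)) (color 114256)))
  (color 179792))) (edge 17 [] (edge 26 [] (edge 44 [] (edge 62 [] (edge 13 [] (leaf 5 373852956)
  (edge 43 [] (leaf 5 204775500) (edge 35 [] (edge 53 [] (nbr 8 7) (color 216484)) (color
  215524)))) (color 211536)) (color 147024)) (color 81552)) (color 85924))) (edge 17 [] (edge 35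
  [] (edge 53 [] (edge 62 [] (edge 16 [] (edge 43 [] (leaf 5 223966820) (edge 44 [] (leaf 4
  369894820) (color 179792))) (edge 26 [] (edge 44 [] (nbr 8 7) (color 147024)) (color 81552)))
  (color 260688)) (color 200340)) (color 135060)) (color 69540))) (edge 61 [] (edge 17 [] (edge
  26 [] (edge 35 [] (edge 44 [] (edge 53 [] (edge 62 [] (nbr 8 7) (color 243344)) (color 233108))
  (color 179792)) (color 167828)) (color 114320)) (color 117732)) (deg 7))) (color 16020))) (edge
  26 [] (edge 16 [] (edge 34 [] (edge 61 [] (edge 8 [] (edge 35 [] (edge 43 [] (edge 53 [] (edge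
  13 [] (leaf 2 249465492) (edge 7 [] (leaf 3 219143612) (edge 17 [] (leaf 6 219674324) (edge 44
  [] (leaf 2 253702756) (color 81316))))) (edge 62 [] (edge 33 [] (edge 13 [] (leaf 3 318954204)
  (edge 7 [] (leaf 15 73785692) (edge 17 [] (leaf 4 273682676) (edge 44 [] (leaf 0 366816340)
  (color 81316))))) (edge 44 [] (leaf 0 366816340) (color 225168))) (color 229008))) (edge 44 []
  (edge 53 [] (leaf 2 253702756) (edge 62 [] (leaf 0 366816340) (color 245328))) (color 179792)))
  (edge 44 [] (edge 33 [] (edge 53 [] (leaf 0 318434724) (edge 62 [] (leaf 0 366816340) (color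
  229008))) (edge 62 [] (leaf 0 366816340) (color 159632))) (color 163472))) (edge 17 [] (edge 7
  [] (edge 44 [] (edge 53 [] (edge 33 [] (leaf 5 309509300) (edge 35 [] (leaf 5 224491700) (edge
  62 [] (leaf 0 325431956) (color 159632)))) (edge 62 [] (leaf 0 325431956) (color 229008)))
  (edge 53 [] (edge 43 [] (edge 35 [] (leaf 4 326848828) (color 163472)) (color 179792)) (edge 62
  [] (edge 33 [] (edge 43 [] (edge 35 [] (leaf 3 165925116) (color 163472)) (color 179792))
  (color 225168)) (color 229008)))) (color 16020)) (color 32400))) (edge 62 [] (edge 7 [] (edge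
  44 [] (edge 8 [] (leaf 1 36326756) (edge 17 [] (leaf 0 325431956) (color 64080))) (edge 53 []
  (edge 43 [] (edge 35 [] (edge 8 [] (leaf 4 26028740) (edge 17 [] (leaf 6 219143452) (color
  64080))) (color 163472)) (color 179792)) (color 195152))) (edge 8 [] (edge 17 [] (edge 35 []
  (edge 53 [] (edge 43 [] (leaf 4 369894980) (deg 7)) (color 200340)) (color 135060)) (color
  69540)) (color 16020))) (color 260688))) (edge 17 [] (edge 35 [] (edge 44 [] (edge 62 []
  (nonedge 8 [] (edge 13 [] (edge 7 [] (edge 43 [] (edge 33 [] (leaf 3 364413132) (edge 61 []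
  (leaf 4 74337620) (color 44948))) (color 48788)) (color 16020)) (color 48548)) (nonedge 53 []
  (edge 13 [] (edge 43 [] (edge 7 [] (leaf 15 265675172) (edge 61 [] (leaf 3 297359388) (color
  200340))) (color 233108)) (color 232868)) (nbr 8 7))) (color 227920)) (color 163408)) (color
  167828)) (color 102308))) (edge 8 [] (edge 17 [] (edge 35 [] (edge 53 [] (nonedge 44 [] (edge 7
  [] (edge 34 [] (edge 43 [] (edge 61 [] (leaf 4 25976236) (edge 62 [] (leaf 3 219674164) (color
  260688))) (color 179792)) (color 163408)) (color 147024)) (nonedge 62 [] (edge 7 [] (edge 34 []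
  (edge 61 [] (leaf 7 347255300) (color 260688)) (color 227920)) (color 211536)) (nbr 8 7)))
  (color 216724)) (color 151444)) (color 85924)) (color 32404))) (color 97936))) (color 251536))
  (color 249492))) (color 256080)) (color 247444)) (color 256020)) (color 256592)) (color
  248400)) (color 248468)) (color 246420)) (color 256336)) (color 248404)) (color 256320)

/-- Certificate for complements with a Hamiltonian cycle. -/
def certCycle9 : Cert :=
  edge 2 [] (edge 12 [] (edge 22 [] (edge 32 [] (edge 42 [] (edge 7 [] (edge 52 [] (edge 17 []
  (edge 62 [] (edge 4 [(5, 54480996)] (edge 13 [] (edge 6 [] (edge 23 [] (edge 16 [] (edge 33 []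
  (edge 3 [] (edge 26 [] (edge 43 [] (edge 5 [] (edge 44 [] (edge 24 [(25, 248124820)] (edge 15
  [] (leaf 9 12099812) (edge 25 [] (leaf 10 119855732) (edge 34 [] (edge 14 [] (leaf 0 325431812)
  (color 38884)) (color 40868)))) (edge 35 [] (edge 14 [] (edge 53 [] (edge 15 [(34, 248124820)]
  (leaf 9 230629212) (color 40868)) (color 220816)) (color 42980)) (color 155536))) (edge 53 []
  (edge 25 [] (edge 24 [] (leaf 14 13565892) (edge 34 [] (leaf 14 304131340) (edge 35 [] (use 0
  320201028) (color 171920)))) (edge 34 [] (edge 35 [] (edge 14 [] (leaf 9 35383252) (edge 15 []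
  (edge 24 [] (leaf 8 84714516) (color 42980)) (color 38884))) (color 163472)) (color 163408)))
  (color 195152))) (edge 53 [] (edge 14 [] (edge 15 [] (edge 35 [] (edge 25 [] (leaf 0 362008476)
  (edge 34 [] (leaf 5 156891204) (edge 44 [] (leaf 9 201912444) (color 163408)))) (edge 44 []
  (edge 24 [] (leaf 9 83804252) (edge 25 [] (edge 34 [] (leaf 8 90095356) (color 171920)) (color
  155536))) (color 193172))) (edge 24 [] (edge 25 [] (edge 35 [] (leaf 0 185518396) (edge 44 []
  (leaf 5 205259716) (color 193172))) (edge 34 [] (use 0 267743844) (color 40868))) (color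
  250516))) (edge 24 [] (edge 44 [] (edge 15 [] (leaf 14 278954652) (edge 25 [] (leaf 14
  182165140) (color 38884))) (color 193104)) (color 250512))) (color 62100))) (edge 44 [] (use 0
  286888644) (color 179792))) (edge 35 [] (use 0 47754956) (color 129616))) (edge 35 [] (use 0
  95584644) (color 64020))) (edge 34 [] (use 0 239072076) (color 44948))) (edge 25 [] (use 0
  348484132) (color 32404))) (edge 24 [] (use 0 191243844) (color 251536))) (edge 15 [] (use 0
  381367044) (color 248400))) (edge 14 [] (use 0 143414316) (color 62884))) (edge 6 [] (edge 3 []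
  (edge 13 [] (edge 15 [] (edge 33 [] (edge 35 [] (edge 53 [] (edge 23 [] (edge 43 [] (edge 14
  [(44, 54480996)] (edge 16 [] (edge 25 [] (edge 34 [] (leaf 9 326007668) (edge 44 [] (leaf 5
  361481276) (color 48276))) (edge 26 [] (edge 34 [] (leaf 14 138520548) (edge 44 [] (leaf 14
  352558820) (color 163408))) (color 97936))) (edge 25 [] (use 0 286868340) (color 32404)))
  (color 193104)) (edge 44 [] (use 0 286888644) (color 179792))) (edge 24 [] (use 0 191243844)
  (color 251536))) (color 62100)) (color 192660)) (color 254100)) (color 250020)) (color 256080))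
  (color 256020)) (color 246420))) (color 260688)) (color 64080)) (color 65172)) (color 16020))
  (color 256592)) (color 64148)) (color 256336)) (color 64084)) (color 256320)

/-- Certificate for complements with a 5-cycle and two disjoint edges. -/
def certCycle5 : Cert :=
  edge 2 [] (edge 3 [] (edge 12 [] (edge 13 [] (edge 22 [] (nonedge 5 [(14, 381354076), (23,
  381361052), (32, 381364788), (41, 381359668), (6, 380894652), (15, 380881684), (24, 380888660),
  (33, 380892396), (42, 380887276), (7, 286888644), (16, 286875676), (25, 286882652), (34,
  286886388), (43, 286881268), (8, 286416252), (17, 286403284), (26, 286410260), (35, 286413996),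
  (44, 286408876)] (edge 7 [(8, 343103292)] (edge 6 [] (edge 15 [] (edge 42 [] (nonedge 24 [(33,
  381346740)] (edge 14 [] (edge 23 [] (edge 25 [] (edge 32 [] (edge 16 [] (nonedge 34 [(43,
  380888660), (52, 380200484), (61, 379722420)] (edge 35 [] (edge 53 [] (edge 17 [] (edge 8 []
  (nonedge 26 [] (use 0 284550012) (nonedge 44 [] (use 0 284841612) (nonedge 62 [] (use 0
  93945780) (nbr 8 7)))) (edge 44 [] (edge 43 [] (edge 41 [] (edge 52 [] (edge 61 [] (leaf 12
  199926308) (edge 62 [] (leaf 7 238717676) (color 258708))) (edge 61 [] (use 0 191238012) (color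
  65172))) (edge 33 [] (use 1 379722420) (color 252496))) (color 48788)) (color 48276))) (edge 26
  [] (use 1 245111220) (color 113812))) (edge 62 [] (use 1 190765620) (color 244884))) (color
  179348)) (nbr 7 8)) (edge 17 [] (edge 26 [] (edge 8 [] (nonedge 35 [(44, 380888660), (53,
  380200484), (62, 379722420)] (use 1 245105388) (nbr 8 7)) (edge 44 [] (use 0 286868340) (color
  31908))) (edge 35 [] (use 0 284517612) (color 162980))) (color 97444))) (edge 41 [] (use 0
  380194812) (color 252560))) (edge 26 [] (edge 35 [] (edge 8 [] (edge 32 [] (nonedge 17 [] (use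
  0 284516964) (nonedge 44 [] (edge 34 [] (edge 43 [] (edge 33 [] (edge 61 [] (edge 16 [] (edge
  53 [] (leaf 4 165819284) (edge 62 [] (edge 52 [] (leaf 7 276444324) (color 253584)) (color
  229008))) (edge 62 [] (use 1 245204100) (color 225940))) (edge 53 [] (use 1 248152500) (color
  220816))) (edge 16 [] (use 1 245819700) (color 222116))) (color 179792)) (color 163408))
  (nonedge 53 [] (edge 52 [] (edge 61 [] (edge 62 [] (edge 33 [] (edge 34 [] (leaf 10 267497500)
  (edge 43 [] (leaf 14 374751812) (color 237200))) (edge 16 [] (use 1 190077444) (color 224420)))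
  (color 229008)) (color 220816)) (color 253584)) (nonedge 62 [] (use 0 189605052) (nbr 8 7)))))
  (edge 41 [] (use 0 380194812) (color 252560))) (edge 17 [] (edge 16 [] (edge 52 [] (edge 32 []
  (edge 43 [] (edge 61 [(53, 286882652)] (edge 41 [] (edge 34 [] (edge 53 [] (leaf 10 66219612)
  (edge 62 [] (leaf 14 309045636) (color 229008))) (edge 44 [] (edge 53 [] (leaf 7 181537836)
  (edge 62 [] (leaf 14 181100612) (color 229008))) (color 163408))) (edge 33 [] (edge 34 [] (edge
  53 [] (leaf 7 138023996) (edge 62 [] (leaf 11 331734708) (color 229008))) (edge 44 [] (use 1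
  379722420) (color 163408))) (color 252496))) (color 220816)) (edge 44 [] (use 0 286888644)
  (color 179792))) (edge 41 [] (use 0 380194812) (color 252560))) (edge 61 [] (use 0 191238012)
  (color 65172))) (color 32404)) (color 32400))) (edge 44 [] (use 0 284555844) (color 163472)))
  (color 97936))) (color 251536)) (color 250512)) (nonedge 61 [] (edge 62 [] (edge 17 [] (edge 35
  [] (edge 8 [] (nonedge 26 [] (use 0 189599220) (nonedge 44 [] (use 1 248152500) (nonedge 53 []
  (leaf 16 138556724) (nbr 8 7)))) (edge 53 [] (edge 52 [] (edge 14 [] (edge 32 [] (edge 16 []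
  (edge 43 [] (edge 25 [] (edge 34 [] (leaf 15 249480164) (edge 44 [] (leaf 4 297335612) (color
  48276))) (edge 26 [] (edge 34 [] (leaf 9 297290900) (edge 44 [] (leaf 10 366777236) (color
  163408))) (color 97936))) (edge 44 [] (use 0 286888644) (color 179792))) (edge 25 [] (use 0
  286868340) (color 32404))) (edge 41 [] (use 0 95584572) (color 64148))) (edge 23 [] (use 1
  381346740) (color 63124))) (color 65172)) (color 62100))) (edge 44 [] (use 0 93939948) (color
  193172))) (edge 26 [] (use 1 248132196) (color 127636))) (color 258708)) (nonedge 62 [] (edge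
  16 [] (nonedge 25 [] (use 0 189605052) (nonedge 34 [] (use 0 93945780) (nonedge 43 [] (use 1
  248624892) (nonedge 52 [] (leaf 16 138025292) (nbr 7 8))))) (edge 25 [] (use 1 248604588)
  (color 225940))) (nbr 6 5)))) (edge 43 [] (use 0 380894652) (edge 44 [] (use 0 380894652)
  (color 179792)))) (edge 24 [] (use 0 380874348) (color 250516))) (color 246420)) (color 16020))
  (cut 31)) (color 256336)) (color 256080)) (color 256084)) (color 256020)) (color 256320)

/-- Certificate for eight vertices, with an independent triple. -/
def certTriangle8 : Cert :=
  edge 5 [(6, 16205448), (7, 14141064)] (edge 4 [(6, 15947400), (7, 13883016)] (edge 3 [(6,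
  15685768), (7, 13621384)] (edge 6 [] (edge 7 [] (edge 37 [(38, 16205448), (46, 15947400), (31,
  14137480)] (edge 29 [(46, 15657096), (39, 13531784)] (edge 28 [] (leaf 4 11636625) (edge 46
  [(47, 14599816)] (edge 30 [(38, 16431240)] (leaf 4 13995793) (edge 47 [] (edge 31 [(39,
  16431240), (55, 15907976)] (leaf 4 16092433) (color 3510)) (color 5697))) (edge 55 [] (edge 30
  [(38, 16431240)] (edge 31 [] (leaf 4 16354065) (edge 39 [] (leaf 5 14437073) (color 4239)))
  (color 5697)) (color 6426)))) (edge 30 [] (edge 28 [] (edge 38 [] (leaf 4 13733713) (edge 55 []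
  (edge 31 [] (leaf 4 16354065) (edge 47 [] (leaf 5 14440657) (color 4077))) (color 6264))) (edge
  31 [] (edge 38 [] (edge 47 [] (leaf 5 16010449) (edge 55 [] (leaf 4 16354065) (color 6426)))
  (edge 55 [] (leaf 4 16354065) (color 6264))) (color 4239))) (color 5535))) (color 4320)) (edge
  15 [(23, 16434768)] (edge 12 [(13, 16406152), (14, 16148104)] (edge 11 [(13, 16373896), (14,
  16115848)] (edge 28 [] (edge 29 [(38, 16201864)] (edge 37 [] (leaf 4 11636625) (edge 30 []
  (edge 38 [] (leaf 4 13733713) (edge 46 [] (leaf 4 13995793) (edge 31 [] (nbr 3 2) (color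
  4320)))) (edge 39 [] (edge 31 [] (leaf 4 15834448) (edge 55 [] (edge 38 [] (leaf 5 14554666)
  (edge 46 [] (leaf 6 7404866) (color 4320))) (color 3591))) (edge 47 [] (edge 31 [] (leaf 5
  12425266) (edge 55 [] (edge 38 [] (leaf 7 7367626) (edge 46 [] (leaf 6 1766170) (color 4320)))
  (color 3591))) (color 5778))))) (edge 31 [] (edge 39 [] (leaf 4 15834448) (edge 55 [] (edge 30
  [] (leaf 5 14522410) (edge 46 [] (edge 37 [] (leaf 6 9239874) (edge 47 [] (leaf 6 16419018)
  (color 5778))) (color 5535))) (color 6264))) (edge 47 [] (edge 37 [] (edge 39 [] (leaf 5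
  12457522) (edge 55 [] (edge 30 [] (leaf 7 9202634) (edge 46 [] (leaf 6 1766170) (color 5535)))
  (color 6264))) (edge 46 [] (edge 30 [] (edge 39 [] (leaf 6 7404418) (edge 55 [] (leaf 6
  1766170) (color 6264))) (edge 55 [] (leaf 6 1766170) (color 3591))) (color 4320))) (color
  4077)))) (edge 46 [] (edge 30 [(38, 16431240)] (edge 29 [] (leaf 4 13995793) (edge 37 [] (edge
  38 [] (leaf 4 14028497) (edge 31 [] (edge 39 [] (leaf 6 10272066) (edge 55 [] (leaf 6 14522690)
  (color 6264))) (edge 47 [] (edge 39 [] (leaf 6 12457858) (edge 55 [] (leaf 7 1767514) (color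
  6264))) (color 4077)))) (edge 55 [] (edge 14 [] (edge 38 [] (nbr 6 2) (edge 31 [] (leaf 4
  16358160) (edge 47 [] (leaf 5 12523042) (color 4077)))) (edge 22 [] (edge 23 [] (edge 38 []
  (nbr 6 1) (edge 31 [] (edge 19 [] (leaf 4 16362248) (edge 20 [] (leaf 7 8102661) (edge 21 []
  (leaf 5 11236897) (color 1452)))) (edge 47 [] (edge 19 [] (leaf 5 12527137) (edge 20 [] (leaf 3
  12289697) (edge 21 [] (leaf 4 16427208) (color 1452)))) (color 4077)))) (color 1434)) (color
  1443))) (color 6183)))) (edge 47 [] (edge 13 [] (edge 29 [(37, 16431240)] (edge 37 [] (nbr 5 2)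
  (edge 31 [] (leaf 4 16096528) (edge 55 [] (leaf 5 14587426) (color 3591)))) (edge 55 [] (edge
  14 [] (leaf 4 16423120) (edge 22 [] (edge 23 [] (nonedge 31 [(39, 16431240)] (edge 19 [] (leaf
  7 12296900) (deg 3)) (nbr 7 0)) (color 1434)) (color 1443))) (color 6183))) (edge 21 [] (edge
  23 [] (edge 29 [(37, 16431240)] (edge 37 [] (nbr 5 1) (edge 31 [] (edge 19 [] (leaf 4 16100616)
  (edge 20 [] (leaf 7 7840518) (edge 22 [] (leaf 5 13301281) (color 1938)))) (edge 55 [] (edge 19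
  [] (leaf 5 14591521) (edge 20 [] (leaf 3 14124705) (edge 22 [] (leaf 4 16427208) (color
  1938)))) (color 3591)))) (edge 55 [] (edge 14 [] (nonedge 31 [(39, 16431240)] (edge 19 [] (leaf
  7 14131908) (deg 3)) (nbr 7 0)) (edge 22 [] (leaf 4 16427208) (color 1443))) (color 6183)))
  (color 1920)) (color 1929))) (color 5697))) (edge 47 [(55, 16205448)] (edge 31 [(39, 16431240)]
  (edge 29 [] (edge 13 [] (leaf 4 16096528) (edge 14 [] (edge 30 [] (leaf 5 12974626) (edge 38 []
  (leaf 6 1711962) (edge 23 [] (edge 21 [] (edge 19 [] (leaf 4 16100616) (edge 20 [] (leaf 7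
  7840518) (edge 22 [] (leaf 7 7840644) (color 1938)))) (color 1929)) (color 1920)))) (edge 23 []
  (edge 19 [] (edge 21 [] (leaf 4 16100616) (edge 22 [] (edge 30 [] (nbr 3 4) (edge 38 [] (leaf 0
  12424608) (color 1929))) (color 1200))) (edge 20 [] (edge 21 [] (leaf 7 7840518) (edge 22 []
  (edge 30 [] (leaf 3 11504738) (edge 38 [] (leaf 6 1716057) (color 1929))) (color 1200))) (color
  1209))) (color 1191)))) (edge 30 [] (edge 37 [] (edge 13 [] (edge 38 [] (leaf 6 12369154) (edge
  39 [] (leaf 4 16129232) (edge 55 [] (leaf 6 16353610) (color 6264)))) (edge 14 [] (edge 38 []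
  (leaf 6 13433602) (edge 39 [] (leaf 6 16125130) (edge 55 [] (leaf 4 16358160) (color 6264))))
  (edge 23 [] (edge 22 [] (edge 19 [] (edge 38 [] (leaf 3 5206572) (edge 39 [] (leaf 2 6134828)
  (edge 55 [] (leaf 4 16362248) (color 6264)))) (edge 20 [] (edge 38 [] (leaf 7 13653969) (edge
  39 [] (leaf 0 12457368) (edge 55 [] (leaf 7 8102661) (color 6264)))) (color 1209))) (edge 38 []
  (edge 21 [] (edge 19 [] (leaf 6 12401921) (edge 20 [] (leaf 6 9795457) (color 1209))) (color
  1200)) (edge 55 [] (edge 21 [] (edge 19 [] (leaf 0 14521696) (edge 20 [] (leaf 6 16353617)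
  (color 1209))) (color 1200)) (deg 6)))) (color 1191)))) (edge 55 [] (edge 14 [] (leaf 4
  16358160) (edge 22 [] (edge 23 [] (edge 19 [] (leaf 4 16362248) (edge 20 [] (leaf 7 8102661)
  (edge 13 [] (edge 21 [] (leaf 5 11265632) (color 1452)) (color 1209)))) (color 1434)) (color
  1443))) (color 6183))) (edge 39 [] (edge 37 [] (edge 13 [] (leaf 4 16129232) (edge 14 [] (edge
  38 [] (leaf 5 13007386) (edge 23 [] (edge 21 [] (nonedge 55 [] (edge 22 [] (leaf 3 10393264)
  (deg 6)) (nbr 7 0)) (color 1929)) (color 1920))) (edge 23 [] (nonedge 55 [] (edge 38 [] (edge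
  19 [] (edge 22 [] (leaf 2 3397296) (deg 6)) (edge 20 [] (nbr 4 3) (color 1209))) (deg 6)) (nbr
  7 0)) (color 1191)))) (edge 38 [] (edge 55 [] (edge 14 [] (leaf 4 16390864) (edge 23 [] (nbr 7
  0) (color 1434))) (color 6183)) (color 2172))) (color 5535)))) (color 4239)) (color 6426))))
  (deg 1)) (deg 1)) (edge 31 [(39, 16431240)] (edge 13 [(14, 16205448)] (edge 37 [(30, 3271352)]
  (edge 29 [] (edge 28 [] (leaf 4 11636625) (edge 46 [] (edge 30 [] (leaf 4 13995793) (edge 38 []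
  (leaf 4 14028497) (color 1323))) (color 2052))) (edge 38 [] (edge 28 [] (edge 30 [(46,
  3787448)] (leaf 4 13733713) (color 1161)) (edge 46 [] (leaf 4 14028497) (color 2052))) (color
  1890))) (color 1404)) (deg 1)) (deg 7)))) (edge 14 [(22, 16434768)] (edge 7 [] (edge 12 [(13,
  16406152), (15, 12220040)] (edge 11 [(13, 16373896), (15, 12187784)] (nonedge 28 [] (edge 46
  [(55, 12306056)] (edge 29 [(37, 16431240)] (edge 30 [] (edge 13 [] (leaf 4 13999888) (edge 22
  [] (edge 21 [] (edge 19 [] (leaf 4 14003976) (edge 20 [] (leaf 7 7807751) (edge 23 [] (edge 15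
  [] (leaf 7 7807940) (edge 47 [] (leaf 5 15394337) (color 2667))) (deg 2)))) (edge 31 []
  (nonedge 19 [] (edge 23 [] (edge 20 [] (leaf 3 11472482) (deg 2)) (deg 2)) (nbr 3 4)) (edge 39
  [] (edge 15 [] (leaf 6 1973594) (edge 23 [] (edge 19 [] (leaf 0 12162528) (edge 20 [] (leaf 6
  1977689) (deg 2))) (edge 47 [] (leaf 6 12163522) (color 2658)))) (color 4845)))) (edge 31 []
  (edge 15 [] (leaf 5 15067682) (edge 47 [] (leaf 4 16092433) (color 2649))) (edge 39 [] (edge 15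
  [] (leaf 6 1973594) (edge 47 [] (leaf 6 12163522) (color 2649))) (color 4836))))) (edge 38 []
  (edge 37 [] (edge 13 [] (leaf 4 14032592) (edge 21 [] (nonedge 47 [] (edge 22 [] (edge 19 []
  (leaf 5 10135097) (edge 20 [] (leaf 4 14036680) (edge 15 [] (edge 23 [] (leaf 3 9897657) (deg
  2)) (color 2667)))) (edge 15 [] (edge 31 [] (leaf 6 12197570) (edge 39 [] (leaf 5 15100442)
  (color 4836))) (color 2649))) (nbr 5 1)) (edge 31 [] (edge 15 [] (leaf 6 12197570) (edge 23 []
  (edge 22 [] (edge 19 [] (leaf 6 1467865) (edge 20 [] (leaf 0 12195288) (deg 2))) (edge 47 []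
  (leaf 4 16092433) (color 2649))) (edge 47 [] (leaf 4 16092433) (color 2658)))) (edge 39 []
  (nonedge 20 [] (edge 23 [] (edge 22 [] (edge 19 [] (leaf 3 11734618) (deg 2)) (deg 2)) (deg 2))
  (nbr 4 3)) (color 4845))))) (edge 39 [] (edge 31 [] (edge 13 [] (leaf 6 12111554) (edge 22 []
  (edge 19 [] (edge 21 [] (leaf 6 7694785) (edge 15 [] (leaf 6 15788738) (edge 23 [] (leaf 7
  15489425) (edge 47 [] (leaf 4 16092433) (color 2658))))) (edge 20 [] (edge 21 [] (leaf 6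
  12144321) (edge 23 [] (leaf 3 5497387) (deg 2))) (edge 15 [] (leaf 6 15788738) (edge 47 []
  (leaf 4 16092433) (color 2667))))) (edge 15 [] (leaf 6 15788738) (edge 47 [] (leaf 4 16092433)
  (color 2649))))) (edge 55 [] (nonedge 15 [] (edge 13 [] (leaf 6 14550858) (edge 22 [] (edge 19
  [] (edge 21 [] (leaf 6 14550865) (edge 23 [] (leaf 7 10429125) (edge 47 [] (leaf 6 16389954)
  (color 2658)))) (edge 20 [] (edge 21 [] (leaf 0 16389464) (edge 23 [] (leaf 4 16394952) (deg
  2))) (edge 47 [] (leaf 6 16389954) (color 2667)))) (edge 47 [] (leaf 6 16389954) (color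
  2649)))) (nonedge 23 [] (leaf 4 16390864) (nonedge 47 [] (leaf 4 16390864) (nbr 7 3)))) (color
  3591))) (edge 47 [] (edge 31 [] (leaf 4 16092433) (edge 55 [] (edge 13 [] (leaf 5 16422434)
  (edge 21 [] (edge 22 [] (edge 19 [] (leaf 5 16426529) (edge 20 [] (leaf 2 5732440) (edge 23 []
  (leaf 4 16427208) (color 4854)))) (color 4836)) (color 4845))) (color 3591))) (color 5778))))
  (edge 47 [] (edge 31 [] (leaf 4 16092433) (edge 39 [] (edge 37 [] (leaf 4 16125137) (edge 55 []
  (leaf 7 1566810) (color 3591))) (edge 55 [] (edge 13 [] (leaf 5 16422434) (edge 21 [] (edge 22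
  [] (nonedge 37 [] (edge 20 [] (leaf 3 16189089) (deg 4)) (nbr 5 1)) (color 4836)) (color
  4845))) (color 3510)))) (color 5697)))) (edge 55 [] (edge 15 [] (edge 31 [(39, 16431240)] (edge
  30 [] (leaf 4 16358160) (edge 39 [] (edge 38 [] (leaf 4 16390864) (edge 47 [] (nbr 7 2) (color
  5697))) (edge 47 [] (leaf 5 12293666) (color 5778)))) (edge 47 [] (edge 13 [] (leaf 4 16423120)
  (edge 21 [] (edge 22 [] (nonedge 30 [(38, 16431240)] (edge 19 [] (leaf 7 16196292) (deg 3))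
  (nbr 6 0)) (color 4836)) (color 4845))) (color 5088))) (edge 23 [] (edge 22 [] (nonedge 30
  [(38, 16431240)] (edge 39 [] (edge 38 [] (edge 19 [] (leaf 7 10429125) (edge 20 [] (leaf 4
  16394952) (edge 21 [] (edge 13 [] (leaf 5 11237464) (edge 47 [] (leaf 4 16427208) (color
  2667))) (color 2910)))) (edge 47 [] (nonedge 31 [] (edge 19 [] (leaf 3 12519577) (deg 3)) (nbr
  7 1)) (color 5697))) (edge 47 [] (edge 19 [] (edge 13 [] (leaf 7 12526276) (edge 21 [] (leaf 4
  16427208) (edge 31 [] (leaf 5 12297761) (color 4845)))) (edge 20 [] (edge 31 [] (leaf 3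
  12519073) (deg 3)) (edge 21 [] (leaf 4 16427208) (color 2910)))) (color 5778))) (nbr 6 0))
  (color 2892)) (color 2901))) (color 6183))) (edge 47 [] (edge 29 [(37, 16431240)] (edge 31 []
  (leaf 4 16092433) (edge 39 [] (edge 37 [] (leaf 4 16125137) (edge 30 [] (edge 38 [] (leaf 6
  7917378) (color 4320)) (color 3591))) (color 4239))) (color 6183)) (color 6426))) (nonedge 29
  [(31, 12306056)] (edge 38 [] (nonedge 37 [] (edge 30 [] (leaf 4 13737808) (edge 39 [] (edge 31
  [] (leaf 4 15830353) (edge 55 [] (leaf 5 16389674) (color 3591))) (edge 47 [] (edge 46 [] (edge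
  31 [] (leaf 6 7400386) (edge 55 [] (leaf 6 14583562) (color 3591))) (color 5535)) (color
  5778)))) (nonedge 39 [] (edge 30 [] (leaf 4 13737808) (edge 46 [] (leaf 5 12195386) (color
  5535))) (nbr 4 2))) (edge 31 [] (edge 39 [] (leaf 4 15830353) (edge 55 [] (edge 30 [] (leaf 5
  16357418) (edge 46 [] (edge 37 [] (leaf 7 9206666) (edge 47 [] (leaf 6 2024218) (color 5778)))
  (color 5535))) (color 6264))) (edge 47 [] (edge 37 [] (edge 39 [] (leaf 4 16125137) (edge 55 []
  (edge 30 [] (leaf 6 9236290) (edge 46 [] (leaf 6 2024218) (color 5535))) (color 6264))) (edge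
  46 [] (edge 30 [] (edge 39 [] (leaf 6 9235394) (edge 55 [] (leaf 6 14584010) (color 6264)))
  (edge 55 [] (leaf 6 2024218) (color 3591))) (color 4320))) (color 4077)))) (nonedge 30 [] (edge
  37 [(39, 12306056)] (leaf 4 11636625) (edge 47 [] (leaf 4 16092433) (color 5778))) (nbr 3 2))))
  (deg 1)) (deg 1)) (edge 15 [] (edge 28 [(29, 16406152), (37, 16373896)] (edge 11 [(12,
  16431240)] (nonedge 29 [] (edge 38 [(39, 14599816)] (edge 12 [] (nonedge 37 [] (edge 30 []
  (leaf 4 13737808) (edge 39 [] (edge 31 [] (leaf 4 15834448) (edge 55 [] (leaf 4 16390864)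
  (color 3591))) (edge 47 [] (edge 46 [] (edge 31 [] (leaf 7 9239874) (edge 55 [] (leaf 6
  4149530) (color 3591))) (color 5535)) (color 5778)))) (nonedge 39 [] (edge 30 [] (leaf 4
  13737808) (edge 46 [] (leaf 5 12195386) (color 5535))) (nbr 4 2))) (edge 20 [] (edge 30 []
  (edge 22 [] (edge 19 [] (leaf 4 13741896) (edge 21 [] (edge 13 [] (leaf 7 7545671) (edge 37 []
  (leaf 5 11167289) (edge 55 [] (edge 23 [] (leaf 5 15418984) (edge 31 [] (leaf 4 16358160)
  (color 4773))) (color 399)))) (edge 55 [] (edge 23 [] (leaf 5 15418984) (deg 2)) (color 642))))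
  (edge 31 [] (nonedge 19 [] (edge 23 [] (edge 21 [] (edge 13 [] (leaf 3 13508138) (edge 37 []
  (leaf 2 944825) (edge 55 [] (leaf 4 16358160) (color 399)))) (deg 2)) (deg 2)) (nbr 3 5)) (edge
  47 [] (edge 13 [] (edge 23 [] (edge 19 [] (leaf 0 13731305) (edge 21 [] (leaf 6 4106648) (deg
  2))) (edge 55 [] (leaf 6 13732810) (color 624))) (edge 37 [] (edge 23 [] (edge 19 [] (leaf 1
  5136761) (edge 21 [] (leaf 6 10067792) (deg 2))) (edge 55 [] (leaf 6 7928578) (color 624)))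
  (color 4755))) (color 4998)))) (edge 46 [] (edge 37 [] (edge 22 [] (edge 19 [] (leaf 5
  12199481) (edge 21 [] (leaf 4 14036680) (edge 55 [] (edge 23 [] (leaf 2 5463640) (deg 2))
  (color 642)))) (edge 31 [] (edge 23 [] (edge 19 [] (leaf 2 5344885) (edge 21 [] (leaf 0
  14026201) (deg 2))) (edge 55 [] (leaf 6 8186626) (color 624))) (edge 47 [] (edge 23 [] (edge 19
  [] (leaf 3 1170617) (edge 21 [] (leaf 1 13796811) (deg 2))) (edge 55 [] (leaf 6 12523266)
  (color 624))) (color 4998)))) (edge 31 [] (edge 13 [] (edge 39 [] (edge 19 [] (edge 22 [] (leaf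
  0 15828393) (edge 23 [] (leaf 4 15838536) (edge 55 [] (leaf 6 15829898) (color 624)))) (edge 21
  [] (edge 22 [] (leaf 6 10328976) (edge 23 [] (leaf 7 7578438) (deg 2))) (edge 55 [] (leaf 6
  15829898) (color 642)))) (edge 47 [] (edge 19 [] (edge 22 [] (leaf 6 13713224) (edge 23 []
  (leaf 3 5226613) (edge 55 [] (leaf 4 16423120) (color 624)))) (edge 21 [] (edge 22 [] (leaf 6
  12142536) (edge 23 [] (leaf 7 16049936) (deg 2))) (edge 55 [] (leaf 4 16423120) (color 642))))
  (color 5778))) (edge 23 [] (edge 19 [] (edge 39 [] (leaf 4 15838536) (edge 47 [] (leaf 3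
  5226613) (color 5778))) (edge 22 [] (edge 55 [] (edge 39 [] (leaf 4 16394952) (edge 47 [] (leaf
  0 12522776) (color 5778))) (color 399)) (color 1857))) (color 1839))) (edge 55 [] (edge 22 []
  (edge 23 [] (edge 39 [] (leaf 4 16394952) (edge 47 [] (leaf 0 12522776) (color 5778))) (edge 39
  [] (edge 13 [] (edge 19 [] (leaf 2 5928489) (edge 21 [] (leaf 5 15936088) (deg 2))) (color
  1839)) (edge 47 [] (edge 13 [] (leaf 4 16423120) (color 1839)) (color 5778)))) (edge 47 []
  (edge 13 [] (leaf 4 16423120) (color 4755)) (color 4998))) (color 3591)))) (edge 23 [] (edge 39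
  [] (edge 37 [] (nbr 4 1) (edge 31 [] (edge 19 [] (leaf 4 15838536) (edge 13 [] (edge 21 []
  (leaf 7 7578438) (edge 55 [] (nonedge 47 [] (deg 5) (nbr 7 0)) (color 642))) (edge 55 []
  (nonedge 47 [] (deg 5) (nbr 7 0)) (color 399)))) (edge 55 [] (edge 22 [] (leaf 4 16394952)
  (edge 47 [] (edge 13 [] (edge 19 [] (leaf 2 6186537) (edge 21 [] (leaf 5 13871704) (color
  2100))) (color 4755)) (color 4998))) (color 3591)))) (color 5535)) (color 2082)))) (edge 55 []
  (edge 30 [] (edge 31 [] (leaf 4 16358160) (edge 47 [] (edge 13 [] (leaf 6 13732810) (edge 37 []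
  (leaf 6 7928578) (edge 22 [] (edge 21 [] (edge 19 [] (leaf 1 5194728) (edge 23 [] (leaf 6
  13732817) (color 4773))) (color 4764)) (color 4755)))) (color 5007))) (edge 46 [] (edge 31 []
  (edge 37 [] (leaf 6 8186626) (edge 39 [] (edge 13 [] (leaf 6 15829898) (edge 21 [] (edge 23 []
  (edge 19 [] (leaf 1 5227432) (edge 22 [] (leaf 1 10425667) (color 1857))) (color 1839)) (color
  1848))) (edge 47 [] (edge 13 [] (leaf 4 16423120) (edge 21 [] (edge 23 [] (edge 19 [] (leaf 5
  14132832) (edge 22 [] (leaf 4 16427208) (color 1857))) (color 1839)) (color 1848))) (color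
  5778)))) (edge 47 [] (edge 13 [] (leaf 4 16423120) (edge 37 [] (leaf 6 12523266) (edge 22 []
  (edge 21 [] (edge 23 [] (leaf 4 16427208) (color 1839)) (color 1848)) (color 4755)))) (color
  5007))) (color 2091))) (color 633)))) (edge 55 [] (edge 30 [] (edge 31 [] (leaf 4 16358160)
  (edge 47 [] (edge 37 [] (leaf 6 7928578) (edge 46 [] (edge 12 [] (leaf 6 4149530) (edge 13 []
  (leaf 4 16423120) (edge 22 [] (edge 20 [] (edge 19 [] (leaf 2 3092292) (edge 23 [] (leaf 0
  12522776) (color 4773))) (deg 4)) (color 4755)))) (color 4320))) (color 4077))) (edge 46 []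
  (edge 37 [] (edge 31 [] (leaf 6 8186626) (edge 47 [] (leaf 6 12523266) (color 4077))) (edge 47
  [] (edge 12 [] (leaf 6 4149530) (edge 13 [] (leaf 4 16423120) (edge 23 [] (edge 20 [] (edge 22
  [] (leaf 0 12522776) (edge 31 [] (edge 19 [] (leaf 2 3124548) (color 1857)) (color 4755))) (deg
  4)) (color 1839)))) (color 5778))) (color 5535))) (color 6264))) (nonedge 30 [(31, 14599816)]
  (edge 37 [] (leaf 4 11636625) (edge 39 [(47, 16406152)] (edge 31 [] (edge 12 [] (leaf 4
  15834448) (edge 13 [] (leaf 5 10876978) (edge 23 [] (edge 19 [] (nbr 3 6) (edge 22 [] (edge 55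
  [] (edge 20 [] (leaf 5 13354600) (edge 21 [] (leaf 2 3132584) (color 1848))) (color 399))
  (color 1857))) (color 1839)))) (edge 55 [] (edge 38 [] (edge 12 [] (leaf 4 16390864) (edge 13
  [] (leaf 6 10427074) (edge 22 [] (edge 23 [] (edge 20 [] (leaf 4 16394952) (edge 21 [] (leaf 0
  10425688) (color 1848))) (color 1839)) (color 4755)))) (edge 46 [] (edge 12 [] (leaf 6
  10283714) (edge 13 [] (leaf 6 12122306) (edge 22 [] (edge 23 [] (edge 20 [] (leaf 6 10316481)
  (edge 21 [] (leaf 6 12155073) (color 1848))) (color 1839)) (color 4755)))) (color 4320)))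
  (color 3591))) (color 5778))) (nbr 3 2))) (edge 13 [] (nonedge 29 [(37, 16431240)] (edge 20 []
  (edge 38 [(39, 14599816)] (edge 19 [] (edge 30 [] (edge 22 [] (leaf 4 13741896) (edge 31 []
  (edge 23 [] (edge 37 [] (leaf 1 13731277) (edge 39 [] (leaf 4 15838536) (edge 47 [] (leaf 0
  13731305) (color 5052)))) (edge 55 [] (edge 37 [] (leaf 6 8329986) (edge 39 [] (leaf 4
  16398984) (edge 47 [] (leaf 6 13732810) (color 5052)))) (color 624))) (edge 47 [] (edge 23 []
  (leaf 0 13731305) (edge 55 [] (leaf 6 13732810) (color 624))) (color 4998)))) (edge 46 [] (edge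
  37 [] (edge 22 [] (leaf 5 12199481) (edge 31 [] (edge 23 [] (leaf 6 10133200) (edge 55 [] (leaf
  6 12121858) (color 624))) (edge 47 [] (nonedge 21 [] (edge 23 [] (leaf 2 1468089) (deg 2)) (nbr
  5 3)) (color 4998)))) (edge 39 [] (edge 31 [] (edge 22 [] (leaf 0 15828393) (edge 23 [] (leaf 4
  15838536) (edge 55 [] (leaf 6 15829898) (color 624)))) (edge 55 [] (edge 22 [] (leaf 2 5928489)
  (edge 47 [] (leaf 4 16423120) (color 4998))) (color 3591))) (edge 47 [] (edge 31 [] (edge 22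
  [(23, 14596232)] (leaf 6 13713224) (edge 55 [] (leaf 4 16423120) (color 624))) (edge 55 []
  (leaf 4 16423120) (color 3591))) (color 5778)))) (edge 23 [] (edge 39 [] (edge 37 [] (nbr 4 1)
  (edge 31 [] (leaf 4 15838536) (edge 55 [] (edge 22 [] (leaf 4 16394952) (edge 47 [] (leaf 2
  6186537) (color 4998))) (color 3591)))) (color 5535)) (color 2082)))) (edge 30 [] (edge 37 []
  (edge 21 [] (edge 22 [] (leaf 5 11167289) (edge 23 [] (edge 31 [] (leaf 3 1227961) (edge 47 []
  (leaf 2 5410419) (color 4998))) (deg 2))) (edge 55 [] (edge 23 [] (edge 22 [] (leaf 2 5455464)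
  (deg 2)) (deg 2)) (color 642))) (edge 55 [] (edge 39 [] (edge 22 [] (edge 21 [] (leaf 1
  5455464) (edge 23 [] (leaf 4 16394952) (deg 2))) (edge 31 [] (leaf 4 16398984) (edge 47 []
  (leaf 6 13732810) (color 4998)))) (edge 47 [] (leaf 6 13732810) (color 5061))) (color 687)))
  (edge 31 [] (nonedge 37 [(39, 12304523)] (edge 55 [] (edge 46 [] (edge 39 [] (leaf 6 15829898)
  (edge 47 [] (leaf 4 16423120) (color 5061))) (edge 23 [] (edge 39 [] (nonedge 47 [] (edge 21 []
  (leaf 1 5487720) (deg 5)) (nbr 7 0)) (color 5535)) (color 2082))) (color 687)) (nbr 4 1)) (deg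
  3)))) (edge 55 [] (edge 30 [] (edge 31 [] (edge 37 [] (leaf 6 8329986) (edge 46 [] (edge 19 []
  (edge 22 [] (leaf 2 5896233) (edge 47 [] (leaf 4 16423120) (color 5052))) (edge 47 [] (leaf 4
  16423120) (color 5061))) (edge 23 [] (edge 19 [] (edge 22 [] (leaf 4 16362248) (edge 47 []
  (leaf 2 6154281) (color 5052))) (color 2145)) (color 2136)))) (edge 47 [] (edge 37 [] (leaf 6
  12379906) (edge 46 [] (leaf 4 16423120) (color 4320))) (color 4077))) (edge 46 [] (edge 37 []
  (edge 31 [] (leaf 6 12121858) (edge 47 [] (leaf 4 16423120) (color 4077))) (edge 47 [] (leaf 4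
  16423120) (color 5778))) (color 5535))) (color 6264))) (edge 55 [] (edge 30 [] (edge 31 []
  (edge 37 [] (leaf 6 8329986) (edge 38 [(39, 14599816)] (edge 19 [] (edge 22 [] (edge 21 []
  (leaf 1 5197416) (edge 23 [] (leaf 4 16362248) (deg 2))) (edge 39 [] (leaf 4 16398984) (edge 47
  [] (leaf 6 13732810) (color 5052)))) (edge 39 [] (leaf 4 16398984) (edge 47 [] (leaf 6
  13732810) (color 5061)))) (deg 4))) (edge 47 [] (edge 37 [] (leaf 6 12379906) (edge 38 [] (leaf
  6 13732810) (edge 46 [] (leaf 4 16423120) (color 4320)))) (color 5007))) (edge 46 [] (edge 31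
  [] (edge 37 [] (leaf 6 12121858) (edge 39 [] (leaf 6 15829898) (edge 47 [] (leaf 4 16423120)
  (color 5778)))) (edge 47 [] (leaf 4 16423120) (color 5007))) (color 2091))) (color 633)))
  (nonedge 46 [(47, 14599816)] (leaf 4 11636625) (nbr 5 2))) (deg 1))) (edge 55 [] (edge 30 [(38,
  16431240), (46, 16398984)] (edge 38 [(46, 16406152)] (edge 11 [(12, 16431240)] (edge 31 []
  (leaf 4 16358160) (edge 39 [] (edge 12 [] (leaf 4 16390864) (edge 22 [] (nonedge 46 [] (edge 21
  [] (edge 13 [] (edge 20 [] (leaf 3 16389800) (edge 47 [] (leaf 7 13096986) (color 5007))) (edge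
  47 [] (edge 19 [] (leaf 3 3799208) (edge 23 [] (leaf 1 10196291) (color 4773))) (deg 5))) (edge
  47 [] (edge 13 [] (leaf 7 13096986) (deg 5)) (deg 5))) (nbr 6 0)) (edge 47 [] (edge 13 [] (leaf
  7 13096986) (color 4755)) (color 4998)))) (edge 47 [] (edge 46 [] (edge 13 [] (leaf 4 16423120)
  (edge 22 [] (nbr 6 0) (color 4836))) (color 4239)) (color 5088)))) (edge 13 [] (edge 46 []
  (edge 22 [] (nbr 6 0) (edge 47 [] (leaf 4 16423120) (color 4971))) (edge 23 [] (edge 31 [(39,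
  16431240)] (edge 22 [] (edge 19 [] (leaf 4 16362248) (edge 20 [] (edge 39 [] (leaf 4 16394952)
  (edge 47 [] (leaf 1 8102724) (color 5061))) (color 2064))) (edge 47 [] (edge 21 [] (nonedge 39
  [] (edge 20 [] (leaf 3 4122272) (deg 4)) (nbr 7 0)) (color 2073)) (color 4971))) (color 4239))
  (color 2055))) (deg 1))) (edge 31 [] (edge 11 [] (leaf 4 16358160) (edge 19 [] (edge 23 []
  (edge 22 [] (leaf 4 16362248) (edge 39 [(47, 16406152)] (nonedge 47 [] (edge 12 [] (edge 21 []
  (edge 13 [] (leaf 3 14522536) (deg 5)) (deg 5)) (color 4971)) (nbr 7 0)) (color 5052))) (color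
  2136)) (color 2145))) (color 4320))) (color 2172)) (color 714))) (edge 23 [] (edge 28 [(29,
  16406152), (37, 16373896)] (nonedge 22 [(55, 5949384)] (edge 11 [(12, 16431240)] (edge 12 []
  (edge 19 [(20, 16431240)] (edge 20 [] (nonedge 30 [(31, 14599760)] (nonedge 38 [] (edge 55 []
  (edge 46 [] (edge 31 [(39, 16431240)] (edge 37 [] (leaf 1 3245557) (edge 39 [] (leaf 4
  15838536) (edge 47 [] (leaf 0 1152501) (color 5778)))) (edge 47 [] (leaf 0 1152501) (deg 7)))
  (deg 6)) (deg 6)) (nonedge 39 [] (edge 37 [] (nbr 4 7) (edge 47 [] (edge 46 [] (edge 31 []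
  (leaf 1 1152494) (edge 55 [] (leaf 0 1152501) (color 3591))) (edge 55 [] (edge 29 [] (leaf 1
  5112765) (color 5535)) (deg 6))) (color 5778))) (nbr 4 5))) (nbr 3 5)) (edge 21 [] (edge 29 []
  (edge 37 [] (leaf 4 11636625) (edge 30 [] (nbr 3 7) (edge 31 [] (nbr 3 6) (edge 55 [] (edge 38
  [] (edge 39 [] (leaf 2 3018197) (edge 47 [] (leaf 6 7699720) (color 5778))) (edge 46 [] (edge
  39 [] (leaf 3 967358) (edge 47 [] (leaf 2 5148556) (color 5778))) (color 4320))) (color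
  3591))))) (edge 38 [] (edge 30 [] (leaf 4 13737808) (edge 46 [] (edge 37 [] (leaf 5 12195386)
  (edge 39 [] (edge 31 [] (leaf 1 947114) (edge 55 [] (leaf 3 3272234) (color 3591))) (edge 47 []
  (edge 31 [] (leaf 6 8215816) (edge 55 [] (leaf 6 14591752) (color 3591))) (color 5778))))
  (color 2088))) (color 1359))) (deg 2))) (deg 2)) (edge 13 [] (edge 29 [] (edge 19 [] (edge 37
  [] (leaf 4 11636625) (edge 30 [] (nbr 3 7) (edge 31 [] (nbr 3 6) (edge 55 [] (edge 20 [] (edge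
  38 [] (edge 39 [] (leaf 2 5115789) (edge 47 [] (leaf 3 938686) (color 5778))) (edge 46 [] (edge
  39 [] (leaf 6 7437640) (edge 47 [] (leaf 2 3050964) (color 5778))) (color 4320))) (edge 21 []
  (edge 38 [(39, 14599760)] (edge 39 [] (leaf 0 1414644) (edge 47 [] (leaf 1 3048948) (color
  5778))) (deg 4)) (color 1845))) (color 3591))))) (edge 37 [] (leaf 4 11636625) (edge 30 []
  (edge 38 [] (leaf 5 10872890) (edge 46 [] (leaf 4 13999888) (color 2142))) (color 1413))))
  (edge 39 [] (edge 20 [] (edge 31 [] (edge 19 [] (leaf 4 15838536) (edge 21 [] (edge 37 [] (leaf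
  5 11171377) (edge 30 [] (edge 38 [] (leaf 1 945833) (edge 46 [] (leaf 6 8268680) (color 2142)))
  (color 1413))) (deg 2))) (edge 47 [] (edge 19 [] (edge 37 [] (leaf 5 12461617) (edge 38 []
  (edge 30 [] (leaf 1 943593) (edge 55 [] (leaf 3 5372969) (color 3591))) (edge 46 [] (edge 30 []
  (leaf 6 7437192) (edge 55 [] (leaf 6 16422672) (color 3591))) (color 4320)))) (edge 21 [] (edge
  37 [] (leaf 4 16133320) (edge 30 [] (edge 38 [] (leaf 6 10066896) (edge 46 [] (leaf 6 12404616)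
  (color 2142))) (color 1413))) (deg 2))) (color 4998))) (edge 38 [] (edge 55 [] (edge 21 []
  (nonedge 19 [] (deg 2) (nonedge 30 [(31, 14599760)] (edge 46 [] (edge 31 [] (leaf 7 7595329)
  (edge 47 [] (leaf 7 12305608) (color 4998))) (color 2088)) (nbr 3 5))) (deg 2)) (color 633))
  (color 1359))) (color 2811))) (deg 1))) (deg 1)) (nonedge 30 [(38, 16431240)] (nonedge 20 [(39,
  5949384)] (edge 21 [] (edge 29 [] (edge 37 [] (leaf 4 11636625) (edge 39 [] (edge 38 [] (leaf 6
  10431169) (edge 46 [] (leaf 6 12155073) (edge 31 [] (edge 19 [] (leaf 5 11139121) (color 2142))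
  (color 4320)))) (edge 47 [] (edge 38 [] (leaf 6 12413121) (edge 46 [] (leaf 4 16427208) (edge
  31 [] (edge 19 [] (leaf 4 16100616) (color 2142)) (color 4320)))) (color 5778)))) (edge 46 []
  (edge 31 [] (edge 37 [] (leaf 6 12154625) (edge 39 [] (leaf 6 15829905) (edge 47 [] (leaf 4
  16427208) (color 5778)))) (edge 39 [] (edge 12 [] (edge 38 [] (edge 11 [] (leaf 2 3831338)
  (edge 13 [] (leaf 5 11237464) (deg 1))) (edge 47 [] (leaf 4 16427208) (color 4077))) (edge 47
  [] (leaf 4 16427208) (color 5007))) (edge 47 [] (leaf 4 16427208) (deg 7)))) (color 2088)))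
  (edge 37 [] (edge 29 [] (leaf 4 11636625) (edge 46 [] (edge 19 [] (edge 31 [] (leaf 6 8219393)
  (edge 39 [] (edge 12 [] (edge 38 [] (nbr 4 2) (edge 47 [] (leaf 6 12527361) (color 4077)))
  (edge 47 [] (leaf 6 12527361) (color 5007))) (edge 47 [] (leaf 6 12527361) (deg 7)))) (deg 2))
  (color 2088))) (color 1845))) (nonedge 37 [] (edge 38 [] (leaf 4 16394952) (edge 46 [] (edge 29
  [] (leaf 6 10316481) (edge 31 [] (edge 19 [] (leaf 4 15838536) (edge 21 [] (leaf 6 15829905)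
  (color 1899))) (edge 47 [] (edge 19 [] (leaf 6 6246681) (edge 21 [] (leaf 4 16427208) (color
  1899))) (color 4077)))) (edge 31 [] (edge 19 [] (leaf 4 15838536) (color 2142)) (color 4320))))
  (nonedge 38 [] (edge 29 [] (leaf 4 11636625) (edge 31 [] (edge 19 [] (leaf 4 15838536) (edge 21
  [] (leaf 5 11171377) (color 1899))) (edge 47 [] (edge 19 [] (leaf 5 12461617) (edge 21 [] (leaf
  4 16133320) (color 1899))) (color 4077)))) (nbr 4 1)))) (nonedge 46 [] (edge 11 [(12,
  16431240)] (nonedge 20 [(39, 5949384)] (edge 12 [] (leaf 4 13737808) (edge 13 [] (edge 29 []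
  (leaf 5 10872890) (edge 31 [] (nonedge 19 [] (edge 21 [] (leaf 1 3100328) (deg 2)) (nbr 3 5))
  (edge 47 [] (edge 19 [] (leaf 1 3098088) (edge 21 [] (leaf 6 13732817) (deg 2))) (color
  5007)))) (deg 1))) (nonedge 37 [] (leaf 4 16394952) (nbr 4 1))) (deg 1)) (nbr 6 0)))) (edge 22
  [] (edge 55 [] (nonedge 30 [(38, 16431240), (46, 16398984)] (edge 20 [(21, 16406152)] (edge 39
  [] (edge 38 [] (leaf 4 16394952) (edge 46 [] (edge 21 [] (edge 47 [] (leaf 4 16427208) (color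
  5697)) (color 1926)) (color 2172))) (edge 47 [] (edge 46 [] (edge 21 [] (leaf 4 16427208) (edge
  38 [] (edge 12 [(13, 5920712)] (edge 13 [] (leaf 5 12527704) (edge 31 [] (edge 11 [] (leaf 3
  5929560) (deg 1)) (color 4845))) (deg 1)) (color 1926))) (color 5535)) (color 5778))) (color
  1845)) (nbr 6 0)) (color 714)) (color 2892))) (edge 31 [(39, 16431240)] (edge 39 [(47,
  16406152)] (edge 28 [] (edge 19 [(20, 16431240)] (edge 29 [] (edge 37 [] (leaf 4 11636625)
  (edge 30 [] (nbr 3 1) (color 1404))) (edge 38 [] (edge 30 [] (nonedge 11 [] (edge 13 [] (edge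
  12 [] (edge 20 [] (nbr 4 5) (edge 21 [] (edge 22 [] (leaf 7 9380679) (deg 2)) (deg 2))) (deg
  1)) (deg 1)) (nbr 3 5)) (edge 46 [] (edge 37 [] (edge 12 [] (nbr 4 2) (edge 20 [] (nbr 4 1)
  (edge 55 [] (leaf 5 12219921) (color 633)))) (color 1404)) (color 1161))) (color 1890))) (deg
  2)) (edge 46 [] (edge 29 [(37, 16431240)] (edge 30 [] (nonedge 11 [] (edge 13 [] (edge 12 []
  (edge 21 [] (nonedge 47 [] (edge 55 [] (leaf 7 11498242) (deg 7)) (nbr 5 4)) (edge 22 [] (edge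
  20 [] (edge 19 [] (leaf 7 11477767) (deg 2)) (deg 2)) (deg 2))) (deg 1)) (deg 1)) (nonedge 19
  [] (edge 12 [] (edge 22 [] (edge 21 [] (edge 20 [] (leaf 7 7807751) (deg 2)) (deg 2)) (deg 2))
  (edge 13 [] (leaf 4 13999888) (deg 1))) (nbr 3 4))) (edge 38 [] (edge 37 [] (nonedge 12 []
  (edge 13 [] (edge 11 [] (leaf 5 10131002) (deg 1)) (deg 1)) (nonedge 20 [] (edge 22 [] (edge 21
  [] (edge 19 [] (leaf 5 10135097) (deg 2)) (deg 2)) (deg 2)) (nbr 4 3))) (color 1404)) (color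
  1323))) (color 2901)) (color 2052))) (deg 7)) (deg 7))))) (edge 30 [(38, 16431240)] (edge 38
  [(46, 16406152)] (edge 28 [] (edge 11 [(12, 16431240)] (edge 29 [] (edge 37 [] (leaf 4
  11636625) (edge 31 [] (nbr 3 2) (color 2862))) (edge 39 [] (edge 31 [] (nonedge 19 [] (nonedge
  20 [] (deg 2) (nonedge 37 [] (nonedge 12 [] (edge 15 [] (edge 13 [] (edge 23 [] (edge 21 []
  (leaf 7 7578438) (deg 2)) (deg 2)) (deg 1)) (deg 1)) (nbr 4 5)) (nbr 4 1))) (nbr 3 5)) (edge 47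
  [] (edge 37 [] (edge 12 [] (nbr 4 2) (edge 20 [] (nbr 4 1) (edge 7 [] (leaf 4 16125137) (edge
  55 [] (leaf 5 12477969) (color 633))))) (color 2862)) (color 2619))) (color 4806))) (deg 1))
  (edge 47 [] (edge 29 [(37, 16431240)] (edge 31 [] (nonedge 11 [(19, 16434768)] (edge 15 []
  (edge 13 [] (edge 12 [] (edge 21 [] (nonedge 46 [] (edge 55 [] (leaf 7 11526914) (deg 6)) (nbr
  5 4)) (edge 23 [] (edge 20 [] (edge 19 [] (leaf 7 11510534) (deg 2)) (deg 2)) (deg 2))) (deg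
  1)) (deg 1)) (deg 1)) (nbr 3 4)) (edge 39 [] (edge 37 [] (nonedge 12 [(20, 16434768)] (edge 15
  [] (edge 13 [] (edge 11 [] (leaf 5 10393138) (deg 1)) (deg 1)) (deg 1)) (nbr 4 3)) (color
  2862)) (color 2781))) (color 4725)) (color 4968))) (deg 6)) (deg 6)))) (deg 0)) (deg 0)) (deg
  0)

/-- Certificate for seven vertices, with an independent triple. -/
def certTriangle7 : Cert :=
  edge 25 [(26, 786261), (33, 769797), (27, 671013), (34, 654549), (41, 537243)] (edge 3 [(10,
  800661), (17, 800613)] (edge 4 [] (leaf 1 523335) (edge 5 [(6, 699825)] (edge 11 [(18, 800625)]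
  (edge 10 [] (leaf 1 525735) (edge 12 [] (leaf 2 615729) (edge 13 [] (edge 17 [] (edge 18 []
  (leaf 1 528129) (edge 26 [] (leaf 1 640935) (edge 6 [] (leaf 2 733371) (edge 20 [] (leaf 2
  748167) (edge 34 [] (leaf 1 777399) (color 42)))))) (edge 19 [] (edge 18 [] (leaf 2 632535)
  (edge 20 [] (leaf 0 636825) (deg 2))) (edge 26 [] (leaf 1 640935) (edge 6 [] (leaf 2 733371)
  (edge 34 [] (leaf 1 777399) (color 46)))))) (deg 1)))) (edge 33 [] (edge 26 [] (leaf 1 664839)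
  (edge 27 [(41, 767739)] (nonedge 10 [(17, 800625)] (edge 13 [] (edge 12 [] (leaf 2 767697) (deg
  1)) (deg 1)) (nbr 3 5)) (color 104))) (edge 34 [] (edge 26 [] (leaf 1 640935) (edge 27 [] (leaf
  1 782145) (edge 41 [] (leaf 2 699735) (color 104)))) (deg 4)))) (deg 0))) (edge 26 [(27,
  699825)] (edge 33 [] (leaf 1 664839) (edge 34 [(41, 786261)] (nonedge 4 [(11, 800661), (18,
  800613)] (edge 6 [] (edge 5 [] (leaf 2 782055) (deg 0)) (deg 0)) (nbr 4 5)) (color 112))) (deg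
  3))) (color 120)

/-- Certificate for five vertices. -/
def certFive : Cert :=
  edge 2 [(3, 2830), (4, 2230)] (nonedge 3 [(4, 2430)] (nonedge 1 [(4, 1190)] (edge 4 [] (edge 13
  [(19, 1730)] (edge 7 [] (nbr 2 4) (edge 8 [] (edge 9 [] (leaf 0 2710) (deg 1)) (deg 1))) (deg
  3)) (deg 0)) (nbr 0 3)) (nbr 0 1)) (deg 0)

end Certificates

/-- The pairs of a 7-cycle and a disjoint edge. -/
def cycle7Pairs : ℕ := addPairs 0 [1, 11, 21, 31, 41, 51, 6, 71]

/-- The pairs of a 9-cycle. -/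
def cycle9Pairs : ℕ := addPairs 0 [1, 11, 21, 31, 41, 51, 61, 71, 8]

/-- The pairs of a 5-cycle and two disjoint edges. -/
def cycle5Pairs : ℕ := addPairs 0 [1, 11, 21, 31, 4, 51, 71]

/-! ### Kernel evaluation of the certificates. -/

theorem claim_cycle7 : Claim 9 4 graphs9 0 cycle7Pairs :=
  certCycle7.check_sound (known := []) (by norm_num)
    (by norm_num) (by simp) _ _ (by decide +kernel)

/-- Branches whose non-edges contain a 7-cycle and a disjoint edge are closed by the claim already
proved. The 5-cycle certificate then cites both, so the order 7, 9, 5 matters. -/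
theorem claim_cycle9 : Claim 9 4 graphs9 0 cycle9Pairs :=
  certCycle9.check_sound (known := [cycle7Pairs]) (by norm_num)
    (by norm_num) (by simp [claim_cycle7]) _ _ (by decide +kernel)

theorem claim_cycle5 : Claim 9 4 graphs9 0 cycle5Pairs :=
  certCycle5.check_sound (known := [cycle7Pairs, cycle9Pairs]) (by norm_num)
    (by norm_num) (by simp [claim_cycle7, claim_cycle9]) _ _ (by decide +kernel)

theorem claim_triangle8 : Claim 8 3 graphs8 0 (addPairs 0 [1, 2, 10]) :=
  certTriangle8.check_sound (known := []) (by norm_num)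
    (by norm_num) (by simp) _ _ (by decide +kernel)

theorem claim_triangle7 : Claim 7 2 graphs7 0 (addPairs 0 [1, 2, 9]) :=
  certTriangle7.check_sound (known := []) (by norm_num)
    (by norm_num) (by simp) _ _ (by decide +kernel)

theorem claim_five : Claim 5 2 graphs5 0 0 :=
  certFive.check_sound (known := []) (by norm_num)
    (by norm_num) (by simp) _ _ (by decide +kernel)


/-! ### Graphs given by edge lists -/

section EdgeGraph

variable {n m : ℕ}

theorem testBit_addPairs (l : List ℕ) (N i : ℕ) :
    (addPairs N l).testBit i = true ↔ N.testBit i = true ∨ i ∈ l := by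
  induction l generalizing N with
  | nil => simp [addPairs]
  | cons e l ih =>
    rw [addPairs, ih, Nat.testBit_or, Bool.or_eq_true, Nat.testBit_two_pow, decide_eq_true_eq,
      List.mem_cons, or_assoc, eq_comm (a := e)]

theorem hasPair_comm (N : ℕ) {a b : ℕ} (h : a ≠ b) : hasPair n N a b = hasPair n N b a := by
  unfold hasPair
  rcases lt_or_gt_of_ne h with h | h
  · rw [Nat.blt_eq.mpr h, Bool.eq_false_iff.2 (fun h' => absurd (Nat.blt_eq.mp h') (by omega))]
    rfl
  · rw [Nat.blt_eq.mpr h, Bool.eq_false_iff.2 (fun h' => absurd (Nat.blt_eq.mp h') (by omega))]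
    rfl

/-- The graph on `Fin n` whose edges are the pairs stored in the list `l`. -/
def edgeGraph (n : ℕ) (l : List ℕ) : SimpleGraph (Fin n) where
  Adj a b := a ≠ b ∧ hasPair n (addPairs 0 l) a b = true
  symm := ⟨fun a b h => ⟨h.1.symm, by rw [hasPair_comm _ (Fin.val_ne_of_ne h.1.symm)]; exact h.2⟩⟩
  loopless := ⟨fun a h => h.1 rfl⟩

instance (l : List ℕ) : DecidableRel (edgeGraph n l).Adj :=
  fun a b => inferInstanceAs (Decidable (a ≠ b ∧ hasPair n (addPairs 0 l) a b = true))

theorem edgeGraph_adj_of_lt {l : List ℕ} {a b : Fin n} (h : a < b) :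
    (edgeGraph n l).Adj a b ↔ n * a + b ∈ l := by
  have hlt : Nat.blt a b = true := Nat.blt_eq.mpr h
  change a ≠ b ∧ hasPair n (addPairs 0 l) a b = true ↔ _
  rw [hasPair, hlt, cond_true, testBit_addPairs]
  simp [h.ne]

theorem div_mod_of_pair (a b : Fin n) : (n * a + b) / n = (a : ℕ) ∧ (n * a + b) % n = (b : ℕ) := by
  have hn : 0 < n := (Nat.zero_le _).trans_lt a.2
  exact ⟨by simp [Nat.mul_add_div hn, Nat.div_eq_of_lt b.2], by simp [Nat.mod_eq_of_lt b.2]⟩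

theorem exists_hom_edgeGraph {G : SimpleGraph (Fin n)} {l : List ℕ} {f : ℕ → Fin n}
    (hf : ∀ e ∈ l, G.Adj (f (e / n)) (f (e % n))) : Nonempty (edgeGraph n l →g G) := by
  have key : ∀ a b : Fin n, a < b → (edgeGraph n l).Adj a b → G.Adj (f a) (f b) := by
    intro a b hlt hab
    have := hf _ ((edgeGraph_adj_of_lt hlt).1 hab)
    rwa [(div_mod_of_pair a b).1, (div_mod_of_pair a b).2] at this
  refine ⟨⟨fun a => f a, fun {a b} hab => ?_⟩⟩
  rcases lt_or_gt_of_ne hab.ne with hlt | hlt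
  · exact key a b hlt hab
  · exact (key b a hlt hab.symm).symm

/-- Extend a partial colouring `c`, defined from `k` on, to all numbers below `n`. -/
def canColor (n m N : ℕ) : ℕ → (ℕ → ℕ) → Bool
  | 0, _ => true
  | k + 1, c => !(allLt m fun i =>
      !((allLt n fun u => Nat.ble u k || !(Nat.beq (c u) i) || !(hasPair n N k u)) &&
        canColor n m N k fun u => bif Nat.beq u k then i else c u))

/-- The search colours vertices in decreasing order: when `k` is treated, the values above it are
final and only they are compared. -/
theorem canColor_iff {N k : ℕ} {c : ℕ → ℕ} : canColor n m N k c = true ↔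
    ∃ d : ℕ → ℕ, (∀ u, k ≤ u → d u = c u) ∧ (∀ u < k, d u < m) ∧
      ∀ u < k, ∀ w < n, u < w → hasPair n N u w = true → d u ≠ d w := by
  induction k generalizing c with
  | zero => simpa [canColor] using ⟨c, fun _ => rfl⟩
  | succ k ih =>
    simp only [canColor, Bool.not_eq_true', ← Bool.not_eq_true, allLt_iff, not_forall,
      Bool.and_eq_true, not_not, Bool.or_eq_true, Nat.ble_eq, Nat.beq_eq, ih]
    constructor
    · rintro ⟨i, hi, hc, d, h1, h2, h3⟩
      have hk : d k = i := by simpa using h1 k le_rfl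
      have hgt : ∀ u, k < u → d u = c u := fun u hu => by
        have : Nat.beq u k = false := natBeq_eq_false_iff.2 hu.ne'
        simpa [this] using h1 u hu.le
      refine ⟨d, fun u hu => hgt u hu, fun u hu => ?_, fun u hu w hw huw hp => ?_⟩
      · rcases Nat.lt_succ_iff_lt_or_eq.1 hu with h | rfl
        exacts [h2 u h, hk ▸ hi]
      · rcases Nat.lt_succ_iff_lt_or_eq.1 hu with h | rfl
        · exact h3 u h w hw huw hp
        · rw [hk, hgt w huw]
          rcases hc w hw with (h | h) | h
          · omega
          · exact fun he => h he.symm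
          · exact absurd hp h
    · rintro ⟨d, h1, h2, h3⟩
      refine ⟨d k, h2 k (Nat.lt_succ_self k), fun u hu => ?_, d, fun u hu => ?_,
        fun u hu => h2 u (hu.trans (Nat.lt_succ_self k)),
        fun u hu => h3 u (hu.trans (Nat.lt_succ_self k))⟩
      · by_cases hle : u ≤ k
        · exact .inl (.inl hle)
        · by_cases hp : hasPair n N k u = true
          · refine .inl (.inr ?_)
            rw [← h1 u (by omega)]
            exact (h3 k (Nat.lt_succ_self k) u hu (by omega) hp).symm
          · exact .inr hp
      · by_cases hu' : u = k
        · simp [hu']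
        · have : Nat.beq u k = false := natBeq_eq_false_iff.2 hu'
          simpa [this] using h1 u (by omega)

/-- The constant `m` is a dummy start: every vertex below `n` receives its colour before that colour
is compared. -/
theorem edgeGraph_colorable_iff {l : List ℕ} :
    (edgeGraph n l).Colorable m ↔ canColor n m (addPairs 0 l) n (fun _ => m) = true := by
  rw [← colOn_univ_iff, canColor_iff]
  constructor
  · rintro ⟨c, hc, hp⟩
    refine ⟨fun u => if h : u < n then c ⟨u, h⟩ else m, fun u hu => ?_, fun u hu => ?_,
      fun u hu w hw huw h => ?_⟩
    · simp [not_lt.2 hu]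
    · simpa [hu] using hc ⟨u, hu⟩ trivial
    · simpa [hu, hw] using hp ⟨u, hu⟩ trivial ⟨w, hw⟩ trivial
        ⟨fun he => huw.ne (congrArg Fin.val he), h⟩
  · rintro ⟨d, -, h2, h3⟩
    refine ⟨fun u => d u, fun u _ => h2 u u.2, fun u _ v _ huv => ?_⟩
    rcases lt_or_gt_of_ne huv.ne with hlt | hlt
    · exact h3 u u.2 v v.2 hlt huv.2
    · exact (h3 v v.2 u u.2 hlt huv.symm.2).symm

/-- Check that a graph is critical. -/
def critCheck (n m : ℕ) (l : List ℕ) : Bool :=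
  !(canColor n m (addPairs 0 l) n fun _ => m) &&
    (l.all fun e => canColor n m (addPairs 0 (l.filter fun x => !(Nat.beq x e))) n fun _ => m) &&
    allLt n fun v => !(allLt n fun u => Nat.beq v u || !(hasPair n (addPairs 0 l) v u))

theorem crit_of_critCheck {l : List ℕ} (h : critCheck n m l = true) : Crit (edgeGraph n l) m := by
  simp only [critCheck, Bool.and_eq_true, List.all_eq_true, allLt_iff, Bool.not_eq_true',
    ← Bool.not_eq_true, not_forall, ← edgeGraph_colorable_iff, Bool.or_eq_true, not_or, not_not,
    Nat.beq_eq] at h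
  obtain ⟨⟨h1, h2⟩, h3⟩ := h
  refine Crit.of_edge h1 (fun v => ?_) ?_
  · obtain ⟨u, hu, hne, hp⟩ := h3 v v.2
    exact ⟨⟨u, hu⟩, fun he => hne (congrArg Fin.val he), hp⟩
  · have key : ∀ u v : Fin n, u < v → (edgeGraph n l).Adj u v →
        ((edgeGraph n l).deleteEdges {s(u, v)}).Colorable m := by
      intro u v hlt huv
      refine (h2 _ ((edgeGraph_adj_of_lt hlt).1 huv)).mono_left ?_
      have sub : ∀ a b : Fin n, a < b → ((edgeGraph n l).deleteEdges {s(u, v)}).Adj a b →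
          (edgeGraph n (l.filter fun x => !(Nat.beq x (n * u + v)))).Adj a b := by
        intro a b hab hadj
        rw [SimpleGraph.deleteEdges_adj] at hadj
        rw [edgeGraph_adj_of_lt hab, List.mem_filter]
        refine ⟨(edgeGraph_adj_of_lt hab).1 hadj.1, ?_⟩
        rw [Bool.not_eq_true', natBeq_eq_false_iff]
        intro he
        refine hadj.2 ?_
        have e1 := (div_mod_of_pair a b).1.symm.trans ((congrArg (· / n) he).trans (div_mod_of_pair u v).1)
        have e2 := (div_mod_of_pair a b).2.symm.trans ((congrArg (· % n) he).trans (div_mod_of_pair u v).2)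
        rw [Fin.ext e1, Fin.ext e2]
        rfl
      intro a b hadj
      rcases lt_or_gt_of_ne hadj.ne with hlt | hlt
      · exact sub a b hlt hadj
      · exact (sub b a hlt hadj.symm).symm
    intro u v huv
    rcases lt_or_gt_of_ne huv.ne with hlt | hlt
    · exact key u v hlt huv
    · rw [Sym2.eq_swap]; exact key v u hlt huv.symm

/-- A critical graph that receives a homomorphism from a graph of the list is isomorphic to a
graph of the list without isolated vertices. -/
theorem Crit.exists_iso_of_homFromList {G : SimpleGraph (Fin n)} (h : Crit G m) (hm : 0 < m)
    {F : List (List ℕ)} (hF : ∀ l ∈ F, canColor n m (addPairs 0 l) n (fun _ => m) = false)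
    (hG : HomFromList F G) :
    ∃ l ∈ F, AreIso G (edgeGraph n l) ∧ ∀ a, ∃ b, (edgeGraph n l).Adj a b := by
  obtain ⟨l, hl, f, hf⟩ := hG
  obtain ⟨φ⟩ := exists_hom_edgeGraph hf
  obtain ⟨g⟩ := h.iso_of_hom (by rw [edgeGraph_colorable_iff, hF l hl]; simp) φ
  refine ⟨l, hl, ⟨g⟩, fun a => ?_⟩
  -- An isolated vertex contradicts the minimum degree `m > 0`.
  by_contra! hno
  have := (h.iso g).le_card_of_neighbors a ∅ fun u hu => absurd hu (hno u)
  simp at this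
  omega

end EdgeGraph

/-! ### Verification of the candidate graphs. -/

/-- Needed for every entry, also those with isolated vertices: it is what turns a homomorphism into
a critical graph of the same order into an isomorphism. -/
theorem canColor_graphs9 : ∀ l ∈ graphs9, canColor 9 4 (addPairs 0 l) 9 (fun _ => 4) = false := by
  decide +kernel

theorem canColor_graphs8 : ∀ l ∈ graphs8, canColor 8 3 (addPairs 0 l) 8 (fun _ => 3) = false := by
  decide +kernel

theorem canColor_graphs7 : ∀ l ∈ graphs7, canColor 7 2 (addPairs 0 l) 7 (fun _ => 2) = false := by
  decide +kernel

theorem canColor_graphs5 : ∀ l ∈ graphs5, canColor 5 2 (addPairs 0 l) 5 (fun _ => 2) = false := by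
  decide +kernel

/-- The 5-critical graphs on nine vertices without simplicial vertices. -/
def critGraph9 (i : Fin 16) : SimpleGraph (Fin 9) := edgeGraph 9 (graphs9.getD i [])

/-- The 4-critical graphs on eight vertices without simplicial vertices. -/
def critGraph8 (i : Fin 4) : SimpleGraph (Fin 8) := edgeGraph 8 (graphs8.getD i [])

/-- The 7-cycle. -/
def critGraph7 : SimpleGraph (Fin 7) := edgeGraph 7 (graphs7.getD 0 [])

/-- The 5-cycle. -/
def critGraph5 : SimpleGraph (Fin 5) := edgeGraph 5 (graphs5.getD 0 [])

instance (i : Fin 16) : DecidableRel (critGraph9 i).Adj :=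
  inferInstanceAs (DecidableRel (edgeGraph 9 (graphs9.getD i [])).Adj)

instance (i : Fin 4) : DecidableRel (critGraph8 i).Adj :=
  inferInstanceAs (DecidableRel (edgeGraph 8 (graphs8.getD i [])).Adj)

instance : DecidableRel critGraph7.Adj :=
  inferInstanceAs (DecidableRel (edgeGraph 7 (graphs7.getD 0 [])).Adj)

instance : DecidableRel critGraph5.Adj :=
  inferInstanceAs (DecidableRel (edgeGraph 5 (graphs5.getD 0 [])).Adj)

theorem crit_critGraph9 (i : Fin 16) : Crit (critGraph9 i) 4 := by
  have : ∀ i : Fin 16, critCheck 9 4 (graphs9.getD i []) = true := by decide +kernel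
  exact crit_of_critCheck (this i)

theorem crit_critGraph8 (i : Fin 4) : Crit (critGraph8 i) 3 := by
  have : ∀ i : Fin 4, critCheck 8 3 (graphs8.getD i []) = true := by decide +kernel
  exact crit_of_critCheck (this i)

theorem crit_critGraph7 : Crit critGraph7 2 := crit_of_critCheck (by decide +kernel)

theorem crit_critGraph5 : Crit critGraph5 2 := crit_of_critCheck (by decide +kernel)

theorem simplicialFree_critGraph9 : ∀ i, SimplicialFree (critGraph9 i) := by
  unfold SimplicialFree
  decide +kernel

theorem simplicialFree_critGraph8 : ∀ i, SimplicialFree (critGraph8 i) := by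
  unfold SimplicialFree
  decide +kernel

theorem simplicialFree_critGraph7 : SimplicialFree critGraph7 := by
  unfold SimplicialFree
  decide +kernel

theorem simplicialFree_critGraph5 : SimplicialFree critGraph5 := by
  unfold SimplicialFree
  decide +kernel

/-- The entry with isolated vertices stands for a smaller forbidden subgraph. A homomorphism from it
would be an isomorphism, but critical graphs have no isolated vertices, so only the first sixteen
entries can occur. -/
theorem Crit.iso_critGraph9 {G : SimpleGraph (Fin 9)} (h : Crit G 4) (hG : HomFromList graphs9 G) :
    ∃ i, AreIso G (critGraph9 i) := by
  have cases : ∀ l ∈ graphs9, (∃ i : Fin 16, l = graphs9.getD i []) ∨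
      ∃ a, ∀ b, ¬ (edgeGraph 9 l).Adj a b := by decide +kernel
  obtain ⟨l, hl, hiso, hadj⟩ := h.exists_iso_of_homFromList (by norm_num) canColor_graphs9 hG
  rcases cases l hl with ⟨i, rfl⟩ | ⟨a, ha⟩
  · exact ⟨i, hiso⟩
  · exact absurd (hadj a) (by simpa using ha)

theorem Crit.iso_critGraph8 {G : SimpleGraph (Fin 8)} (h : Crit G 3) (hG : HomFromList graphs8 G) :
    ∃ i, AreIso G (critGraph8 i) := by
  have cases : ∀ l ∈ graphs8, (∃ i : Fin 4, l = graphs8.getD i []) ∨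
      ∃ a, ∀ b, ¬ (edgeGraph 8 l).Adj a b := by decide +kernel
  obtain ⟨l, hl, hiso, hadj⟩ := h.exists_iso_of_homFromList (by norm_num) canColor_graphs8 hG
  rcases cases l hl with ⟨i, rfl⟩ | ⟨a, ha⟩
  · exact ⟨i, hiso⟩
  · exact absurd (hadj a) (by simpa using ha)

theorem Crit.iso_critGraph7 {G : SimpleGraph (Fin 7)} (h : Crit G 2) (hG : HomFromList graphs7 G) :
    AreIso G critGraph7 := by
  have cases : ∀ l ∈ graphs7, l = graphs7.getD 0 [] ∨
      ∃ a, ∀ b, ¬ (edgeGraph 7 l).Adj a b := by decide +kernel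
  obtain ⟨l, hl, hiso, hadj⟩ := h.exists_iso_of_homFromList (by norm_num) canColor_graphs7 hG
  rcases cases l hl with rfl | ⟨a, ha⟩
  · exact hiso
  · exact absurd (hadj a) (by simpa using ha)

theorem Crit.iso_critGraph5 {G : SimpleGraph (Fin 5)} (h : Crit G 2) (hG : HomFromList graphs5 G) :
    AreIso G critGraph5 := by
  have cases : ∀ l ∈ graphs5, l = graphs5.getD 0 [] ∨
      ∃ a, ∀ b, ¬ (edgeGraph 5 l).Adj a b := by decide +kernel
  obtain ⟨l, hl, hiso, hadj⟩ := h.exists_iso_of_homFromList (by norm_num) canColor_graphs5 hG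
  rcases cases l hl with rfl | ⟨a, ha⟩
  · exact hiso
  · exact absurd (hadj a) (by simpa using ha)

/-! ### An isomorphism invariant -/

open Classical in
/-- The sum over all vertices of the squared number of (ordered) triangles at the vertex. -/
noncomputable def triangleSum {V : Type*} [Fintype V] (G : SimpleGraph V) : ℕ :=
  ∑ v, (∑ u, ∑ w, if G.Adj v u ∧ G.Adj v w ∧ G.Adj u w then 1 else 0) ^ 2

theorem triangleSum_eq_of_areIso {V W : Type*} [Fintype V] [Fintype W] {G : SimpleGraph V}
    {H : SimpleGraph W} (h : AreIso G H) : triangleSum G = triangleSum H := by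
  obtain ⟨f⟩ := h
  refine Fintype.sum_equiv f.toEquiv _ _ fun v => ?_
  congr 1
  refine Fintype.sum_equiv f.toEquiv _ _ fun u => ?_
  refine Fintype.sum_equiv f.toEquiv _ _ fun w => ?_
  have : ∀ a b, H.Adj (f.toEquiv a) (f.toEquiv b) ↔ G.Adj a b := fun a b => f.map_adj_iff
  congr 1
  simp only [this]

/-- The invariant computed from an edge list. -/
def triangleSumOf (n : ℕ) (l : List ℕ) : ℕ :=
  ∑ v : Fin n, (∑ u : Fin n, ∑ w : Fin n, if (edgeGraph n l).Adj v u ∧ (edgeGraph n l).Adj v w ∧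
    (edgeGraph n l).Adj u w then 1 else 0) ^ 2

theorem triangleSum_edgeGraph (n : ℕ) (l : List ℕ) :
    triangleSum (edgeGraph n l) = triangleSumOf n l := by
  unfold triangleSum triangleSumOf
  congr! 6

/-- The sixteen values of the triangle invariant are pairwise distinct. -/
theorem injective_critGraph9 {i j : Fin 16} (h : AreIso (critGraph9 i) (critGraph9 j)) : i = j := by
  have vals : ∀ i : Fin 16, triangleSumOf 9 (graphs9.getD i []) =
      [684, 816, 848, 1168, 1044, 896, 988, 1108, 1040, 1356, 1420, 1440, 1576, 1660, 1172,
        1432].getD i 0 := by decide +kernel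
  have := triangleSum_eq_of_areIso h
  rw [critGraph9, critGraph9, triangleSum_edgeGraph, triangleSum_edgeGraph, vals, vals] at this
  clear h vals
  revert i j
  decide +kernel

theorem injective_critGraph8 {i j : Fin 4} (h : AreIso (critGraph8 i) (critGraph8 j)) : i = j := by
  have vals : ∀ i : Fin 4, triangleSumOf 8 (graphs8.getD i []) = [96, 172, 200, 120].getD i 0 := by
    decide +kernel
  have := triangleSum_eq_of_areIso h
  rw [critGraph8, critGraph8, triangleSum_edgeGraph, triangleSum_edgeGraph, vals, vals] at this
  clear h vals
  revert i j
  decide +kernel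


/-! ### Starting configurations of the case analysis -/

section Start

variable {n m : ℕ}

/-- Appending the missing vertices extends `l` to an enumeration of `Fin n`. -/
theorem exists_perm_of_nodup {l : List (Fin n)} (hl : l.Nodup) :
    ∃ σ : Fin n ≃ Fin n, ∀ (a : Fin n) (h : a < l.length), σ a = l[(a : ℕ)] := by
  classical
  let L := l ++ (Finset.univ.filter (· ∉ l)).toList
  have hL : L.Nodup := List.nodup_append'.2 ⟨hl, Finset.nodup_toList _, fun a h1 h2 => by
    simp at h2; exact h2 h1⟩
  have hall : ∀ a, a ∈ L := fun a => by simpa [L] using em _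
  have hlen : n = L.length := by
    rw [← List.toFinset_card_of_nodup hL, Finset.eq_univ_iff_forall.2 fun a => List.mem_toFinset.2 (hall a)]
    simp
  refine ⟨Equiv.ofBijective (fun a => L.get (a.cast hlen))
    (Finite.injective_iff_bijective.1 fun a b hab => ?_), fun a h => ?_⟩
  · simpa using (List.nodup_iff_injective_get.1 hL) hab
  · simp [L, List.getElem_append_left h]

/-- Apply the case analysis to a graph with the given non-adjacent pairs on a list of vertices. -/
theorem Claim.of_list {F : List (List ℕ)} {es : List ℕ} (h : Claim n m F 0 (addPairs 0 es))
    {G : SimpleGraph (Fin n)} (hG : CaseHyp G m) {l : List (Fin n)} (hl : l.Nodup)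
    (hes : ∀ e ∈ es, ∃ (h₁ : e / n < l.length) (h₂ : e % n < l.length),
      ¬ G.Adj l[e / n] l[e % n]) : HomFromList F G := by
  obtain ⟨σ, hσ⟩ := exists_perm_of_nodup hl
  have hK : PairsSat n (addPairs 0 es) fun a b => ¬ (G.comap σ).Adj a b := by
    refine PairsSat.addPairs _ (fun e he a b hab => ?_) fun a b hab => by simp at hab
    obtain ⟨h1, h2, hadj⟩ := hes e he
    subst hab
    simp only [(div_mod_of_pair a b).1, (div_mod_of_pair a b).2] at h1 h2 hadj
    rw [SimpleGraph.comap_adj, hσ a h1, hσ b h2]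
    exact hadj
  obtain ⟨l', hl', f, hf⟩ := h (G.comap σ) (hG.iso (SimpleGraph.Iso.comap σ G).symm)
    (fun a b hab => by simp at hab) hK
  exact ⟨l', hl', fun i => σ (f i), fun e he => hf e he⟩

/-- Pigeonhole: after deleting a vertex, more than `2m` vertices share `m` colours, so some colour
class has three elements. -/
theorem Crit.exists_triple {V : Type*} [Fintype V] {G : SimpleGraph V} (h : Crit G m)
    (hcard : 2 * m + 1 < Fintype.card V) :
    ∃ u v w, u ≠ v ∧ u ≠ w ∧ v ≠ w ∧ ¬ G.Adj u v ∧ ¬ G.Adj u w ∧ ¬ G.Adj v w := by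
  classical
  obtain ⟨x⟩ := h.nonempty
  obtain ⟨c, hc, hp⟩ := h.vert x
  obtain ⟨k, -, hk⟩ := Finset.exists_lt_card_fiber_of_mul_lt_card_of_maps_to
    (s := Finset.univ.erase x) (t := Finset.range m) (f := c) (n := 2)
    (fun u hu => Finset.mem_range.2 (hc u (Finset.ne_of_mem_erase hu)))
    (by rw [Finset.card_range, Finset.card_erase_of_mem (Finset.mem_univ _), Finset.card_univ]; omega)
  obtain ⟨u, hu, v, hv, w, hw, huv, huw, hvw⟩ := Finset.two_lt_card.1 hk
  simp only [Finset.mem_filter, Finset.mem_erase, Finset.mem_univ, and_true] at hu hv hw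
  refine ⟨u, v, w, huv, huw, hvw, fun h => ?_, fun h => ?_, fun h => ?_⟩
  · exact hp u hu.1 v hv.1 h (hu.2.trans hv.2.symm)
  · exact hp u hu.1 w hw.1 h (hu.2.trans hw.2.symm)
  · exact hp v hv.1 w hw.1 h (hv.2.trans hw.2.symm)

theorem Crit.iso_critGraph8_of_cutConn {G : SimpleGraph (Fin 8)} (h : Crit G 3)
    (hconn : CutConn G) : ∃ i, AreIso G (critGraph8 i) := by
  obtain ⟨u, v, w, h1, h2, h3, h4, h5, h6⟩ := h.exists_triple (by simp)
  refine h.iso_critGraph8 (claim_triangle8.of_list (h.caseHyp hconn (by simp)) (l := [u, v, w])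
    (by simp [*]) ?_)
  simp [h4, h5, h6]

theorem Crit.iso_critGraph7_of_cutConn {G : SimpleGraph (Fin 7)} (h : Crit G 2)
    (hconn : CutConn G) : AreIso G critGraph7 := by
  obtain ⟨u, v, w, h1, h2, h3, h4, h5, h6⟩ := h.exists_triple (by simp)
  refine h.iso_critGraph7 (claim_triangle7.of_list (h.caseHyp hconn (by simp)) (l := [u, v, w])
    (by simp [*]) ?_)
  simp [h4, h5, h6]

theorem Crit.iso_critGraph5_of_cutConn {G : SimpleGraph (Fin 5)} (h : Crit G 2)
    (hconn : CutConn G) : AreIso G critGraph5 :=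
  h.iso_critGraph5 (claim_five G (h.caseHyp hconn (by simp)) (fun a b hab => by simp at hab)
    fun a b hab => by simp at hab)

/-! ### Alternating paths of two near-perfect matchings. -/

section AlternatingPath

variable {V : Type*} {f g : V → V} {x a b : V} {l : List V}

/-- A list of vertices that is closed under the matching `f` of all vertices but `x`. -/
structure MatchClosed (f : V → V) (x : V) (l : List V) : Prop where
  nodup : l.Nodup
  mem : x ∈ l
  closed : ∀ u ∈ l, u ≠ x → f u ∈ l

theorem MatchClosed.append (h : MatchClosed f x l) (hf : ∀ u, u ≠ x → f u ≠ x ∧ f u ≠ u ∧ f (f u) = u)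
    {c : V} (hc : c ∉ l) : MatchClosed f x (l ++ [c, f c]) := by
  have hcx : c ≠ x := fun he => hc (he ▸ h.mem)
  obtain ⟨h1, h2, h3⟩ := hf c hcx
  have hfc : f c ∉ l := fun hl => hc (h3 ▸ h.closed _ hl h1)
  refine ⟨List.nodup_append'.2 ⟨h.nodup, by simpa using h2.symm, ?_⟩, by simp [h.mem], ?_⟩
  · intro u hu hu'
    rcases List.mem_pair.1 hu' with rfl | rfl
    exacts [hc hu, hfc hu]
  · intro u hu hux
    rcases List.mem_append.1 hu with hu | hu
    · exact List.mem_append_left _ (h.closed u hu hux)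
    · rcases List.mem_pair.1 hu with rfl | rfl
      · simp
      · simp [h3]

/-- An alternating path for the matchings `f` and `g`, which miss `x` and `a`, with last
vertex `b`. -/
structure AltPath (f g : V → V) (x a b : V) (l : List V) : Prop extends MatchClosed f x l where
  mem_last : b ∈ l
  last_ne : b ≠ a
  alt : ∀ u ∈ l, u ≠ a → u ≠ b → u ≠ x → g u ∈ l ∧ g u ≠ b

/-- The involution `g` sends `g b` back to `b`, whereas by `alt` it sends no earlier path vertex
there. -/
theorem AltPath.notMem (h : AltPath f g x a b l) (hg : ∀ u, u ≠ a → g u ≠ a ∧ g u ≠ u ∧ g (g u) = u)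
    (hx : g b ≠ x) : g b ∉ l := by
  intro hl
  obtain ⟨h1, h2, h3⟩ := hg b h.last_ne
  exact (h.alt _ hl h1 h2 hx).2 h3

theorem AltPath.append (h : AltPath f g x a b l)
    (hf : ∀ u, u ≠ x → f u ≠ x ∧ f u ≠ u ∧ f (f u) = u)
    (hg : ∀ u, u ≠ a → g u ≠ a ∧ g u ≠ u ∧ g (g u) = u) (ha : a ∈ l) (hx : g b ≠ x) :
    AltPath f g x a (f (g b)) (l ++ [g b, f (g b)]) := by
  have hn := h.notMem hg hx
  have hM := h.toMatchClosed.append hf hn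
  have hd := (List.nodup_append'.1 hM.nodup).2.2
  have hfl : f (g b) ∉ l := fun hl => hd hl (by simp)
  refine ⟨hM, by simp, fun he => hfl (he ▸ ha), fun u hu hua hub hux => ?_⟩
  rcases List.mem_append.1 hu with hu | hu
  · by_cases hb : u = b
    · subst hb
      exact ⟨by simp, fun he => (hf _ hx).2.1 he.symm⟩
    · have := (h.alt u hu hua hb hux).1
      exact ⟨List.mem_append_left _ this, fun he => hfl (he ▸ this)⟩
  · rcases List.mem_pair.1 hu with rfl | rfl
    · rw [(hg b h.last_ne).2.2]
      exact ⟨List.mem_append_left _ h.mem_last, fun he => hfl (he ▸ h.mem_last)⟩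
    · exact absurd rfl hub

end AlternatingPath

theorem exists_notMem_of_length_lt {l : List (Fin n)} (h : l.length < n) : ∃ c, c ∉ l := by
  by_contra! hall
  have := Finset.card_le_card (s := Finset.univ) (t := l.toFinset) fun a _ => List.mem_toFinset.2 (hall a)
  have := l.toFinset_card_le
  simp at *
  omega

/-- Here `9 = 2 * 4 + 1`, so the complement has matchings `f` and `g` missing `x` and `a`, where `x`
and `a` are non-adjacent. Following `f` and `g` alternately from `a` ends at `x`. The pair `x, a`
closes the path to an odd cycle of the complement, and `f` pairs the vertices off the cycle. The
lengths 5, 7 and 9 are the starting configurations of the search. -/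
theorem Crit.iso_critGraph9_of_cutConn {G : SimpleGraph (Fin 9)} (h : Crit G 4)
    (hconn : CutConn G) : ∃ i, AreIso G (critGraph9 i) := by
  have hcase := h.caseHyp hconn (by simp)
  refine h.iso_critGraph9 ?_
  obtain ⟨a, hax, -, hxa⟩ := hcase.nbr 0 0
  generalize (0 : Fin 9) = x at hax hxa
  obtain ⟨f, hf⟩ := h.pmOn_erase hconn (by simp) x
  obtain ⟨g, hg⟩ := h.pmOn_erase hconn (by simp) a
  simp only [Finset.mem_erase, Finset.mem_univ, and_true] at hf hg
  have hf' : ∀ u, u ≠ x → f u ≠ x ∧ f u ≠ u ∧ f (f u) = u := fun u hu =>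
    ⟨(hf u hu).1, (hf u hu).2.1, (hf u hu).2.2.1⟩
  have hg' : ∀ u, u ≠ a → g u ≠ a ∧ g u ≠ u ∧ g (g u) = u := fun u hu =>
    ⟨(hg u hu).1, (hg u hu).2.1, (hg u hu).2.2.1⟩
  have hnf : ∀ u, u ≠ x → ¬ G.Adj u (f u) := fun u hu => (hf u hu).2.2.2
  have hng : ∀ u, u ≠ a → ¬ G.Adj u (g u) := fun u hu => (hg u hu).2.2.2
  have hstart : MatchClosed f x [x] := ⟨by simp, by simp, by simp⟩
  have h3 : AltPath f g x a (f a) [x, a, f a] :=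
    ⟨hstart.append hf' (c := a) (by simpa using hax), by simp, (hf' a hax).2.1, by
      intro u hu h1 h2 h3
      simp only [List.mem_cons, List.not_mem_nil, or_false] at hu
      tauto⟩
  obtain ⟨b, hb⟩ : ∃ b, f a = b := ⟨_, rfl⟩
  have hab := hnf a hax
  rw [hb] at h3 hab
  -- Length 3: the independent triple and the three remaining pairs of `f` are four colour classes.
  by_cases hx3 : g b = x
  · exfalso
    have hbx := hng b h3.last_ne
    rw [hx3] at hbx
    have hP : PMOn G (Finset.univ \ {x, a, b}) := by
      refine ⟨f, fun u hu => ?_⟩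
      simp only [Finset.mem_sdiff, Finset.mem_univ, Finset.mem_insert, Finset.mem_singleton,
        true_and, not_or] at hu ⊢
      obtain ⟨h1, h2, h3, h4⟩ := hf u hu.1
      refine ⟨⟨h1, fun he => hu.2.2 ?_, fun he => hu.2.1 ?_⟩, h2, h3, h4⟩
      · rw [← h3, he, hb]
      · rw [← h3, he, ← hb, (hf' a hax).2.2]
    obtain ⟨k, hk, hc⟩ := hP.colOn
    have hcard : ({x, a, b} : Finset (Fin 9)).card = 3 := by
      have := h3.nodup
      simp at this
      exact Finset.card_eq_three.2 ⟨x, a, b, this.1.1, this.1.2, this.2, rfl⟩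
    rw [Finset.card_sdiff_of_subset (Finset.subset_univ _), hcard, Finset.card_univ, Fintype.card_fin] at hk
    have htri : ColOn G {x, a, b} 1 := ⟨fun _ => 0, by simp, by
      intro u hu v hv huv
      simp only [Set.mem_insert_iff, Set.mem_singleton_iff] at hu hv
      have : ∀ u, ¬ G.Adj u u := G.loopless.irrefl
      rcases hu with rfl | rfl | rfl <;> rcases hv with rfl | rfl | rfl <;>
        first
        | exact absurd huv (this _)
        | exact absurd huv (by assumption)
        | exact absurd huv.symm (by assumption)⟩
    refine h.not_col (colOn_univ_iff.1 ((hc.union htri).mono (fun u _ => ?_) (by omega)))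
    by_cases hu : u ∈ ({x, a, b} : Finset (Fin 9))
    · exact .inr (by simpa using hu)
    · exact .inl (by simpa using hu)
  have h5 := h3.append hf' hg' (by simp) hx3
  have hbc := hng b h3.last_ne
  have hcd := hnf _ hx3
  generalize hc : g b = c at *
  generalize hd : f c = d at *
  simp only [List.cons_append, List.nil_append] at h5
  -- Length 5: the other four vertices form two pairs of `f`.
  by_cases hx5 : g d = x
  · have hdx := hng d h5.last_ne
    rw [hx5] at hdx
    obtain ⟨p, hp⟩ := exists_notMem_of_length_lt (l := [x, a, b, c, d]) (by simp)
    have h7 := h5.toMatchClosed.append hf' hp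
    have hpp := hnf p fun he => hp (by simp [he])
    simp only [List.cons_append, List.nil_append] at h7
    obtain ⟨q, hq⟩ := exists_notMem_of_length_lt (l := [x, a, b, c, d, p, f p]) (by simp)
    have h9 := h7.append hf' hq
    have hqq := hnf q fun he => hq (by simp [he])
    refine claim_cycle5.of_list hcase h9.nodup ?_
    have hxd : ¬ G.Adj x d := fun h => hdx h.symm
    simp [*]
  have h7 := h5.append hf' hg' (by simp) hx5
  have hde := hng d h5.last_ne
  have her := hnf _ hx5
  generalize he : g d = e at *
  generalize hr : f e = r at *
  simp only [List.cons_append, List.nil_append] at h7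
  by_cases hx7 : g r = x
  · have hrx := hng r h7.last_ne
    rw [hx7] at hrx
    obtain ⟨p, hp⟩ := exists_notMem_of_length_lt (l := [x, a, b, c, d, e, r]) (by simp)
    have h9 := h7.toMatchClosed.append hf' hp
    have hpp := hnf p fun he => hp (by simp [he])
    refine claim_cycle7.of_list hcase h9.nodup ?_
    have hxr : ¬ G.Adj x r := fun h => hrx h.symm
    simp [*]
  have h9 := h7.append hf' hg' (by simp) hx7
  have hrs := hng r h7.last_ne
  have hst := hnf _ hx7
  generalize hs : g r = s at *
  generalize ht : f s = t at *
  simp only [List.cons_append, List.nil_append] at h9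
  -- Otherwise the path could be extended to eleven distinct vertices.
  have hx9 : g t = x := by
    by_contra hx9
    have := (h9.append hf' hg' (by simp) hx9).nodup.length_le_card
    simp at this
  have htx := hng t h9.last_ne
  rw [hx9] at htx
  refine claim_cycle9.of_list hcase h9.nodup ?_
  have hxt : ¬ G.Adj x t := fun h => htx h.symm
  simp [*]

end Start


/-! ### Structure of critical graphs with few more vertices than colours -/

section AreIso

variable {U V W : Type*} {F : SimpleGraph U} {G : SimpleGraph V} {H : SimpleGraph W}

theorem AreIso.symm (h : AreIso G H) : AreIso H G := h.map fun f => f.symm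

theorem AreIso.trans (h : AreIso F G) (h' : AreIso G H) : AreIso F H :=
  h.elim fun f => h'.map fun g => f.trans g

theorem AreIso.card_eq [Fintype V] [Fintype W] (h : AreIso G H) :
    Fintype.card V = Fintype.card W := h.elim fun f => Fintype.card_congr f.toEquiv

theorem AreIso.addSimplicial (h : AreIso G H) (s : ℕ) :
    AreIso (addSimplicial G s) (addSimplicial H s) :=
  h.map fun f => graphJoinCongr f SimpleGraph.Iso.refl

theorem areIso_addSimplicial_zero (G : SimpleGraph V) : AreIso (addSimplicial G 0) G :=
  ⟨{ toEquiv := Equiv.sumEmpty V (Fin 0)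
     map_rel_iff' := by
      rintro (u | u) (v | v)
      · simp [_root_.addSimplicial]
      · exact v.elim0
      · exact u.elim0
      · exact u.elim0 }⟩

theorem SimplicialFree.iso (h : SimplicialFree G) (f : G ≃g H) : SimplicialFree H := by
  intro v
  obtain ⟨u, hu, hadj⟩ := h (f.symm v)
  refine ⟨f u, fun he => hu (by simp [← he]), fun hvu => hadj ?_⟩
  rw [← f.map_adj_iff]
  simpa using hvu

/-- An isomorphism preserves having a non-neighbour, and the added vertices have none. -/
theorem SimplicialFree.exists_inl {s t : ℕ} (h : SimplicialFree G)
    (f : _root_.addSimplicial G s ≃g _root_.addSimplicial H t) (v : V) :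
    ∃ w, f (.inl v) = .inl w := by
  obtain ⟨u, hu, hadj⟩ := h v
  rcases hv : f (.inl v) with w | i
  · exact ⟨w, rfl⟩
  · exfalso
    have hne : f (.inl u) ≠ f (.inl v) := fun he => hu (by simpa using f.injective he)
    have hn : ¬ (_root_.addSimplicial H t).Adj (f (.inl v)) (f (.inl u)) := by
      rw [f.map_adj_iff]
      simpa [_root_.addSimplicial] using hadj
    rw [hv] at hne hn
    rcases hu' : f (.inl u) with w | j
    · rw [hu'] at hn
      exact hn (by simp [_root_.addSimplicial])
    · rw [hu'] at hn hne
      exact hn (by simpa [_root_.addSimplicial] using fun he => hne (by rw [he]))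

/-- Simplicial vertices can be cancelled. -/
theorem SimplicialFree.areIso_of_addSimplicial {s t : ℕ} (hG : SimplicialFree G)
    (hH : SimplicialFree H) (h : AreIso (_root_.addSimplicial G s) (_root_.addSimplicial H t)) :
    AreIso G H := by
  obtain ⟨f⟩ := h
  choose φ hφ using hG.exists_inl f
  choose ψ hψ using hH.exists_inl f.symm
  refine ⟨⟨⟨φ, ψ, fun v => ?_, fun w => ?_⟩, fun {u v} => ?_⟩⟩
  · have : (Sum.inl (ψ (φ v)) : V ⊕ Fin s) = .inl v := by rw [← hψ, ← hφ, f.symm_apply_apply]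
    simpa using this
  · have : (Sum.inl (φ (ψ w)) : W ⊕ Fin t) = .inl w := by rw [← hφ, ← hψ, f.apply_symm_apply]
    simpa using this
  · have := f.map_adj_iff (v := .inl u) (w := .inl v)
    rw [hφ, hφ] at this
    simpa [_root_.addSimplicial] using this

end AreIso

/-! ### Orders of critical graphs and removal of simplicial vertices. -/

section Structure

variable {V W : Type*} {G : SimpleGraph V} {H : SimpleGraph W} {m k : ℕ}

theorem Crit.card_of_zero [Fintype V] (h : Crit G 0) : Fintype.card V = 1 := by
  obtain ⟨v⟩ := h.nonempty
  refine Fintype.card_eq_one_iff.2 ⟨v, fun u => ?_⟩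
  obtain ⟨c, hc, -⟩ := h.vert v
  by_contra hu
  exact absurd (hc u hu) (Nat.not_lt_zero _)

theorem Crit.exists_adj_of_one (h : Crit G 1) : ∃ u v, G.Adj u v ∧ ∀ w, w = u ∨ w = v := by
  have : ∃ u v, G.Adj u v := by
    by_contra! hno
    exact h.not_col (colOn_univ_iff.1 ⟨fun _ => 0, by simp, fun u _ v _ huv => absurd huv (hno u v)⟩)
  obtain ⟨u, v, huv⟩ := this
  refine ⟨u, v, huv, fun w => ?_⟩
  by_contra! hw
  obtain ⟨c, hc, hp⟩ := h.vert w
  have h1 := hc u hw.1.symm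
  have h2 := hc v hw.2.symm
  exact hp u hw.1.symm v hw.2.symm huv (by omega)

theorem Crit.card_of_one [Fintype V] (h : Crit G 1) : Fintype.card V = 2 := by
  obtain ⟨u, v, huv, hall⟩ := h.exists_adj_of_one
  classical
  rw [← Finset.card_univ, ← Finset.card_pair huv.ne]
  congr 1
  ext w
  simpa using hall w

/-- For `m = 0` and `m = 1` the critical graphs are complete, on one and two vertices. -/
theorem Crit.two_le (h : Crit G m) (hs : SimplicialFree G) : 2 ≤ m := by
  by_contra! hlt
  interval_cases m
  · obtain ⟨v⟩ := h.nonempty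
    obtain ⟨u, hu, -⟩ := hs v
    obtain ⟨c, hc, -⟩ := h.vert v
    exact absurd (hc u hu) (Nat.not_lt_zero _)
  · obtain ⟨u, v, huv, hall⟩ := h.exists_adj_of_one
    obtain ⟨w, hw, hadj⟩ := hs u
    rcases hall w with rfl | rfl
    exacts [hw rfl, hadj huv]

theorem SimplicialFree.induce {X : Set V} (hs : SimplicialFree G)
    (hX : ∀ u ∈ X, ∀ v ∈ Xᶜ, G.Adj u v) : SimplicialFree (G.induce X) := by
  rintro ⟨v, hv⟩
  obtain ⟨u, hu, hadj⟩ := hs v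
  have huX : u ∈ X := by
    by_contra huX
    exact hadj (hX v hv u huX)
  exact ⟨⟨u, huX⟩, fun he => hu (congrArg Subtype.val he), by simpa using hadj⟩

theorem exists_join_of_not_cutConn (h : ¬ CutConn G) :
    ∃ X : Set V, X.Nonempty ∧ Xᶜ.Nonempty ∧ ∀ u ∈ X, ∀ v ∈ Xᶜ, G.Adj u v := by
  unfold CutConn at h
  push Not at h
  exact h

theorem card_add_card_compl [Fintype V] (X : Set V) [Fintype X] [Fintype (Xᶜ : Set V)] :
    Fintype.card X + Fintype.card (Xᶜ : Set V) = Fintype.card V := by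
  classical
  rw [← Fintype.card_sum]
  exact Fintype.card_congr (Equiv.Set.sumCompl X)

/-- A critical graph without simplicial vertices that is a join. -/
theorem Crit.exists_simplicialFree_split (h : Crit G m) (hs : SimplicialFree G)
    (hconn : ¬ CutConn G) :
    ∃ (X : Set V) (a b : ℕ), a + b + 1 = m ∧ (∀ u ∈ X, ∀ v ∈ Xᶜ, G.Adj u v) ∧
      X.Nonempty ∧ Xᶜ.Nonempty ∧ Crit (G.induce X) a ∧ Crit (G.induce Xᶜ) b ∧
      SimplicialFree (G.induce X) ∧ SimplicialFree (G.induce Xᶜ) := by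
  obtain ⟨X, hne, hne', hX⟩ := exists_join_of_not_cutConn hconn
  obtain ⟨a, b, hab, ha, hb⟩ := h.exists_split hX hne hne'
  refine ⟨X, a, b, hab, hX, hne, hne', ha, hb, hs.induce hX, hs.induce fun u hu v hv => ?_⟩
  exact (hX v (by simpa using hv) u hu).symm

/-- With connected complement, `2m + 1 ≥ m + 3` because `m ≥ 2`. For a join, induction even gives
`(a + 3) + (b + 3) = m + 5`. -/
theorem Crit.add_three_le [Fintype V] (h : Crit G m) (hs : SimplicialFree G) :
    m + 3 ≤ Fintype.card V := by
  classical
  induction hn : Fintype.card V using Nat.strong_induction_on generalizing V m with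
  | _ n ih =>
    by_cases hconn : CutConn G
    · have := h.two_mul_add_one_le hconn
      have := h.two_le hs
      omega
    · obtain ⟨X, a, b, hab, -, hne, hne', ha, hb, hsa, hsb⟩ := h.exists_simplicialFree_split hs hconn
      have hc := card_add_card_compl X
      have : 0 < Fintype.card X := Fintype.card_pos_iff.2 hne.to_subtype
      have : 0 < Fintype.card (Xᶜ : Set V) := Fintype.card_pos_iff.2 hne'.to_subtype
      have := ih _ (by omega) ha hsa rfl
      have := ih _ (by omega) hb hsb rfl
      omega

theorem Crit.add_five_le [Fintype V] (h : Crit G m) (hs : SimplicialFree G)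
    (hconn : ¬ CutConn G) : m + 5 ≤ Fintype.card V := by
  classical
  obtain ⟨X, a, b, hab, -, -, -, ha, hb, hsa, hsb⟩ := h.exists_simplicialFree_split hs hconn
  have := card_add_card_compl X
  have := ha.add_three_le hsa
  have := hb.add_three_le hsb
  omega

/-- Order `m + 3` is too small for a join, and `2m + 1 ≤ m + 3` leaves `m = 2` on five vertices. -/
theorem Crit.iso_critGraph5_of_card [Fintype V] (h : Crit G m) (hs : SimplicialFree G)
    (hcard : Fintype.card V = m + 3) : m = 2 ∧ AreIso G critGraph5 := by
  classical
  have hconn : CutConn G := by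
    by_contra hconn
    have := h.add_five_le hs hconn
    omega
  have := h.two_mul_add_one_le hconn
  have := h.two_le hs
  obtain rfl : m = 2 := by omega
  let f := G.overFinIso hcard
  exact ⟨rfl, AreIso.trans ⟨f⟩ ((h.iso f).iso_critGraph5_of_cutConn (hconn.iso f))⟩

/-- The join of two 5-cycles. -/
def critGraph10 : SimpleGraph (Fin 10) :=
  (graphJoin critGraph5 critGraph5).map (finSumFinEquiv : Fin 5 ⊕ Fin 5 ≃ Fin 10).toEmbedding

/-- The defining isomorphism of `critGraph10`. -/
def critGraph10Iso : graphJoin critGraph5 critGraph5 ≃g critGraph10 :=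
  SimpleGraph.Iso.map finSumFinEquiv _

theorem crit_critGraph10 : Crit critGraph10 5 :=
  (crit_critGraph5.graphJoin crit_critGraph5).iso critGraph10Iso

theorem SimplicialFree.graphJoin (hG : SimplicialFree G) (hH : SimplicialFree H) :
    SimplicialFree (graphJoin G H) := by
  rintro (v | v)
  · obtain ⟨u, hu, hadj⟩ := hG v
    exact ⟨.inl u, by simpa using hu, by simpa using hadj⟩
  · obtain ⟨u, hu, hadj⟩ := hH v
    exact ⟨.inr u, by simpa using hu, by simpa using hadj⟩

theorem simplicialFree_critGraph10 : SimplicialFree critGraph10 :=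
  (simplicialFree_critGraph5.graphJoin simplicialFree_critGraph5).iso critGraph10Iso

/-- Classification of the critical graphs without simplicial vertices that have five more vertices
than colours are excluded. -/
theorem Crit.classify_simplicialFree [Fintype V] (h : Crit G m) (hs : SimplicialFree G)
    (hcard : Fintype.card V = m + 5) :
    (m = 2 ∧ AreIso G critGraph7) ∨ (m = 3 ∧ ∃ i, AreIso G (critGraph8 i)) ∨
      (m = 4 ∧ ∃ i, AreIso G (critGraph9 i)) ∨ (m = 5 ∧ AreIso G critGraph10) := by
  classical
  by_cases hconn : CutConn G
  · have := h.two_mul_add_one_le hconn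
    have := h.two_le hs
    have hm : m = 2 ∨ m = 3 ∨ m = 4 := by omega
    let f := G.overFinIso hcard
    have hf := h.iso f
    have hc := hconn.iso f
    rcases hm with rfl | rfl | rfl
    · exact .inl ⟨rfl, AreIso.trans ⟨f⟩ (hf.iso_critGraph7_of_cutConn hc)⟩
    · obtain ⟨i, hi⟩ := hf.iso_critGraph8_of_cutConn hc
      exact .inr (.inl ⟨rfl, i, AreIso.trans ⟨f⟩ hi⟩)
    · obtain ⟨i, hi⟩ := hf.iso_critGraph9_of_cutConn hc
      exact .inr (.inr (.inl ⟨rfl, i, AreIso.trans ⟨f⟩ hi⟩))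
  -- Since `m + 5 = (a + 3) + (b + 3)`, both factors attain the minimal order and are 5-cycles.
  · obtain ⟨X, a, b, hab, hX, -, -, ha, hb, hsa, hsb⟩ := h.exists_simplicialFree_split hs hconn
    have := card_add_card_compl X
    have := ha.add_three_le hsa
    have := hb.add_three_le hsb
    obtain ⟨rfl, ⟨f⟩⟩ := ha.iso_critGraph5_of_card hsa (by omega)
    obtain ⟨rfl, ⟨g⟩⟩ := hb.iso_critGraph5_of_card hsb (by omega)
    exact .inr (.inr (.inr ⟨by omega, ⟨(isoGraphJoin hX).symm.trans
      ((graphJoinCongr f g).trans critGraph10Iso)⟩⟩))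

theorem crit_top (s : ℕ) : Crit (⊤ : SimpleGraph (Fin (s + 1))) s := by
  have hcard := fun v : Fin (s + 1) => colOn_card (G := (⊤ : SimpleGraph (Fin (s + 1)))) (Finset.univ.erase v)
  have hvert : ∀ v : Fin (s + 1), ColOn (⊤ : SimpleGraph (Fin (s + 1))) {v}ᶜ s := fun v =>
    (hcard v).mono (by intro u hu; simpa using hu)
      (by rw [Finset.card_erase_of_mem (Finset.mem_univ _), Finset.card_univ, Fintype.card_fin]; omega)
  refine ⟨fun ⟨c⟩ => ?_, hvert, fun u v huv => ?_⟩
  · have := Fintype.card_le_of_injective c fun u v he => by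
      by_contra hne
      exact c.valid ((SimpleGraph.top_adj u v).2 hne) he
    simp at this
  · obtain ⟨c, hc, hp⟩ := hvert u
    refine colOn_univ_iff.1 ⟨fun w => if w = u then c v else c w, fun w _ => ?_, fun w _ z _ hwz => ?_⟩
    · by_cases hw : w = u
      · simpa [hw] using hc v huv.ne'
      · simpa [hw] using hc w hw
    · have key : ∀ z, z ≠ u → z ≠ v → c v ≠ c z := fun z h1 h2 =>
        hp v huv.ne' z h1 (by simpa using h2.symm)
      simp only [SimpleGraph.deleteEdges_adj, SimpleGraph.top_adj, Set.mem_singleton_iff,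
        Sym2.eq_iff] at hwz
      by_cases hw : w = u <;> by_cases hz : z = u
      · exact absurd (hw.trans hz.symm) hwz.1
      · simpa [hw, hz] using key z hz (by tauto)
      · simpa [hw, hz] using (key w hw (by tauto)).symm
      · simpa [hw, hz] using hp w hw z hz hwz.1

/-- This is a join with a critical clique. The case of no added vertex is separate because the empty
graph is not critical in this sense. -/
theorem Crit.addSimplicial (h : Crit G k) (s : ℕ) : Crit (addSimplicial G s) (k + s) := by
  cases s with
  | zero =>
    obtain ⟨f⟩ := areIso_addSimplicial_zero G
    exact h.iso f.symm
  | succ s => exact h.graphJoin (crit_top s)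

theorem Crit.card_of_eq_top [Fintype V] (h : Crit G m) (hG : ∀ u v, u ≠ v → G.Adj u v) :
    Fintype.card V = m + 1 := by
  classical
  refine le_antisymm ?_ ?_
  · obtain ⟨c⟩ := h.colorable_succ
    have hc : Function.Injective c := fun u v he => by
      by_contra hne
      exact c.valid (hG u v hne) he
    simpa using Fintype.card_le_of_injective c hc
  · by_contra! hlt
    exact h.not_col (colOn_univ_iff.1 ((colOn_card Finset.univ).mono (by simp)
      (by rw [Finset.card_univ]; omega)))

/-- A critical graph that is not complete arises from a critical graph without simplicial vertices
by adding simplicial vertices. -/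
theorem Crit.exists_core [Fintype V] (h : Crit G m) (hcard : m + 1 < Fintype.card V) :
    ∃ (X : Set V) (k s : ℕ), k + s = m ∧ Crit (G.induce X) k ∧ SimplicialFree (G.induce X) ∧
      AreIso G (_root_.addSimplicial (G.induce X) s) := by
  classical
  -- The non-simplicial vertices. Their complement, if not empty, is a critical clique on `b + 1`
  -- vertices, whence `s = b + 1` below.
  let X : Set V := {v | ∃ u, u ≠ v ∧ ¬ G.Adj v u}
  have hXc : ∀ v ∈ Xᶜ, ∀ u, u ≠ v → G.Adj v u := fun v hv u hu => by
    by_contra hadj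
    exact hv ⟨u, hu, hadj⟩
  have hX : ∀ u ∈ X, ∀ v ∈ Xᶜ, G.Adj u v := fun u hu v hv =>
    (hXc v hv u fun he => hv (he ▸ hu)).symm
  have hs : SimplicialFree (G.induce X) := by
    rintro ⟨v, u, hu, hadj⟩
    exact ⟨⟨u, v, hu.symm, fun h => hadj h.symm⟩, fun he => hu (congrArg Subtype.val he),
      by simpa using hadj⟩
  rcases Xᶜ.eq_empty_or_nonempty with he | hne'
  · rw [Set.compl_empty_iff] at he
    refine ⟨X, m, 0, by omega, ?_, hs, ?_⟩
    · rw [he]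
      exact h.iso (SimpleGraph.induceUnivIso G).symm
    · refine AreIso.trans ?_ (areIso_addSimplicial_zero _).symm
      rw [he]
      exact ⟨(SimpleGraph.induceUnivIso G).symm⟩
  · have hne : X.Nonempty := by
      by_contra hne
      have := h.card_of_eq_top fun u v huv =>
        hXc u (fun hu => hne ⟨u, hu⟩) v huv.symm
      omega
    obtain ⟨a, b, hab, ha, hb⟩ := h.exists_split hX hne hne'
    have htop : G.induce Xᶜ = ⊤ := by
      ext u v
      simpa using ⟨fun hadj he => hadj.ne (congrArg Subtype.val he),
        fun hne => hXc u u.2 v fun he => hne (Subtype.ext he.symm)⟩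
    have hcard := hb.card_of_eq_top fun u v huv => by rw [htop]; exact huv
    refine ⟨X, a, b + 1, by omega, ha, hs, ⟨(isoGraphJoin hX).symm.trans
      (graphJoinCongr SimpleGraph.Iso.refl ?_)⟩⟩
    rw [htop]
    exact SimpleGraph.Iso.completeGraph (Fintype.equivFinOfCardEq hcard)

/-- Passing to the core keeps the difference: `k + s = m` and `|X| + s = m + 5` give `|X| = k + 5`.
-/
theorem Crit.classify [Fintype V] (h : Crit G m) (hcard : Fintype.card V = m + 5) (hm : 5 ≤ m) :
    AreIso G (_root_.addSimplicial critGraph7 (m - 2)) ∨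
      (∃ i, AreIso G (_root_.addSimplicial (critGraph8 i) (m - 3))) ∨
      (∃ i, AreIso G (_root_.addSimplicial (critGraph9 i) (m - 4))) ∨
      AreIso G (_root_.addSimplicial critGraph10 (m - 5)) := by
  classical
  obtain ⟨X, k, s, hks, hk, hs, hiso⟩ := h.exists_core (by omega)
  have hX := hiso.card_eq
  rw [Fintype.card_sum, Fintype.card_fin] at hX
  rcases hk.classify_simplicialFree hs (by omega) with ⟨rfl, hc⟩ | ⟨rfl, i, hc⟩ | ⟨rfl, i, hc⟩ | ⟨rfl, hc⟩
  · obtain rfl : s = m - 2 := by omega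
    exact .inl (hiso.trans (hc.addSimplicial _))
  · obtain rfl : s = m - 3 := by omega
    exact .inr (.inl ⟨i, hiso.trans (hc.addSimplicial _)⟩)
  · obtain rfl : s = m - 4 := by omega
    exact .inr (.inr (.inl ⟨i, hiso.trans (hc.addSimplicial _)⟩))
  · obtain rfl : s = m - 5 := by omega
    exact .inr (.inr (.inr (hiso.trans (hc.addSimplicial _))))

/-- Simplicial vertices are not excluded here, but a join with `a + b = 1` has only three vertices.
-/
theorem Crit.iso_critGraph7_of_two {G : SimpleGraph (Fin 7)} (h : Crit G 2) :
    AreIso G critGraph7 := by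
  classical
  refine h.iso_critGraph7_of_cutConn ?_
  by_contra hconn
  obtain ⟨X, hne, hne', hX⟩ := exists_join_of_not_cutConn hconn
  obtain ⟨a, b, hab, ha, hb⟩ := h.exists_split hX hne hne'
  have hc := card_add_card_compl X
  rw [Fintype.card_fin] at hc
  have : (a = 0 ∧ b = 1) ∨ (a = 1 ∧ b = 0) := by omega
  rcases this with ⟨rfl, rfl⟩ | ⟨rfl, rfl⟩
  · rw [ha.card_of_zero, hb.card_of_one] at hc
    omega
  · rw [ha.card_of_one, hb.card_of_zero] at hc
    omega

end Structure

/-! ### Counting isomorphism classes. -/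

section Count

variable {m : ℕ}

/-- The index set of the list of graphs. -/
abbrev CoreIndex : Type := (Unit ⊕ Fin 4) ⊕ (Fin 16 ⊕ Unit)

/-- The critical graphs with `m + 5` vertices. -/
noncomputable def critGraph (m : ℕ) (hm : 5 ≤ m) : CoreIndex → SimpleGraph (Fin (m + 5)) :=
  Sum.elim
    (Sum.elim (fun _ => (addSimplicial critGraph7 (m - 2)).overFin (by simp; omega))
      fun i => (addSimplicial (critGraph8 i) (m - 3)).overFin (by simp; omega))
    (Sum.elim (fun i => (addSimplicial (critGraph9 i) (m - 4)).overFin (by simp; omega))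
      fun _ => (addSimplicial critGraph10 (m - 5)).overFin (by simp; omega))

theorem areIso_overFin {V : Type*} [Fintype V] (G : SimpleGraph V) {n : ℕ} (h : Fintype.card V = n) :
    AreIso G (G.overFin h) := ⟨G.overFinIso h⟩

theorem areIso_of_areIso_overFin {V W : Type*} [Fintype V] [Fintype W] {G : SimpleGraph V}
    {H : SimpleGraph W} (hG : SimplicialFree G) (hH : SimplicialFree H) {n s t : ℕ}
    (hV : Fintype.card (V ⊕ Fin s) = n) (hW : Fintype.card (W ⊕ Fin t) = n)
    (h : AreIso ((addSimplicial G s).overFin hV) ((addSimplicial H t).overFin hW)) : AreIso G H :=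
  hG.areIso_of_addSimplicial hH
    (((areIso_overFin _ hV).trans h).trans (areIso_overFin _ hW).symm)

/-- After cancelling the simplicial vertices, cores from different families differ in order (7 to
10), and those of one family are told apart by the triangle invariant. -/
theorem critGraph_injective (hm : 5 ≤ m) {i j : CoreIndex}
    (h : AreIso (critGraph m hm i) (critGraph m hm j)) : i = j := by
  rcases i with (i | i) | (i | i) <;> rcases j with (j | j) | (j | j) <;>
    simp only [critGraph, Sum.elim_inl, Sum.elim_inr] at h <;>
    have h' := areIso_of_areIso_overFin
      (by first
        | exact simplicialFree_critGraph7
        | exact simplicialFree_critGraph8 _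
        | exact simplicialFree_critGraph9 _
        | exact simplicialFree_critGraph10)
      (by first
        | exact simplicialFree_critGraph7
        | exact simplicialFree_critGraph8 _
        | exact simplicialFree_critGraph9 _
        | exact simplicialFree_critGraph10) _ _ h <;>
    first
    | rfl
    | rw [injective_critGraph8 h']
    | rw [injective_critGraph9 h']
    | exact absurd h'.card_eq (by simp)

/-- The bound `5 ≤ m` makes every truncated subtraction a genuine one, so each core contributes a
graph of the right chromatic number. -/
theorem crit_iff_areIso {V : Type*} [Fintype V] {G : SimpleGraph V}
    (hcard : Fintype.card V = m + 5) (hm : 5 ≤ m) :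
    Crit G m ↔ AreIso G (addSimplicial critGraph7 (m - 2)) ∨
      (∃ i, AreIso G (addSimplicial (critGraph8 i) (m - 3))) ∨
      (∃ i, AreIso G (addSimplicial (critGraph9 i) (m - 4))) ∨
      AreIso G (addSimplicial critGraph10 (m - 5)) := by
  refine ⟨fun h => h.classify hcard hm, ?_⟩
  have key : ∀ {U : Type} {H : SimpleGraph U} {k : ℕ}, Crit H k → k ≤ m →
      AreIso G (addSimplicial H (m - k)) → Crit G m := by
    rintro U H k hH hk ⟨f⟩
    have := (hH.addSimplicial (m - k)).iso f.symm
    rwa [Nat.add_sub_cancel' hk] at this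
  rintro (h | ⟨i, h⟩ | ⟨i, h⟩ | h)
  · exact key crit_critGraph7 (by omega) h
  · exact key (crit_critGraph8 i) (by omega) h
  · exact key (crit_critGraph9 i) (by omega) h
  · exact key crit_critGraph10 (by omega) h

theorem crit_iff_exists_critGraph (hm : 5 ≤ m) {G : SimpleGraph (Fin (m + 5))} :
    Crit G m ↔ ∃ i, AreIso (critGraph m hm i) G := by
  have flip : ∀ {V : Type} [Fintype V] (H : SimpleGraph V) (h : Fintype.card V = m + 5),
      AreIso G H ↔ AreIso (H.overFin h) G := fun H h =>
    ⟨fun h' => (h'.trans (areIso_overFin H h)).symm, fun h' => h'.symm.trans (areIso_overFin H h).symm⟩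
  rw [crit_iff_areIso (by simp) hm]
  simp only [Sum.exists, critGraph, Sum.elim_inl, Sum.elim_inr, ← flip, exists_const, or_assoc]

theorem numCritical_eq (hm : 5 ≤ m) : numCritical (m + 1) (m + 5) = 22 := by
  have hset : {q : Quotient (isoSetoid (m + 5)) | ∃ G : SimpleGraph (Fin (m + 5)),
      IsCritical (m + 1) G ∧ Quotient.mk (isoSetoid (m + 5)) G = q} =
      (fun i => Quotient.mk (isoSetoid (m + 5)) (critGraph m hm i)) '' Set.univ := by
    ext q
    constructor
    · rintro ⟨G, hG, rfl⟩
      obtain ⟨i, hi⟩ := (crit_iff_exists_critGraph hm).1 (isCritical_iff.1 hG)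
      exact ⟨i, trivial, Quotient.sound hi⟩
    · rintro ⟨i, -, rfl⟩
      exact ⟨_, isCritical_iff.2 ((crit_iff_exists_critGraph hm).2 ⟨i, ⟨SimpleGraph.Iso.refl⟩⟩), rfl⟩
  rw [numCritical, hset, Set.ncard_image_of_injective, Set.ncard_univ, Nat.card_eq_fintype_card]
  · simp
  · intro i j hij
    exact critGraph_injective hm (Quotient.exact hij)

end Count

theorem mainTheorem7 :
    (∀ r : ℕ, 6 ≤ r → numCritical r (r + 4) = 22) ∧
    ∃ (A : SimpleGraph (Fin 7)) (B : Fin 4 → SimpleGraph (Fin 8))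
      (C : Fin 16 → SimpleGraph (Fin 9)) (D : SimpleGraph (Fin 10)),
      (IsCritical 3 A ∧ ∀ H : SimpleGraph (Fin 7), IsCritical 3 H → AreIso H A) ∧
      ((∀ i, IsCritical 4 (B i)) ∧ ∀ i j, AreIso (B i) (B j) → i = j) ∧
      ((∀ i, IsCritical 5 (C i)) ∧ ∀ i j, AreIso (C i) (C j) → i = j) ∧
      IsCritical 6 D ∧
      ∀ r : ℕ, 6 ≤ r → ∀ G : SimpleGraph (Fin (r + 4)),
        IsCritical r G ↔
          AreIso G (addSimplicial A (r - 3)) ∨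
          (∃ i, AreIso G (addSimplicial (B i) (r - 4))) ∨
          (∃ i, AreIso G (addSimplicial (C i) (r - 5))) ∨
          AreIso G (addSimplicial D (r - 6)) := by
  refine ⟨fun r hr => ?_, critGraph7, critGraph8, critGraph9, critGraph10,
    ⟨isCritical_iff.2 crit_critGraph7, fun H hH => (isCritical_iff.1 hH).iso_critGraph7_of_two⟩,
    ⟨fun i => isCritical_iff.2 (crit_critGraph8 i), fun i j => injective_critGraph8⟩,
    ⟨fun i => isCritical_iff.2 (crit_critGraph9 i), fun i j => injective_critGraph9⟩,
    isCritical_iff.2 crit_critGraph10, fun r hr G => ?_⟩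
  · obtain ⟨m, rfl⟩ : ∃ m, r = m + 1 := ⟨r - 1, by omega⟩
    exact numCritical_eq (by omega)
  · obtain ⟨m, rfl⟩ : ∃ m, r = m + 1 := ⟨r - 1, by omega⟩
    rw [isCritical_iff]
    exact crit_iff_areIso (by simp) (by omega)
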